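/- **Setting.** Identify $\mathbb{R}^2$ with $\mathbb{C}$, $z=x_1+\mathrm{i}x_2$. Fix $0<r_i<r_e$. For $0<\epsilon<r_e-r_i$ and $k>0$ let $\Omega=\{|\mathbf{x}-(r_e,0)|<r_e\}$ and $D=D_\epsilon=\{|\mathbf{x}-(r_i+\epsilon,0)|<r_i\}$, so that $\overline D\subset\Omega$ and $\operatorname{dist}(D,\partial\Omega)=\epsilon$. For a mean-zero function $g_d$ on $\partial\Omega$ let $v=v_{\epsilon,k}$ be the solution of $$\Delta v=0 \text{ in } D\cup(\Omega\setminus\overline D),\qquad v|_+=v|_-,\quad \frac{\partial v}{\partial\nu}\Big|_+=k\,\frac{\partial v}{\partial\nu}\Big|_-\ \text{ on }\partial D,\qquad v=g_d\ \text{ on }\partial\Omega,$$ where $\nu$ is the outward unit normal and $\pm$ denote limits from outside and inside $D$. Set $\tau=\frac{k-1}{k+1}$, $r_*=\sqrt{\frac{2r_ir_e}{r_e-r_i}}$ and, for $k>1$, $\beta=\frac{r_*(-\ln|\tau|)}{4\sqrt\epsilon}$. Let $c_i=\frac{r_e^2-r_i^2-(r_e-r_i-\epsilon)^2}{2(r_e-r_i-\epsilon)}$,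 $c_e=c_i+r_e-r_i-\epsilon$, $x_0=c_e-r_e$ and $$\alpha=\frac{\sqrt{\epsilon(2r_i+\epsilon)(2r_e-\epsilon)(2r_e-2r_i-\epsilon)}}{2(r_e-r_i-\epsilon)},\qquad \xi_i=\tfrac12\ln\frac{c_i+\alpha}{c_i-\alpha},\qquad \xi_e=\tfrac12\ln\frac{c_e+\alpha}{c_e-\alpha}.$$ Bipolar coordinates $(\xi,\theta)$ are defined by $\mathbf{x}(\xi,\theta)=\alpha\,\frac{e^{\xi+\mathrm{i}\theta}-1}{e^{\xi+\mathrm{i}\theta}+1}$, and $\mathbf{e}_\xi=\nabla\xi/|\nabla\xi|$. The translated set $(x_0,0)+(\Omega\setminus\overline D)$ is $\{\mathbf{x}(\xi,\theta):\xi_e<\xi<\xi_i,\ -\pi<\theta\le\pi\}$. For $|z|<1$ and $\beta>0$ put $$P(z;\beta)=\int_0^\infty\frac{z e^{-(\beta+1)t}}{(1+ze^{-t})^2}\,dt .$$ Let $H_d=2\mathcal{D}_{\partial\Omega}[g_d]$ in $\Omega$, where $\mathcal{D}_{\partial\Omega}[\phi](\mathbf{x})=\frac1{2\pi}\int_{\partial\Omega}\frac{\partial}{\partial\nu_\zeta}\ln|\mathbf{x}-\zeta|\,\phi(\zeta)\,d\sigma(\zeta)$;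 this is the harmonic function in $\Omega$ with boundary values $g_d$. **Theorem.** Let $g_d$ be a mean-zero function on $\partial\Omega$ with $g_d\in C^{2,\delta}(\partial\Omega)$ for some $\delta>1/2$. All constants below may depend on $r_i,r_e,g_d$. 1. There is $C$ such that $\|\nabla v\|_{L^\infty(D)}\le C$ for all $0<\epsilon<r_e-r_i$ and all $k>0$. 2. $\|\nabla v\|_{L^\infty(\Omega\setminus\overline D)}$ can blow up only if both $\epsilon\to0$ and $k\to\infty$ (i.e. $\tau\to1$): for all $\epsilon_0>0$ and $K>0$ there is $C$, depending also on $\epsilon_0$ and $K$, such that $\|\nabla v\|_{L^\infty(\Omega\setminus\overline D)}\le C$ for all $0<\epsilon<r_e-r_i$ and $k>0$ with $\epsilon\ge\epsilon_0$ or $k\le K$. 3. The limit $(C_1,C_2)=\lim_{\Omega\ni\mathbf{x}\to(0,0)}\nabla H_d(\mathbf{x})$ exists. For $s=2\xi_i-\xi$, and also for $s=\xi+2\xi_i$, $$\nabla v\big(\mathbf{x}(\xi,\theta)-(x_0,0)\big)=\frac{r_*\tau}{\sqrt\epsilon}(\cosh\xi+\cos\theta)\Big[C_1\,\mathrm{Re}\,P\big(e^{-s-\mathrm{i}\theta};\beta\big)+C_2\,\mathrm{Im}\,P\big(e^{-s-\mathrm{i}\theta};\beta\big)\Big]\mathbf{e}_\xi\big(\mathbf{x}(\xi,\theta)\big)+O(1),$$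 where the $O(1)$ term is bounded uniformly for $0<\epsilon<r_e-r_i$, $k>1$, $\xi_e<\xi<\xi_i$ and $-\pi<\theta\le\pi$. -/

import Mathlib

open Set Filter Topology InnerProductSpace
open scoped NNReal

/-! The plane `ℝ²` is identified with `ℂ` (as a real inner product space), `(x₁, x₂) = x₁ + i x₂`. -/

noncomputable section

namespace DirichletInclusion

/-- The outer disk `Ω`, of radius `rₑ`, centred at `(rₑ, 0)`; it touches the origin. -/
def Omega (re : ℝ) : Set ℂ := Metric.ball (re : ℂ) re

/-- The centre `(rᵢ + ε, 0)` of the inclusion. -/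
def centerD (ri ε : ℝ) : ℂ := ((ri + ε : ℝ) : ℂ)

/-- The inclusion `D`, of radius `rᵢ`; for `0 < ε < rₑ - rᵢ` its distance to `∂Ω` is `ε`. -/
def Inclusion (ri ε : ℝ) : Set ℂ := Metric.ball (centerD ri ε) ri

/-- `g ∈ C^{2,δ}(∂Ω)`: in the angular parametrization of the circle `∂Ω` the function is twice
continuously differentiable with `δ`-Hölder continuous second derivative. -/
def IsC2Holder (re : ℝ) (δ : ℝ≥0) (g : ℂ → ℝ) : Prop :=
  ContDiff ℝ 2 (fun t : ℝ => g (circleMap (re : ℂ) re t)) ∧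
    ∃ K : ℝ≥0, HolderWith K δ (iteratedDeriv 2 (fun t : ℝ => g (circleMap (re : ℂ) re t)))

/-- `g` has mean zero over the circle `∂Ω`. -/
def MeanZero (re : ℝ) (g : ℂ → ℝ) : Prop :=
  ∫ t in (0 : ℝ)..(2 * Real.pi), g (circleMap (re : ℂ) re t) = 0

/-- `v` solves the Dirichlet transmission problem: it is harmonic in `D` and in `Ω \ D̄`, continuous
up to `∂Ω` and across `∂D`, equals `g` on `∂Ω`, and at every point of `∂D` its exterior and interior
normal derivatives (along the outward unit normal `ν`) exist and satisfy `∂v/∂ν|₊ = k ∂v/∂ν|₋`. -/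
structure IsSolution (ri re ε k : ℝ) (g v : ℂ → ℝ) : Prop where
  harmonic_inside : HarmonicOnNhd v (Inclusion ri ε)
  harmonic_outside : HarmonicOnNhd v (Omega re \ closure (Inclusion ri ε))
  continuous : ContinuousOn v (closure (Omega re))
  boundary : ∀ x ∈ frontier (Omega re), v x = g x
  transmission : ∀ x ∈ frontier (Inclusion ri ε), ∀ ν : ℂ, ν = (ri⁻¹ : ℝ) • (x - centerD ri ε) →
    ∃ a b : ℝ, HasDerivWithinAt (fun t : ℝ => v (x + t • ν)) a (Ici 0) 0 ∧
      HasDerivWithinAt (fun t : ℝ => v (x + t • ν)) b (Iic 0) 0 ∧ a = k * b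

/-- The double-layer potential on the circle `∂Ω`, at a point `x` off the circle:
`(1 / 2π) ∫_{∂Ω} ∂/∂ν_ζ (ln |x - ζ|) φ(ζ) dσ(ζ)`, with `ζ = rₑ + rₑ e^{it}`, `ν_ζ = e^{it}` and
`dσ = rₑ dt`. -/
def doubleLayer (re : ℝ) (φ : ℂ → ℝ) (x : ℂ) : ℝ :=
  1 / (2 * Real.pi) * ∫ t in (0 : ℝ)..(2 * Real.pi),
    lineDeriv ℝ (fun ζ : ℂ => Real.log ‖x - ζ‖) (circleMap (re : ℂ) re t)
      (Complex.exp (t * Complex.I)) * φ (circleMap (re : ℂ) re t) * re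

/-- The harmonic function `H_d = 2 𝒟_{∂Ω}[g]` in `Ω`. -/
def Hd (re : ℝ) (g : ℂ → ℝ) (x : ℂ) : ℝ := 2 * doubleLayer re g x

/-- `r_* = √(2 rᵢ rₑ / (rₑ - rᵢ))`. -/
def rStar (ri re : ℝ) : ℝ := Real.sqrt (2 * ri * re / (re - ri))

/-- `τ = (k - 1) / (k + 1)`. -/
def tau (k : ℝ) : ℝ := (k - 1) / (k + 1)

/-- `β = r_* (- ln |τ|) / (4 √ε)` (used for `k > 1`). -/
def beta (ri re ε k : ℝ) : ℝ := rStar ri re * (-Real.log |tau k|) / (4 * Real.sqrt ε)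

/-- The abscissa `cᵢ` of the centre of the translated inclusion. -/
def ci (ri re ε : ℝ) : ℝ := (re ^ 2 - ri ^ 2 - (re - ri - ε) ^ 2) / (2 * (re - ri - ε))

/-- The abscissa `cₑ` of the centre of the translated outer disk. -/
def ce (ri re ε : ℝ) : ℝ := ci ri re ε + re - ri - ε

/-- The translation distance `x₀ = cₑ - rₑ`. -/
def x0 (ri re ε : ℝ) : ℝ := ce ri re ε - re

/-- The poles of the bipolar coordinates are `(± α, 0)`. -/
def alpha (ri re ε : ℝ) : ℝ :=
  Real.sqrt (ε * (2 * ri + ε) * (2 * re - ε) * (2 * re - 2 * ri - ε)) / (2 * (re - ri - ε))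

/-- The value `ξᵢ` of the coordinate `ξ` on the (translated) circle `∂D`. -/
def xiI (ri re ε : ℝ) : ℝ :=
  1 / 2 * Real.log ((ci ri re ε + alpha ri re ε) / (ci ri re ε - alpha ri re ε))

/-- The value `ξₑ` of the coordinate `ξ` on the (translated) circle `∂Ω`. -/
def xiE (ri re ε : ℝ) : ℝ :=
  1 / 2 * Real.log ((ce ri re ε + alpha ri re ε) / (ce ri re ε - alpha ri re ε))

/-- The point `x(ξ, θ)` with bipolar coordinates `(ξ, θ)` for the poles `(± α, 0)`. -/
def bipolar (α ξ θ : ℝ) : ℂ :=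
  α * ((Complex.exp (ξ + θ * Complex.I) - 1) / (Complex.exp (ξ + θ * Complex.I) + 1))

/-- The bipolar coordinate `ξ` as a function on the plane: `e^{ξ + iθ} = (α + z) / (α - z)`. -/
def xiCoord (α : ℝ) (z : ℂ) : ℝ := Real.log ‖(α + z) / (α - z)‖

/-- The unit vector `e_ξ = ∇ξ / |∇ξ|`. -/
def eXi (α : ℝ) (z : ℂ) : ℂ := ‖gradient (xiCoord α) z‖⁻¹ • gradient (xiCoord α) z

/-- `P(z; β) = ∫₀^∞ z e^{-(β+1)t} / (1 + z e^{-t})² dt`, for `|z| < 1`, `β > 0`. -/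
def P (z : ℂ) (β : ℝ) : ℂ :=
  ∫ t in Ioi (0 : ℝ), z * Complex.exp (-(β + 1) * t) / (1 + z * Complex.exp (-t)) ^ 2

/-- The scalar factor
`(r_* τ / √ε) (cosh ξ + cos θ) [C₁ Re P(e^{-s - iθ}; β) + C₂ Im P(e^{-s - iθ}; β)]`. -/
def singularPart (ri re ε k C₁ C₂ ξ θ s : ℝ) : ℝ :=
  rStar ri re * tau k / Real.sqrt ε * (Real.cosh ξ + Real.cos θ) *
    (C₁ * (P (Complex.exp (-s - θ * Complex.I)) (beta ri re ε k)).re +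
      C₂ * (P (Complex.exp (-s - θ * Complex.I)) (beta ri re ε k)).im)

end DirichletInclusion

end

open Set Filter Topology InnerProductSpace
open scoped NNReal

noncomputable section

/-! The data enter through one holomorphic function. Since `δ > 1/2`, Bernstein's theorem applied to
the second angular derivative of `g` makes `∑ n² |a_n|` finite for the Fourier coefficients `a_n`.
Hence `g = Re F` on `∂Ω`, where `F` is holomorphic in `Ω` with derivative `F₁` Lipschitz up to the
boundary, and `H_d = Re F` (`exists_holomorphic_extension`). The gradient of a real part `Re f` is
the conjugate of `f'`, so `(C₁, C₂)` is the conjugate of `F₁(0)`.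

The two circles lie in one Apollonius family, so the Möbius map `w = e^{-(ξ + iθ)}` makes them
concentric, with radii `ρᵢ < ρₑ < 1`. There the problem is solved by images. Put `q = (ρᵢ/ρₑ)²` and
`S(W) = ∑ τ^m F(z(q^m W))`. The solution is the real part of `(1 - τ) S(w)` inside and of `S(w) - τ
conj S(w*)` outside, `w*` being the reflection of `w` in `|w| = ρᵢ`. The Dirichlet condition is the
identity `S(W) - τ S(qW) = F(z(W))`, and a maximum principle shows that there is no other solution
(`IsSolution.eq_potential`).

Differentiation turns `S` into sums `∑ τ^m M(s q^m) F₁(z(s q^m W))` with weight `M(x) = x (1 + W)² /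
(1 + xW)²`. Everything rests on the behaviour of `M` on `[0, 1]`, uniformly for `|W| < 1`: it is
bounded by `1`, and its increments are dominated by those of a bounded increasing function
(`norm_kerM_sub_le_majorant`). Three consequences follow. Summation by parts bounds the sum of the
weights by `O(1/(1 - τ))`, and inside the inclusion the prefactor `1 - τ` absorbs this. Replacing
`F₁(z(·))` by `F₁(0)` costs `O(1)`, because the points `z(·)` are small where the weights are large
(`Admissible.norm_gradSeries_sub_le`). The sum differs by `O(1)` from `∫ e^{-lt} M(s e^{-ht}) dt`,
where `τ = e^{-l}` and `q = e^{-h}`, even when `s` is moved within `[q^J, 1]`; this freedom is why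
two values of `s` serve in the asymptotic formula.

For small `ε` one has `h = 4√ε/r_* + O(ε)`, so `h` may be replaced by its leading term at cost
`O(1)`. The substitution `u = ht` then produces `P(·; β)`, and the direct and reflected terms
combine into a real multiple of `e_ξ` (`singularPart_smul_eXi`). For `ε` bounded below, `q` stays
away from `1` and the series converge geometrically. -/

namespace DirichletInclusion

/-! ### Fourier coefficients of `2π`-periodic functions -/

/-- The Fourier coefficient `(1 / 2π) ∫ e^{-int} f(t) dt` of a `2π`-periodic function. -/
def circleCoeff (f : ℝ → ℂ) (n : ℤ) : ℂ :=
  (1 / (2 * Real.pi) : ℝ) * ∫ t in (0 : ℝ)..(2 * Real.pi), Complex.exp (-(n * t * Complex.I)) * f t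

theorem circleCoeff_eq_fourierCoeffOn (f : ℝ → ℂ) (n : ℤ) :
    circleCoeff f n = fourierCoeffOn Real.two_pi_pos f n := by
  rw [fourierCoeffOn_eq_integral, circleCoeff, sub_zero, Complex.real_smul]
  congr 1
  refine intervalIntegral.integral_congr fun t _ => ?_
  simp only [smul_eq_mul]
  rw [fourier_coe_apply]
  congr 2
  have : (Real.pi : ℂ) ≠ 0 := by exact_mod_cast Real.pi_ne_zero
  push_cast
  field_simp

/-- Bessel's inequality, read off from Parseval's identity. -/
theorem sum_sq_circleCoeff_le {f : ℝ → ℂ} (hf : Continuous f) (s : Finset ℤ) :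
    ∑ n ∈ s, ‖circleCoeff f n‖ ^ 2 ≤
      (2 * Real.pi)⁻¹ * ∫ t in (0 : ℝ)..(2 * Real.pi), ‖f t‖ ^ 2 := by
  have hL : MeasureTheory.MemLp f 2
      (MeasureTheory.volume.restrict (Ioc (0 : ℝ) (2 * Real.pi))) := by
    refine (MeasureTheory.memLp_two_iff_integrable_sq_norm
      hf.aestronglyMeasurable).2 ?_
    exact ((hf.norm.pow 2).intervalIntegrable 0 (2 * Real.pi)).1
  have h := hasSum_sq_fourierCoeffOn Real.two_pi_pos hL
  simp_rw [circleCoeff_eq_fourierCoeffOn]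
  rw [sub_zero, smul_eq_mul] at h
  exact sum_le_hasSum s (fun _ _ => by positivity) h

theorem circleCoeff_sub {f₁ f₂ : ℝ → ℂ} (h₁ : Continuous f₁) (h₂ : Continuous f₂) (n : ℤ) :
    circleCoeff (fun t => f₁ t - f₂ t) n = circleCoeff f₁ n - circleCoeff f₂ n := by
  simp only [circleCoeff, mul_sub]
  rw [intervalIntegral.integral_sub, mul_sub] <;>
  exact Continuous.intervalIntegrable (by fun_prop) _ _

theorem circleCoeff_shift {f : ℝ → ℂ} (hp : Function.Periodic f (2 * Real.pi))
    (s : ℝ) (n : ℤ) :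
    circleCoeff (fun t => f (t + s)) n = Complex.exp (n * s * Complex.I) * circleCoeff f n := by
  simp only [circleCoeff]
  set F : ℝ → ℂ := fun t => Complex.exp (-(n * t * Complex.I)) * f t with hF
  have hFp : Function.Periodic F (2 * Real.pi) := by
    intro t
    simp only [hF, hp t]
    congr 1
    rw [Complex.exp_eq_exp_iff_exists_int]
    exact ⟨-n, by push_cast; ring⟩
  have h1 : ∀ t : ℝ, Complex.exp (-(n * t * Complex.I)) * f (t + s) =
      Complex.exp (n * s * Complex.I) * F (t + s) := by
    intro t
    simp only [hF]
    rw [← mul_assoc, ← Complex.exp_add]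
    congr 2
    push_cast
    ring
  simp_rw [h1]
  rw [intervalIntegral.integral_const_mul, intervalIntegral.integral_comp_add_right]
  have h2 := hFp.intervalIntegral_add_eq s 0
  rw [zero_add] at h2
  rw [zero_add, add_comm (2 * Real.pi) s, h2]
  ring

/-- Integration by parts; periodicity cancels the boundary terms. -/
theorem circleCoeff_deriv {f f' : ℝ → ℂ} (hp : Function.Periodic f (2 * Real.pi))
    (hf : ∀ t, HasDerivAt f (f' t) t) (hf' : Continuous f') (n : ℤ) :
    circleCoeff f' n = n * Complex.I * circleCoeff f n := by
  simp only [circleCoeff]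
  have hu : ∀ t : ℝ, HasDerivAt (fun t : ℝ => Complex.exp (-(n * t * Complex.I)))
      (-(n * Complex.I) * Complex.exp (-(n * t * Complex.I))) t := by
    intro t
    have h : HasDerivAt (fun t : ℝ => -((n : ℂ) * t * Complex.I)) (-(n * 1 * Complex.I)) t :=
      (((Complex.ofRealCLM.hasDerivAt (x := t)).const_mul (n : ℂ)).mul_const Complex.I).neg
    convert h.cexp using 1
    ring
  have h := intervalIntegral.integral_mul_deriv_eq_deriv_mul (a := 0) (b := 2 * Real.pi)
    (u := fun t : ℝ => Complex.exp (-(n * t * Complex.I))) (v := f)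
    (fun t _ => hu t) (fun t _ => hf t)
    (Continuous.intervalIntegrable (by fun_prop) _ _) (hf'.intervalIntegrable _ _)
  have hb : f (2 * Real.pi) = f 0 := by simpa using hp 0
  have he : Complex.exp (-((n : ℂ) * ((2 * Real.pi : ℝ) : ℂ) * Complex.I)) = 1 := by
    rw [Complex.exp_eq_one_iff]
    exact ⟨-n, by push_cast; ring⟩
  rw [h, hb, he]
  simp_rw [mul_assoc (-((n : ℂ) * Complex.I))]
  rw [intervalIntegral.integral_const_mul]
  simp
  ring

theorem norm_exp_sub_one_sq (x : ℝ) :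
    ‖Complex.exp (x * Complex.I) - 1‖ ^ 2 = 2 - 2 * Real.cos x := by
  rw [← Complex.normSq_eq_norm_sq, Complex.normSq_apply]
  simp only [Complex.sub_re, Complex.sub_im, Complex.exp_ofReal_mul_I_re,
    Complex.exp_ofReal_mul_I_im, Complex.one_re, Complex.one_im]
  nlinarith [Real.sin_sq_add_cos_sq x]

/-- The dyadic block estimate behind Bernstein's theorem. -/
theorem sum_circleCoeff_block_le {f : ℝ → ℂ} (hf : Continuous f)
    (hp : Function.Periodic f (2 * Real.pi)) {K δ : ℝ} (hK : 0 ≤ K)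
    (hH : ∀ x y, ‖f x - f y‖ ≤ K * |x - y| ^ δ) (j : ℕ) :
    ∑ n ∈ Finset.Ico (2 ^ j) (2 ^ (j + 1)), ‖circleCoeff f (n : ℕ)‖ ≤
      K * (Real.pi / 2) ^ δ * ((2 : ℝ) ^ (1 / 2 - δ)) ^ j := by
  set N : ℕ := 2 ^ j with hN
  have hN1 : (1 : ℝ) ≤ N := by rw [hN]; exact_mod_cast Nat.one_le_two_pow
  -- For `N ≤ n ≤ 2N` the angle `n s` lies in `[π/2, π]`, so `|e^{ins} - 1|² ≥ 2`: translation by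
  -- `s` does not shrink any coefficient of the block.
  set s : ℝ := Real.pi / (2 * N) with hs
  have hs0 : 0 < s := by positivity
  have hsh : ∀ n : ℤ, circleCoeff (fun t => f (t + s) - f t) n =
      (Complex.exp ((n * s : ℝ) * Complex.I) - 1) * circleCoeff f n := by
    intro n
    rw [circleCoeff_sub (by fun_prop) hf, circleCoeff_shift hp]
    push_cast
    ring
  have hint : (2 * Real.pi)⁻¹ * ∫ t in (0 : ℝ)..(2 * Real.pi), ‖f (t + s) - f t‖ ^ 2 ≤
      (K * s ^ δ) ^ 2 := by
    have h1 : ∫ t in (0 : ℝ)..(2 * Real.pi), ‖f (t + s) - f t‖ ^ 2 ≤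
        ∫ t in (0 : ℝ)..(2 * Real.pi), (K * s ^ δ) ^ 2 := by
      refine intervalIntegral.integral_mono Real.two_pi_pos.le
        (Continuous.intervalIntegrable (by fun_prop) _ _)
        (Continuous.intervalIntegrable (by fun_prop) _ _) fun t => ?_
      have := hH (t + s) t
      rw [add_sub_cancel_left, abs_of_pos hs0] at this
      exact pow_le_pow_left₀ (norm_nonneg _) this 2
    rw [intervalIntegral.integral_const, smul_eq_mul, sub_zero] at h1
    rw [inv_mul_le_iff₀ Real.two_pi_pos]
    exact h1
  have hsq : ∑ n ∈ Finset.Ico N (2 ^ (j + 1)), ‖circleCoeff f (n : ℕ)‖ ^ 2 ≤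
      (K * s ^ δ) ^ 2 := by
    refine le_trans ?_ ((sum_sq_circleCoeff_le (f := fun t => f (t + s) - f t) (by fun_prop)
      ((Finset.Ico N (2 ^ (j + 1))).map Nat.castEmbedding)).trans hint)
    rw [Finset.sum_map]
    refine Finset.sum_le_sum fun n hn => ?_
    rw [Finset.mem_Ico] at hn
    have hn1 : (N : ℝ) ≤ n := by exact_mod_cast hn.1
    have hn2 : (n : ℝ) ≤ 2 * N := by
      have : n ≤ 2 * N := by rw [hN]; have := hn.2; rw [pow_succ] at this; omega
      exact_mod_cast this
    rw [Nat.castEmbedding_apply, hsh, norm_mul, mul_pow, norm_exp_sub_one_sq]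
    have hcos : Real.cos (((n : ℤ) : ℝ) * s) ≤ 0 := by
      have e : ((n : ℤ) : ℝ) * s = Real.pi / 2 * (n / N) := by
        rw [hs]; push_cast; field_simp
      have h1 : 1 ≤ (n : ℝ) / N := by rw [le_div_iff₀ (by linarith)]; linarith
      have h2 : (n : ℝ) / N ≤ 2 := by rw [div_le_iff₀ (by linarith)]; linarith
      rw [e]
      refine Real.cos_nonpos_of_pi_div_two_le_of_le ?_ ?_ <;> nlinarith [Real.pi_pos]
    nlinarith [sq_nonneg ‖circleCoeff f (n : ℤ)‖]
  -- Cauchy–Schwarz over the `N` terms of the block costs `N^{1/2}`, while the Hölder bound gains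
  -- `s^δ = (π/2)^δ N^{-δ}`.
  have hcs := sq_sum_le_card_mul_sum_sq (s := Finset.Ico N (2 ^ (j + 1)))
    (f := fun n : ℕ => ‖circleCoeff f (n : ℕ)‖)
  have hcard : ((Finset.Ico N (2 ^ (j + 1))).card : ℝ) = N := by
    rw [Nat.card_Ico, pow_succ, ← hN]
    congr 1
    omega
  rw [hcard] at hcs
  have hfin : (∑ n ∈ Finset.Ico N (2 ^ (j + 1)), ‖circleCoeff f (n : ℕ)‖) ^ 2 ≤
      (K * (Real.pi / 2) ^ δ * ((2 : ℝ) ^ (1 / 2 - δ)) ^ j) ^ 2 := by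
    refine hcs.trans ((mul_le_mul_of_nonneg_left hsq (by linarith)).trans (le_of_eq ?_))
    have e1 : s ^ δ = (Real.pi / 2) ^ δ * (N : ℝ) ^ (-δ) := by
      rw [hs, ← div_div, Real.div_rpow (by positivity) (by positivity), Real.rpow_neg (by positivity)]
      rfl
    have e2 : ((2 : ℝ) ^ (1 / 2 - δ)) ^ j = (N : ℝ) ^ (1 / 2 - δ) := by
      rw [hN, ← Real.rpow_natCast, ← Real.rpow_mul (by norm_num), mul_comm, Real.rpow_mul (by norm_num)]
      norm_num
    have e3 : (N : ℝ) ^ (1 / 2 - δ) = (N : ℝ) ^ (1 / 2 : ℝ) * (N : ℝ) ^ (-δ) := by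
      rw [← Real.rpow_add (by linarith)]; rfl
    have e4 : ((N : ℝ) ^ (1 / 2 : ℝ)) ^ 2 = N := by
      rw [← Real.sqrt_eq_rpow, Real.sq_sqrt (by linarith)]
    rw [e1, e2, e3]
    calc (N : ℝ) * (K * ((Real.pi / 2) ^ δ * (N : ℝ) ^ (-δ))) ^ 2
        = ((N : ℝ) ^ (1 / 2 : ℝ)) ^ 2 * (K * ((Real.pi / 2) ^ δ * (N : ℝ) ^ (-δ))) ^ 2 := by
          rw [e4]
      _ = _ := by ring
  exact le_of_sq_le_sq hfin (by positivity)

/-- **Bernstein's theorem**: the Fourier series of a `δ`-Hölder function, `δ > 1/2`, converges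
absolutely. -/
theorem summable_circleCoeff_of_holder {f : ℝ → ℂ} (hf : Continuous f)
    (hp : Function.Periodic f (2 * Real.pi)) {K δ : ℝ} (hK : 0 ≤ K) (hδ : 1 / 2 < δ)
    (hH : ∀ x y, ‖f x - f y‖ ≤ K * |x - y| ^ δ) :
    Summable fun n : ℕ => ‖circleCoeff f n‖ := by
  set r : ℝ := (2 : ℝ) ^ (1 / 2 - δ) with hr
  have hr0 : 0 ≤ r := by positivity
  -- The only place where `δ > 1/2` is needed: the dyadic block sums decay geometrically.
  have hr1 : r < 1 := Real.rpow_lt_one_of_one_lt_of_neg (by norm_num) (by linarith)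
  have hblock : ∀ J : ℕ, ∑ n ∈ Finset.range (2 ^ J), ‖circleCoeff f (n : ℕ)‖ ≤
      ‖circleCoeff f (0 : ℕ)‖ + ∑ j ∈ Finset.range J, K * (Real.pi / 2) ^ δ * r ^ j := by
    intro J
    induction J with
    | zero => simp
    | succ J ih =>
      rw [Finset.sum_range_succ, ← Finset.sum_range_add_sum_Ico _
        (Nat.pow_le_pow_right (by norm_num) (Nat.le_succ J))]
      have := sum_circleCoeff_block_le hf hp hK hH J
      linarith
  refine summable_of_sum_range_le (c := ‖circleCoeff f (0 : ℕ)‖ +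
    ∑' j : ℕ, K * (Real.pi / 2) ^ δ * r ^ j) (fun _ => norm_nonneg _) fun n => ?_
  have h1 : ∑ i ∈ Finset.range n, ‖circleCoeff f (i : ℕ)‖ ≤
      ∑ i ∈ Finset.range (2 ^ n), ‖circleCoeff f (i : ℕ)‖ :=
    Finset.sum_le_sum_of_subset_of_nonneg
      (Finset.range_mono Nat.lt_two_pow_self.le) fun _ _ _ => norm_nonneg _
  refine h1.trans ((hblock n).trans ?_)
  gcongr
  exact ((summable_geometric_of_lt_one hr0 hr1).mul_left _).sum_le_tsum _
    fun _ _ => by positivity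

theorem circleCoeff_neg_ofReal (G : ℝ → ℝ) (n : ℤ) :
    circleCoeff (fun t => (G t : ℂ)) (-n) =
      (starRingEnd ℂ) (circleCoeff (fun t => (G t : ℂ)) n) := by
  simp only [circleCoeff, map_mul, Complex.conj_ofReal]
  congr 1
  rw [intervalIntegral.integral_of_le Real.two_pi_pos.le,
    intervalIntegral.integral_of_le Real.two_pi_pos.le, ← integral_conj]
  congr 1
  ext t
  simp only [map_mul, Complex.conj_ofReal, ← Complex.exp_conj, map_neg, Complex.conj_I, map_intCast]
  congr 2
  push_cast
  ring

/-- `f` descends to a continuous function on the circle, and a continuous function with summable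
Fourier coefficients is the pointwise sum of its Fourier series. -/
theorem hasSum_circleCoeff {f : ℝ → ℂ} (hf : Continuous f)
    (hp : Function.Periodic f (2 * Real.pi)) (hs : Summable (circleCoeff f)) (t : ℝ) :
    HasSum (fun n : ℤ => circleCoeff f n * Complex.exp (n * t * Complex.I)) (f t) := by
  have : Fact (0 < 2 * Real.pi) := ⟨Real.two_pi_pos⟩
  let φ : C(AddCircle (2 * Real.pi), ℂ) := ⟨hp.lift, continuous_coinduced_dom.mpr hf⟩
  have hpi : (Real.pi : ℂ) ≠ 0 := by exact_mod_cast Real.pi_ne_zero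
  have hφ : ∀ t : ℝ, φ (t : AddCircle (2 * Real.pi)) = f t := fun t => rfl
  have hc : fourierCoeff φ = circleCoeff f := by
    ext n
    rw [fourierCoeff_eq_intervalIntegral _ n 0, zero_add, circleCoeff, Complex.real_smul]
    congr 1
    refine intervalIntegral.integral_congr fun t _ => ?_
    simp only [smul_eq_mul, hφ]
    rw [fourier_coe_apply]
    congr 2
    push_cast
    field_simp
  have h := has_pointwise_sum_fourier_series_of_summable (f := φ) (by rw [hc]; exact hs)
    (t : AddCircle (2 * Real.pi))
  rw [hφ, hc] at h
  convert! h using 2 with n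
  rw [smul_eq_mul, fourier_coe_apply]
  congr 2
  push_cast
  field_simp

/-! ### Power series whose coefficients are summable against `n ^ 2` -/

section PowerSeries

variable {c : ℕ → ℂ} (hc : Summable fun n : ℕ => (n : ℝ) ^ 2 * ‖c n‖)

include hc in
theorem summable_mul_norm_of_sq : Summable fun n : ℕ => (n : ℝ) * ‖c n‖ := by
  refine Summable.of_nonneg_of_le (fun n => by positivity) (fun n => ?_) hc
  have : (n : ℝ) ≤ (n : ℝ) ^ 2 := by exact_mod_cast Nat.le_self_pow (by norm_num) n
  gcongr

include hc in
theorem summable_norm_of_sq : Summable fun n : ℕ => ‖c n‖ := by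
  rw [← summable_nat_add_iff 1]
  refine Summable.of_nonneg_of_le (fun n => by positivity) (fun n => ?_)
    ((summable_nat_add_iff 1).2 (summable_mul_norm_of_sq hc))
  push_cast
  nlinarith [norm_nonneg (c (n + 1)), (Nat.cast_nonneg n : (0 : ℝ) ≤ n)]

theorem norm_pow_le_one {w : ℂ} (hw : ‖w‖ ≤ 1) (n : ℕ) : ‖w ^ n‖ ≤ 1 := by
  rw [norm_pow]; exact pow_le_one₀ (norm_nonneg _) hw

include hc in
theorem summable_powerSeries {w : ℂ} (hw : ‖w‖ ≤ 1) : Summable fun n : ℕ => c n * w ^ n :=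
  Summable.of_norm_bounded (summable_norm_of_sq hc) fun n => by
    rw [norm_mul]
    exact mul_le_of_le_one_right (norm_nonneg _) (norm_pow_le_one hw n)

include hc in
theorem continuousOn_powerSeries :
    ContinuousOn (fun w : ℂ => ∑' n : ℕ, c n * w ^ n) (Metric.closedBall 0 1) := by
  refine continuousOn_tsum (fun n => by fun_prop) (summable_norm_of_sq hc) fun n w hw => ?_
  rw [norm_mul]
  exact mul_le_of_le_one_right (norm_nonneg _) (norm_pow_le_one (by simpa using hw) n)

include hc in
theorem hasDerivAt_powerSeries {w : ℂ} (hw : ‖w‖ < 1) :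
    HasDerivAt (fun w : ℂ => ∑' n : ℕ, c n * w ^ n) (∑' n : ℕ, c n * (n * w ^ (n - 1))) w := by
  refine hasDerivAt_tsum_of_isPreconnected (summable_mul_norm_of_sq hc)
    (t := Metric.ball (0 : ℂ) 1) Metric.isOpen_ball (convex_ball _ _).isPreconnected
    (fun n y _ => (hasDerivAt_pow n y).const_mul (c n)) (fun n y hy => ?_)
    (Metric.mem_ball_self one_pos) (summable_powerSeries hc (by simp)) (by simpa using hw)
  rw [norm_mul, norm_mul, Complex.norm_natCast, mul_comm, mul_assoc]
  refine mul_le_mul_of_nonneg_left ?_ (Nat.cast_nonneg n)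
  exact mul_le_of_le_one_left (norm_nonneg _) (norm_pow_le_one (by simpa using (mem_ball_zero_iff.1 hy).le) _)

theorem norm_pow_sub_pow_le {x y : ℂ} (hx : ‖x‖ ≤ 1) (hy : ‖y‖ ≤ 1) (n : ℕ) :
    ‖x ^ n - y ^ n‖ ≤ n * ‖x - y‖ := by
  induction n with
  | zero => simp
  | succ n ih =>
    have e : x ^ (n + 1) - y ^ (n + 1) = x ^ n * (x - y) + (x ^ n - y ^ n) * y := by ring
    rw [e]
    refine (norm_add_le _ _).trans ?_
    rw [norm_mul, norm_mul]
    have h1 := norm_pow_le_one hx n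
    have h2 := norm_nonneg (x - y)
    have h3 := norm_nonneg (x ^ n - y ^ n)
    push_cast
    nlinarith

include hc in
-- The term `n w^{n-1}` has Lipschitz constant at most `n²` on the closed disk, which is why the
-- coefficients are weighted by `n²`.
theorem norm_derivSeries_sub_le {x y : ℂ} (hx : ‖x‖ ≤ 1) (hy : ‖y‖ ≤ 1) :
    ‖∑' n : ℕ, c n * (n * x ^ (n - 1)) - ∑' n : ℕ, c n * (n * y ^ (n - 1))‖ ≤
      (∑' n : ℕ, (n : ℝ) ^ 2 * ‖c n‖) * ‖x - y‖ := by
  have hs : ∀ w : ℂ, ‖w‖ ≤ 1 → Summable fun n : ℕ => c n * (n * w ^ (n - 1)) := fun w hw =>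
    Summable.of_norm_bounded (summable_mul_norm_of_sq hc) fun n => by
      rw [norm_mul, norm_mul, Complex.norm_natCast, mul_comm, mul_assoc]
      refine mul_le_mul_of_nonneg_left ?_ (Nat.cast_nonneg n)
      exact mul_le_of_le_one_left (norm_nonneg _) (norm_pow_le_one hw _)
  rw [← (hs x hx).tsum_sub (hs y hy), ← tsum_mul_right]
  refine tsum_of_norm_bounded (hc.mul_right _).hasSum fun n => ?_
  rw [← mul_sub, ← mul_sub, norm_mul, norm_mul, Complex.norm_natCast]
  have h1 := norm_pow_sub_pow_le hx hy (n - 1)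
  have h2 : ((n - 1 : ℕ) : ℝ) ≤ n := by exact_mod_cast Nat.sub_le n 1
  calc ‖c n‖ * (n * ‖x ^ (n - 1) - y ^ (n - 1)‖) ≤ ‖c n‖ * (n * (n * ‖x - y‖)) := by
        gcongr
        exact h1.trans (mul_le_mul_of_nonneg_right h2 (norm_nonneg _))
    _ = _ := by ring

end PowerSeries

/-! ### The holomorphic extension of the boundary data -/

theorem circleMap_periodic' (g : ℂ → ℝ) (re : ℝ) :
    Function.Periodic (fun t : ℝ => g (circleMap (re : ℂ) re t)) (2 * Real.pi) := fun t => by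
  simp only [periodic_circleMap (re : ℂ) re t]

/-- Two derivatives multiply the `n`-th coefficient by `(in)²`, so this is Bernstein's theorem for
the second derivative. -/
theorem summable_sq_mul_circleCoeff {re : ℝ} {δ : ℝ≥0} (hδ : 1 / 2 < δ) {g : ℂ → ℝ}
    (hg : IsC2Holder re δ g) :
    Summable fun n : ℕ => (n : ℝ) ^ 2 *
      ‖circleCoeff (fun t => (g (circleMap (re : ℂ) re t) : ℂ)) n‖ := by
  obtain ⟨hC, K, hK⟩ := hg
  set G : ℝ → ℝ := fun t => g (circleMap (re : ℂ) re t) with hG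
  have hp : Function.Periodic G (2 * Real.pi) := circleMap_periodic' g re
  have h1 : ContDiff ℝ 1 (deriv G) := by
    have : ContDiff ℝ (1 + 1) G := by convert hC using 1; norm_num
    exact (contDiff_succ_iff_deriv.1 this).2.2
  have hd0 : Differentiable ℝ G := hC.differentiable (by norm_num)
  have hd1 : Differentiable ℝ (deriv G) := h1.differentiable (by norm_num)
  have e2 : iteratedDeriv 2 G = deriv (deriv G) := by
    rw [iteratedDeriv_succ, iteratedDeriv_one]
  rw [e2] at hK
  have hp1 : Function.Periodic (deriv G) (2 * Real.pi) := fun t => by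
    rw [← deriv_comp_add_const]
    congr 1
    ext s
    exact hp s
  have hp2 : Function.Periodic (deriv (deriv G)) (2 * Real.pi) := fun t => by
    rw [← deriv_comp_add_const]
    congr 1
    ext s
    exact hp1 s
  have hc2 : Continuous (deriv (deriv G)) := h1.continuous_deriv le_rfl
  have hsum := summable_circleCoeff_of_holder (f := fun t => ((deriv (deriv G) t : ℝ) : ℂ))
    (by fun_prop) (fun t => by simp only [hp2 t]) (K := K) (δ := δ) K.2 (by exact_mod_cast hδ)
    (fun x y => by
      rw [← Complex.ofReal_sub, Complex.norm_real, ← dist_eq_norm, ← Real.dist_eq]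
      exact hK.dist_le x y)
  refine hsum.congr fun n => ?_
  rw [circleCoeff_deriv (f := fun t => ((deriv G t : ℝ) : ℂ)) (fun t => by simp only [hp1 t])
    (fun t => (hd1 t).hasDerivAt.ofReal_comp) (by fun_prop),
    circleCoeff_deriv (f := fun t => (G t : ℂ)) (fun t => by simp only [hp t])
    (fun t => (hd0 t).hasDerivAt.ofReal_comp) (by fun_prop)]
  simp only [norm_mul, Complex.norm_I, Int.cast_natCast, Complex.norm_natCast]
  ring

theorem hasSum_of_eq {ι E : Type*} [AddCommMonoid E] [TopologicalSpace E] {f f' : ι → E} {a : E}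
    (h : HasSum f a) (e : ∀ n, f n = f' n) : HasSum f' a := funext e ▸ h

/-- The differential is `v ↦ Re (f' v)`, which is the real inner product of `v` with the conjugate
of `f'`. -/
theorem hasGradientAt_re {f : ℂ → ℂ} {f' z : ℂ} (hf : HasDerivAt f f' z) :
    HasGradientAt (fun z => (f z).re) ((starRingEnd ℂ) f') z := by
  rw [hasGradientAt_iff_hasFDerivAt]
  have h := Complex.reCLM.hasFDerivAt.comp z hf.complexToReal_fderiv
  refine h.congr_fderiv ?_
  ext v
  simp [Complex.inner, mul_comm]

/-- Dividing by `z` moves the base point to `1`, inside the slit plane, so no branch of the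
logarithm at `z` has to be chosen. -/
theorem log_norm_eventuallyEq {z : ℂ} (hz : z ≠ 0) :
    (fun w : ℂ => Real.log ‖w‖) =ᶠ[𝓝 z] fun w => (Complex.log (w / z) + Real.log ‖z‖).re := by
  filter_upwards [isOpen_ne.mem_nhds hz] with w hw
  have h2 : ‖z‖ ≠ 0 := norm_ne_zero_iff.2 hz
  have h1 : ‖w‖ ≠ 0 := norm_ne_zero_iff.2 hw
  rw [Complex.add_re, Complex.log_re, norm_div, Real.log_div h1 h2, Complex.ofReal_re]
  ring

theorem hasDerivAt_log_div {z : ℂ} (hz : z ≠ 0) :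
    HasDerivAt (fun w : ℂ => Complex.log (w / z) + Real.log ‖z‖) z⁻¹ z := by
  have h : HasDerivAt (fun w : ℂ => w / z) z⁻¹ z := by
    simpa [one_div] using (hasDerivAt_id z).div_const z
  have h1 := (h.clog (by rw [div_self hz]; exact Complex.one_mem_slitPlane)).add_const
    (Real.log ‖z‖ : ℂ)
  simpa [div_self hz] using h1

theorem hasGradientAt_log_norm {f : ℂ → ℂ} {f' z : ℂ} (hf : HasDerivAt f f' z) (hz : f z ≠ 0) :
    HasGradientAt (fun w => Real.log ‖f w‖) ((starRingEnd ℂ) (f' / f z)) z := by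
  have h := (hasDerivAt_log_div hz).comp z hf
  have h2 := hasGradientAt_re h
  rw [show (f z)⁻¹ * f' = f' / f z by field_simp] at h2
  refine h2.congr_of_eventuallyEq ?_
  exact (hf.continuousAt.eventually (log_norm_eventuallyEq hz))

theorem hasDerivAt_line_of_hasGradientAt {u : ℂ → ℝ} {x p : ℂ} (h : HasGradientAt u p x) (ν : ℂ) :
    HasDerivAt (fun t : ℝ => u (x + t • ν)) ((starRingEnd ℂ) p * ν).re 0 := by
  have hl : HasDerivAt (fun t : ℝ => x + t • ν) ν 0 := by
    simpa using ((hasDerivAt_id (0 : ℝ)).smul_const ν).const_add x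
  have hf := hasGradientAt_iff_hasFDerivAt.1 h
  have h0 : x = x + (0 : ℝ) • ν := by simp
  rw [h0] at hf
  have := hf.comp_hasDerivAt (0 : ℝ) hl
  convert! this using 1
  simp [Complex.inner, mul_comm]

theorem summable_norm_circleCoeff_int {G : ℝ → ℝ}
    (h : Summable fun n : ℕ => ‖circleCoeff (fun t => (G t : ℂ)) n‖) :
    Summable (circleCoeff fun t => (G t : ℂ)) := by
  refine Summable.of_nat_of_neg h.of_norm ?_
  refine (h.congr fun n => ?_).of_norm
  rw [circleCoeff_neg_ofReal, RCLike.norm_conj]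

theorem hasSum_re_circleCoeff {G : ℝ → ℝ} (hG : Continuous G)
    (hp : Function.Periodic G (2 * Real.pi)) (h0 : ∫ t in (0 : ℝ)..(2 * Real.pi), G t = 0)
    (h : Summable fun n : ℕ => ‖circleCoeff (fun t => (G t : ℂ)) n‖) (t : ℝ) :
    HasSum (fun n : ℕ => (2 * circleCoeff (fun t => (G t : ℂ)) n *
      Complex.exp (t * Complex.I) ^ n).re) (G t) := by
  have hs := hasSum_circleCoeff (f := fun t => (G t : ℂ)) (by fun_prop)
    (fun t => by simp only [hp t]) (summable_norm_circleCoeff_int h) t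
  have hc0 : circleCoeff (fun t => (G t : ℂ)) 0 = 0 := by
    simp only [circleCoeff, Int.cast_zero, zero_mul, neg_zero, Complex.exp_zero, one_mul]
    rw [intervalIntegral.integral_ofReal, h0]
    simp
  -- Pairing `n` with `-n` counts the index `0` twice. This is harmless because the mean, hence the
  -- coefficient `0`, vanishes.
  have h1 := hs.nat_add_neg
  simp only [hc0, zero_mul, add_zero] at h1
  have h2 := Complex.hasSum_re h1
  simp only [Complex.ofReal_re] at h2
  refine hasSum_of_eq h2 fun n => ?_
  have e1 : Complex.exp (t * Complex.I) ^ n = Complex.exp ((n : ℤ) * t * Complex.I) := by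
    rw [← Complex.exp_nat_mul]
    congr 1
    push_cast
    ring
  have e2 : Complex.exp ((-(n : ℤ) : ℤ) * t * Complex.I) =
      (starRingEnd ℂ) (Complex.exp ((n : ℤ) * t * Complex.I)) := by
    rw [← Complex.exp_conj]
    congr 1
    simp
  rw [e1, e2, circleCoeff_neg_ofReal, ← map_mul, Complex.add_re, Complex.conj_re, mul_assoc (2 : ℂ)]
  rw [show (2 : ℂ) = ((2 : ℝ) : ℂ) by norm_num, Complex.re_ofReal_mul]
  ring

theorem lineDeriv_log_norm_sub {x ζ : ℂ} (h : ζ ≠ x) (e : ℂ) :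
    lineDeriv ℝ (fun ζ : ℂ => Real.log ‖x - ζ‖) ζ e = (e / (ζ - x)).re := by
  have hd : HasDerivAt (fun ζ : ℂ => x - ζ) (-1) ζ := by
    simpa using (hasDerivAt_id ζ).const_sub x
  have h1 := hasDerivAt_line_of_hasGradientAt
    (hasGradientAt_log_norm hd (sub_ne_zero.2 h.symm)) e
  rw [lineDeriv, h1.deriv, Complex.conj_conj]
  congr 1
  rw [← neg_sub ζ x, neg_div_neg_eq]
  ring

/-- With `w = (x - rₑ)/rₑ`, the kernel times `rₑ` is the real part of `1 / (1 - w e^{-it})`.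
Expanding this as a geometric series and integrating termwise produces the Fourier coefficients. -/
theorem doubleLayer_eq {re : ℝ} (hre : 0 < re) {g : ℂ → ℝ}
    (hg : Continuous fun t : ℝ => g (circleMap (re : ℂ) re t)) {x : ℂ}
    (hx : x ∈ Metric.ball (re : ℂ) re) :
    HasSum (fun n : ℕ => (circleCoeff (fun t => (g (circleMap (re : ℂ) re t) : ℂ)) n *
      ((x - re) / re) ^ n).re) (doubleLayer re g x) := by
  set w : ℂ := (x - re) / re with hw
  have hre' : (re : ℂ) ≠ 0 := by exact_mod_cast hre.ne'
  have hw1 : ‖w‖ < 1 := by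
    rw [hw, norm_div, Complex.norm_real, Real.norm_of_nonneg hre.le, div_lt_one hre]
    simpa [dist_eq_norm] using hx
  set G : ℝ → ℝ := fun t => g (circleMap (re : ℂ) re t) with hG
  obtain ⟨B, hB⟩ : ∃ B, ∀ t ∈ Icc (0 : ℝ) (2 * Real.pi), ‖G t‖ ≤ B :=
    isCompact_Icc.exists_bound_of_continuousOn hg.continuousOn
  have hsum : HasSum (fun n : ℕ => ∫ t in (0 : ℝ)..(2 * Real.pi),
      (w ^ n * Complex.exp (-(n * t * Complex.I)) * G t))
      (∫ t in (0 : ℝ)..(2 * Real.pi), 1 / (1 - w * Complex.exp (-(t * Complex.I))) * G t) := by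
    refine intervalIntegral.hasSum_integral_of_dominated_convergence
      (bound := fun n _ => ‖w‖ ^ n * B) (fun n => ?_) (fun n => ?_) ?_ ?_ ?_
    · exact Continuous.aestronglyMeasurable (by fun_prop)
    · refine Eventually.of_forall fun t ht => ?_
      rw [uIoc_of_le Real.two_pi_pos.le] at ht
      rw [norm_mul, norm_mul, norm_pow, Complex.norm_real]
      have : ‖Complex.exp (-(n * t * Complex.I))‖ = 1 := by
        rw [show -((n : ℂ) * t * Complex.I) = ((-(n * t) : ℝ) : ℂ) * Complex.I by push_cast; ring]
        exact Complex.norm_exp_ofReal_mul_I _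
      rw [this, mul_one]
      exact mul_le_mul_of_nonneg_left (hB t ⟨ht.1.le, ht.2⟩) (by positivity)
    · exact Eventually.of_forall fun t _ =>
        (summable_geometric_of_lt_one (norm_nonneg _) hw1).mul_right B
    · exact Continuous.intervalIntegrable (by fun_prop) _ _
    · refine Eventually.of_forall fun t _ => ?_
      have h1 : ‖w * Complex.exp (-(t * Complex.I))‖ < 1 := by
        rw [norm_mul, show -((t : ℂ) * Complex.I) = ((-t : ℝ) : ℂ) * Complex.I by push_cast; ring,
          Complex.norm_exp_ofReal_mul_I, mul_one]
        exact hw1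
      have h2 := (hasSum_geometric_of_norm_lt_one h1).mul_right (G t : ℂ)
      rw [one_div]
      refine hasSum_of_eq h2 fun n => ?_
      rw [mul_pow, ← Complex.exp_nat_mul]
      congr 3
      ring
  have hsum2 := Complex.hasSum_re (hsum.mul_left (((1 / (2 * Real.pi) : ℝ)) : ℂ))
  have e1 : ∀ n : ℕ, (((1 / (2 * Real.pi) : ℝ)) : ℂ) * ∫ t in (0 : ℝ)..(2 * Real.pi),
      (w ^ n * Complex.exp (-(n * t * Complex.I)) * G t) =
      circleCoeff (fun t => (G t : ℂ)) n * w ^ n := by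
    intro n
    simp only [circleCoeff, mul_assoc]
    rw [intervalIntegral.integral_const_mul]
    push_cast
    ring
  simp_rw [e1] at hsum2
  convert! hsum2 using 1
  rw [doubleLayer, Complex.re_ofReal_mul]
  congr 1
  have hne : ∀ t : ℝ, 1 - w * Complex.exp (-(t * Complex.I)) ≠ 0 := by
    intro t h0
    have h1 : ‖w * Complex.exp (-(t * Complex.I))‖ = 1 := by
      rw [← sub_eq_zero.1 h0, norm_one]
    rw [norm_mul, show -((t : ℂ) * Complex.I) = ((-t : ℝ) : ℂ) * Complex.I by push_cast; ring,
      Complex.norm_exp_ofReal_mul_I, mul_one] at h1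
    exact hw1.ne h1
  have hint : IntervalIntegrable (fun t : ℝ => 1 / (1 - w * Complex.exp (-(t * Complex.I))) * G t)
      MeasureTheory.volume 0 (2 * Real.pi) := by
    refine Continuous.intervalIntegrable ?_ _ _
    exact (continuous_const.div (by fun_prop) hne).mul (by fun_prop)
  have e2 := Complex.reCLM.intervalIntegral_comp_comm hint
  simp only [Complex.reCLM_apply] at e2
  rw [← e2]
  refine intervalIntegral.integral_congr fun t _ => ?_
  have hexp : Complex.exp (t * Complex.I) ≠ 0 := Complex.exp_ne_zero _
  have hζ : circleMap (re : ℂ) re t - x = re * Complex.exp (t * Complex.I) *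
      (1 - w * Complex.exp (-(t * Complex.I))) := by
    rw [circleMap, Complex.exp_neg, hw]
    field_simp
    ring
  have hne2 : circleMap (re : ℂ) re t ≠ x := by
    rw [← sub_ne_zero, hζ]
    exact mul_ne_zero (mul_ne_zero hre' hexp) (hne t)
  rw [lineDeriv_log_norm_sub hne2, hζ]
  have e3 : Complex.exp (t * Complex.I) / (re * Complex.exp (t * Complex.I) *
      (1 - w * Complex.exp (-(t * Complex.I)))) =
      ((re⁻¹ : ℝ) : ℂ) * (1 / (1 - w * Complex.exp (-(t * Complex.I)))) := by
    have := hne t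
    push_cast
    field_simp
  rw [e3, Complex.re_ofReal_mul, Complex.re_mul_ofReal]
  field_simp
  rfl

/-- The boundary datum is the real part of a function `F`, holomorphic in `Ω`, whose derivative
`F₁` is Lipschitz up to the boundary; in `Ω` one has `H_d = Re F`. -/
theorem exists_holomorphic_extension {re : ℝ} (hre : 0 < re) {δ : ℝ≥0} (hδ : 1 / 2 < δ)
    {g : ℂ → ℝ} (hg : IsC2Holder re δ g) (hg0 : MeanZero re g) :
    ∃ F F₁ : ℂ → ℂ, ∃ L : ℝ, 0 ≤ L ∧ ContinuousOn F (Metric.closedBall (re : ℂ) re) ∧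
      (∀ z ∈ Metric.ball (re : ℂ) re, HasDerivAt F (F₁ z) z) ∧
      (∀ z ∈ Metric.sphere (re : ℂ) re, (F z).re = g z) ∧
      (∀ x ∈ Metric.closedBall (re : ℂ) re, ∀ y ∈ Metric.closedBall (re : ℂ) re,
        ‖F₁ x - F₁ y‖ ≤ L * ‖x - y‖) ∧
      ∀ x ∈ Metric.ball (re : ℂ) re, Hd re g x = (F x).re := by
  set a : ℕ → ℂ := fun n => circleCoeff (fun t => (g (circleMap (re : ℂ) re t) : ℂ)) n with ha
  set c : ℕ → ℂ := fun n => 2 * a n with hcdef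
  have hre' : (re : ℂ) ≠ 0 := by exact_mod_cast hre.ne'
  have hsa : Summable fun n : ℕ => (n : ℝ) ^ 2 * ‖a n‖ := summable_sq_mul_circleCoeff hδ hg
  have hc : Summable fun n : ℕ => (n : ℝ) ^ 2 * ‖c n‖ := by
    refine (hsa.mul_left 2).congr fun n => ?_
    rw [hcdef]
    simp only [norm_mul, Complex.norm_ofNat]
    ring
  have hnorm : ∀ z : ℂ, ‖(z - re) / re‖ = dist z re / re := fun z => by
    rw [norm_div, Complex.norm_real, Real.norm_of_nonneg hre.le, dist_eq_norm]
  have hle : ∀ z ∈ Metric.closedBall (re : ℂ) re, ‖(z - re) / re‖ ≤ 1 := fun z hz => by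
    rw [hnorm, div_le_one hre]; exact hz
  have hlt : ∀ z ∈ Metric.ball (re : ℂ) re, ‖(z - re) / re‖ < 1 := fun z hz => by
    rw [hnorm, div_lt_one hre]; exact hz
  have hcont : Continuous fun t : ℝ => g (circleMap (re : ℂ) re t) := hg.1.continuous
  -- In the Lipschitz constant one factor `1/rₑ` comes from the chain rule and the other from
  -- rescaling the distance.
  refine ⟨fun z => ∑' n : ℕ, c n * ((z - re) / re) ^ n,
    fun z => (∑' n : ℕ, c n * (n * ((z - re) / re) ^ (n - 1))) / re,
    (∑' n : ℕ, (n : ℝ) ^ 2 * ‖c n‖) / re ^ 2, ?_, ?_, ?_, ?_, ?_, ?_⟩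
  · exact div_nonneg (tsum_nonneg fun n => by positivity) (by positivity)
  · refine (continuousOn_powerSeries hc).comp (f := fun z : ℂ => (z - re) / re)
      (Continuous.continuousOn (by fun_prop)) fun z hz => ?_
    simpa using hle z hz
  · intro z hz
    have h1 : HasDerivAt (fun z : ℂ => (z - re) / re) (1 / re) z :=
      ((hasDerivAt_id z).sub_const _).div_const _
    have := (hasDerivAt_powerSeries hc (hlt z hz)).comp z h1
    rw [mul_one_div] at this
    exact this
  · intro z hz
    obtain ⟨t, rfl⟩ : ∃ t : ℝ, circleMap (re : ℂ) re t = z := by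
      have := range_circleMap (re : ℂ) re
      rw [abs_of_pos hre] at this
      rw [← this] at hz
      exact hz
    have e : (circleMap (re : ℂ) re t - re) / re = Complex.exp (t * Complex.I) := by
      rw [circleMap]
      field_simp
      ring
    have h1 := hasSum_re_circleCoeff hcont (circleMap_periodic' g re) hg0
      (summable_norm_of_sq hsa) t
    have h2 := Complex.hasSum_re (summable_powerSeries hc
      (w := Complex.exp (t * Complex.I)) (Complex.norm_exp_ofReal_mul_I t).le).hasSum
    simp only [e]
    exact h2.unique h1
  · intro x hx y hy
    have h1 := norm_derivSeries_sub_le hc (hle x hx) (hle y hy)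
    rw [← sub_div, norm_div, Complex.norm_real, Real.norm_of_nonneg hre.le, div_le_iff₀ hre]
    refine h1.trans (le_of_eq ?_)
    rw [← sub_div, sub_sub_sub_cancel_right, norm_div, Complex.norm_real,
      Real.norm_of_nonneg hre.le]
    field_simp
  · intro x hx
    have h1 := doubleLayer_eq hre hcont hx
    have h2 := Complex.hasSum_re (summable_powerSeries hc (hlt x hx).le).hasSum
    rw [Hd]
    refine (hasSum_of_eq (h1.mul_left 2) fun n => ?_).unique h2
    rw [hcdef]
    simp only [mul_assoc]
    rw [show (2 : ℂ) = ((2 : ℝ) : ℂ) by norm_num, Complex.re_ofReal_mul]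

/-! ### The maximum principle and uniqueness for the transmission problem -/

/-- The weak maximum principle for harmonic functions on bounded open sets. -/
theorem harmonic_le_of_frontier {U : Set ℂ} (hU : IsOpen U) (hb : Bornology.IsBounded U)
    {u : ℂ → ℝ} (hu : HarmonicOnNhd u U) (hc : ContinuousOn u (closure U)) {M : ℝ}
    (hM : ∀ x ∈ frontier U, u x ≤ M) : ∀ x ∈ closure U, u x ≤ M := by
  by_contra! hcon
  obtain ⟨y, hy, hyM⟩ := hcon
  have hcomp : IsCompact (closure U) := hb.isCompact_closure
  obtain ⟨p, hp, hpmax⟩ := hcomp.exists_isMaxOn ⟨y, hy⟩ hc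
  have hpM : M < u p := hyM.trans_le (hpmax hy)
  -- The set of maximum points, if the maximum exceeds `M`, avoids the frontier. It turns out to be
  -- open as well as closed, hence all of `ℂ`, which is not compact.
  set S : Set ℂ := closure U ∩ u ⁻¹' {u p} with hS
  have hScl : IsClosed S := hc.preimage_isClosed_of_isClosed isClosed_closure isClosed_singleton
  have hSU : S ⊆ U := by
    rintro x ⟨hx, hxp⟩
    by_contra hxU
    have : x ∈ frontier U := by rw [frontier, hU.interior_eq]; exact ⟨hx, hxU⟩
    have h1 := hM x this
    have h2 : u x = u p := hxp
    linarith
  have hSop : IsOpen S := by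
    rw [isOpen_iff_mem_nhds]
    intro x hx
    have hxU := hSU hx
    have hxp : u x = u p := hx.2
    obtain ⟨r, hr, hrU⟩ := Metric.isOpen_iff.1 hU x hxU
    -- Locally `u = Re f`, so `|e^f| = e^u` and the maximum modulus principle applies to `e^f`.
    obtain ⟨f, hf, hfu⟩ := (hu.mono hrU).exists_analyticOnNhd_ball_re_eq
    have hball : ∀ᶠ z in 𝓝 x, z ∈ Metric.ball x r := Metric.ball_mem_nhds x hr
    have hn : ∀ z ∈ Metric.ball x r, ‖Complex.exp (f z)‖ = Real.exp (u z) := fun z hz => by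
      rw [Complex.norm_exp]; congr 1; exact hfu hz
    have hmax : IsLocalMax (norm ∘ fun z => Complex.exp (f z)) x := by
      filter_upwards [hball] with z hz
      simp only [Function.comp]
      rw [hn z hz, hn x (Metric.mem_ball_self hr), hxp]
      exact Real.exp_le_exp.2 (hpmax (subset_closure (hrU hz)))
    have h1 := Complex.norm_eventually_eq_of_isLocalMax (f := fun z => Complex.exp (f z))
      (hball.mono fun z hz => (hf z hz).differentiableAt.cexp) hmax
    filter_upwards [h1, hball] with z hz hzb
    rw [hn z hzb, hn x (Metric.mem_ball_self hr), hxp] at hz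
    exact ⟨subset_closure (hrU hzb), Real.exp_injective hz⟩
  have hSuniv : S = univ := IsClopen.eq_univ ⟨hScl, hSop⟩ ⟨p, hp, rfl⟩
  have hcu : IsCompact (univ : Set ℂ) := by
    rw [← hSuniv]
    exact hcomp.of_isClosed_subset hScl inter_subset_left
  exact noncompact_univ ℂ hcu

theorem deriv_nonpos_of_right_max {φ : ℝ → ℝ} {a : ℝ} (h : HasDerivWithinAt φ a (Ici 0) 0)
    (hm : ∀ᶠ t in 𝓝[>] (0 : ℝ), φ t ≤ φ 0) : a ≤ 0 := by
  have h1 := hasDerivWithinAt_iff_tendsto_slope.1 h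
  rw [Ici_sdiff_left] at h1
  refine le_of_tendsto h1 ?_
  filter_upwards [hm, self_mem_nhdsWithin] with t ht ht0
  rw [slope_def_field, sub_zero]
  exact div_nonpos_of_nonpos_of_nonneg (by linarith) (le_of_lt ht0)

theorem deriv_nonneg_of_left_max {φ : ℝ → ℝ} {b : ℝ} (h : HasDerivWithinAt φ b (Iic 0) 0)
    (hm : ∀ᶠ t in 𝓝[<] (0 : ℝ), φ t ≤ φ 0) : 0 ≤ b := by
  have h1 := hasDerivWithinAt_iff_tendsto_slope.1 h
  rw [Iic_sdiff_right] at h1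
  refine ge_of_tendsto h1 ?_
  filter_upwards [hm, self_mem_nhdsWithin] with t ht ht0
  rw [slope_def_field, sub_zero]
  exact div_nonneg_of_nonpos (by linarith) (le_of_lt ht0)

theorem frontier_annulus_subset {C c : ℂ} {R r : ℝ} :
    closure (Metric.ball C R \ Metric.closedBall c r) ⊆
        Metric.closedBall C R \ Metric.ball c r ∧
      frontier (Metric.ball C R \ Metric.closedBall c r) ⊆
        Metric.sphere C R ∪ Metric.sphere c r := by
  have hU : IsOpen (Metric.ball C R \ Metric.closedBall c r) :=
    Metric.isOpen_ball.sdiff Metric.isClosed_closedBall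
  have h1 : closure (Metric.ball C R \ Metric.closedBall c r) ⊆
      Metric.closedBall C R \ Metric.ball c r := by
    refine closure_minimal (fun x hx => ⟨Metric.ball_subset_closedBall hx.1,
      fun h => hx.2 (Metric.ball_subset_closedBall h)⟩) ?_
    exact Metric.isClosed_closedBall.sdiff Metric.isOpen_ball
  refine ⟨h1, fun x hx => ?_⟩
  rw [frontier, hU.interior_eq] at hx
  obtain ⟨hx1, hx2⟩ := hx
  obtain ⟨h3, h4⟩ := h1 hx1
  rw [Metric.mem_closedBall] at h3
  rw [Metric.mem_ball, not_lt] at h4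
  by_contra h
  simp only [mem_union, Metric.mem_sphere, not_or] at h
  exact hx2 ⟨lt_of_le_of_ne h3 h.1, fun h5 => h.2 (le_antisymm h5 h4)⟩

/-- Let `M` be the maximum of `u` on the inner circle, attained at `p`. If `M > 0`, a logarithmic
barrier equal to `M` on that circle and nonnegative on the outer one lies above `w`. The exterior
normal derivative at `p` is then strictly negative, as in Hopf's lemma, while the interior one is
nonnegative because `u ≤ M` inside. The flux condition with `k > 0` excludes this. -/
theorem transmission_nonpos {C c : ℂ} {R r k : ℝ} (hr : 0 < r) (hk : 0 < k)
    (hsub : Metric.closedBall c r ⊆ Metric.ball C R) {u w : ℂ → ℝ}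
    (hu : HarmonicOnNhd u (Metric.ball c r)) (huc : ContinuousOn u (Metric.closedBall c r))
    (hw : HarmonicOnNhd w (Metric.ball C R \ Metric.closedBall c r))
    (hwc : ContinuousOn w (Metric.closedBall C R \ Metric.ball c r))
    (hw0 : ∀ x ∈ Metric.sphere C R, w x = 0) (huw : ∀ x ∈ Metric.sphere c r, u x = w x)
    (ht : ∀ x ∈ Metric.sphere c r, ∃ a b : ℝ,
      HasDerivWithinAt (fun t : ℝ => w (x + t • ((r⁻¹ : ℝ) • (x - c)))) a (Ici 0) 0 ∧
      HasDerivWithinAt (fun t : ℝ => u (x + t • ((r⁻¹ : ℝ) • (x - c)))) b (Iic 0) 0 ∧ a = k * b) :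
    (∀ x ∈ Metric.closedBall c r, u x ≤ 0) ∧
      ∀ x ∈ Metric.closedBall C R \ Metric.ball c r, w x ≤ 0 := by
  obtain ⟨p, hp, hpmax⟩ := (isCompact_sphere c r).exists_isMaxOn
    (NormedSpace.sphere_nonempty.2 hr.le) (huc.mono Metric.sphere_subset_closedBall)
  set M := u p with hM
  have hin : ∀ x ∈ Metric.closedBall c r, u x ≤ M := by
    have := harmonic_le_of_frontier Metric.isOpen_ball Metric.isBounded_ball hu
      (by rwa [closure_ball c hr.ne']) (M := M) (fun x hx => by
        rw [frontier_ball c hr.ne'] at hx; exact hpmax hx)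
    rwa [closure_ball c hr.ne'] at this
  have hcR : c ∈ Metric.ball C R := hsub (Metric.mem_closedBall_self hr.le)
  have hR : 0 < R := dist_nonneg.trans_lt hcR
  set U := Metric.ball C R \ Metric.closedBall c r with hU
  have hUo : IsOpen U := Metric.isOpen_ball.sdiff Metric.isClosed_closedBall
  have hUb : Bornology.IsBounded U := Metric.isBounded_ball.subset sdiff_subset
  obtain ⟨hUc, hUf⟩ := frontier_annulus_subset (C := C) (c := c) (R := R) (r := r)
  have hann : ∀ x ∈ Metric.closedBall C R \ Metric.ball c r,
      x ∈ closure U ∨ x ∈ Metric.sphere C R ∨ x ∈ Metric.sphere c r := by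
    rintro x ⟨h1, h2⟩
    by_cases h3 : x ∈ U
    · exact Or.inl (subset_closure h3)
    · right
      rw [Metric.mem_closedBall] at h1
      rw [Metric.mem_ball, not_lt] at h2
      by_contra h
      simp only [Metric.mem_sphere, not_or] at h
      exact h3 ⟨lt_of_le_of_ne h1 h.1, fun h5 => h.2 (le_antisymm h5 h2)⟩
  have hM0 : M ≤ 0 := by
    by_contra! hMpos
    -- Points of the outer circle are within `2R` of `c`, so the barrier is nonnegative there; the
    -- summand `r` gives `R0 > r`.
    set R0 : ℝ := 2 * R + r with hR0
    set ℓ : ℝ := Real.log R0 - Real.log r with hℓ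
    have hℓ0 : 0 < ℓ := sub_pos.2 (Real.log_lt_log hr (by linarith))
    have hne : ∀ x : ℂ, x ∉ Metric.ball c r → x - c ≠ 0 := by
      intro x hx h0
      rw [sub_eq_zero.1 h0] at hx
      exact hx (Metric.mem_ball_self hr)
    set b : ℂ → ℝ := fun x => (M / ℓ) * (Real.log R0 - Real.log ‖x - c‖) with hb
    have hgrad : ∀ x : ℂ, x - c ≠ 0 →
        HasGradientAt (fun x => Real.log ‖x - c‖) ((starRingEnd ℂ) (1 / (x - c))) x := fun x hx =>
      hasGradientAt_log_norm ((hasDerivAt_id x).sub_const c) hx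
    have hbh : HarmonicOnNhd b U := by
      intro x hx
      have hx0 : x - c ≠ 0 := hne x fun h => hx.2 (Metric.ball_subset_closedBall h)
      have h1 : HarmonicAt (fun x : ℂ => Real.log ‖x - c‖) x :=
        AnalyticAt.harmonicAt_log_norm (by fun_prop) hx0
      exact ((harmonicAt_const (Real.log R0)).sub h1).const_smul (c := M / ℓ)
    have hbc : ContinuousOn b (closure U) := by
      intro x hx
      have := (hgrad x (hne x (hUc hx).2)).continuousAt.continuousWithinAt (s := closure U)
      exact continuousWithinAt_const.mul (continuousWithinAt_const.sub this)
    have hle := harmonic_le_of_frontier hUo hUb (u := w - b) (hw.sub hbh)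
      ((hwc.mono hUc).sub hbc) (M := 0) (by
        intro x hx
        simp only [Pi.sub_apply]
        rcases hUf hx with hx | hx
        · rw [hw0 x hx]
          have h1 : ‖x - c‖ ≤ R0 := by
            have := dist_triangle x C c
            rw [Metric.mem_ball, dist_comm] at hcR
            rw [Metric.mem_sphere] at hx
            rw [← dist_eq_norm]
            linarith
          have hx0 : x - c ≠ 0 := by
            intro h0
            rw [sub_eq_zero.1 h0] at hx
            exact (Metric.mem_ball.1 hcR).ne hx
          have h2 : Real.log ‖x - c‖ ≤ Real.log R0 :=
            Real.log_le_log (norm_pos_iff.2 hx0) h1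
          have : 0 ≤ b x := mul_nonneg (by positivity) (by linarith)
          linarith
        · have hx' : ‖x - c‖ = r := by rw [← dist_eq_norm]; exact hx
          have h1 : b x = M := by
            simp only [hb, hx', ← hℓ]
            field_simp
          rw [h1, ← huw x hx]
          have := hpmax hx
          simp only [mem_ofPred_eq] at this
          linarith)
    obtain ⟨a, b', ha, hb', hab⟩ := ht p hp
    have hp' : ‖p - c‖ = r := by rw [← dist_eq_norm]; exact hp
    have hp0 : p - c ≠ 0 := by rw [← norm_pos_iff, hp']; exact hr
    have hline : ∀ t : ℝ, dist (p + t • ((r⁻¹ : ℝ) • (p - c))) c = |1 + t / r| * r := by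
      intro t
      have e : p + t • ((r⁻¹ : ℝ) • (p - c)) - c = (1 + t / r) • (p - c) := by
        rw [add_smul, smul_smul, one_smul, div_eq_mul_inv]
        ring
      rw [dist_eq_norm, e, norm_smul, hp', Real.norm_eq_abs]
    have hcontl : Continuous fun t : ℝ => p + t • ((r⁻¹ : ℝ) • (p - c)) := by fun_prop
    have hb0 : 0 ≤ b' := by
      refine deriv_nonneg_of_left_max hb' ?_
      have : ∀ᶠ t in 𝓝[<] (0 : ℝ), t ∈ Ioo (-r) 0 := Ioo_mem_nhdsLT (by linarith)
      filter_upwards [this] with t ht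
      simp only [zero_smul, add_zero]
      refine hin _ ?_
      rw [Metric.mem_closedBall, hline]
      have h1 : -1 < t / r := by rw [lt_div_iff₀ hr]; linarith [ht.1]
      have h2 : t / r < 0 := div_neg_of_neg_of_pos ht.2 hr
      rw [abs_of_pos (by linarith)]
      nlinarith
    have ha0 : a + M / ℓ / r ≤ 0 := by
      have hbd : HasDerivAt (fun t : ℝ => b (p + t • ((r⁻¹ : ℝ) • (p - c)))) (-(M / ℓ / r)) 0 := by
        have h1 := hasDerivAt_line_of_hasGradientAt (hgrad p hp0) ((r⁻¹ : ℝ) • (p - c))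
        have h2 := (h1.const_sub (Real.log R0)).const_mul (M / ℓ)
        refine h2.congr_deriv ?_
        rw [Complex.conj_conj, Complex.real_smul]
        have : 1 / (p - c) * (((r⁻¹ : ℝ) : ℂ) * (p - c)) = ((r⁻¹ : ℝ) : ℂ) := by field_simp
        rw [this, Complex.ofReal_re]
        ring
      have h3 := ha.sub (hbd.hasDerivWithinAt (s := Ici 0))
      rw [sub_neg_eq_add] at h3
      refine deriv_nonpos_of_right_max h3 ?_
      have hmem : ∀ᶠ t in 𝓝 (0 : ℝ), p + t • ((r⁻¹ : ℝ) • (p - c)) ∈ Metric.ball C R := by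
        refine hcontl.continuousAt.eventually (Metric.isOpen_ball.mem_nhds ?_)
        simp only [zero_smul, add_zero]
        exact hsub (Metric.sphere_subset_closedBall hp)
      filter_upwards [hmem.filter_mono nhdsWithin_le_nhds, self_mem_nhdsWithin] with t h4 h5
      have h5' : 0 < t := h5
      have h6 := hle (p + t • ((r⁻¹ : ℝ) • (p - c))) (subset_closure ⟨h4, fun h7 => by
        rw [Metric.mem_closedBall, hline] at h7
        have h8 : 0 < t / r := by positivity
        rw [abs_of_pos (by linarith)] at h7
        nlinarith⟩)
      have h9 : b p = M := by
        simp only [hb, hp', ← hℓ]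
        field_simp
      simp only [Pi.sub_apply] at h6 ⊢
      simp only [zero_smul, add_zero]
      rw [h9, ← huw p hp, ← hM, sub_self]
      exact h6
    have : 0 < M / ℓ / r := by positivity
    have : 0 ≤ k * b' := by positivity
    linarith
  refine ⟨fun x hx => (hin x hx).trans hM0, fun x hx => ?_⟩
  have hws : ∀ x ∈ Metric.sphere C R ∪ Metric.sphere c r, w x ≤ 0 := by
    rintro x (hx | hx)
    · exact (hw0 x hx).le
    · rw [← huw x hx]; exact (hin x (Metric.sphere_subset_closedBall hx)).trans hM0
  rcases hann x hx with h | h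
  · exact harmonic_le_of_frontier hUo hUb hw (hwc.mono hUc) (fun x hx => hws x (hUf hx)) x h
  · exact hws x h

/-- Uniqueness for the homogeneous transmission problem. -/
theorem transmission_eq_zero {C c : ℂ} {R r k : ℝ} (hr : 0 < r) (hk : 0 < k)
    (hsub : Metric.closedBall c r ⊆ Metric.ball C R) {u w : ℂ → ℝ}
    (hu : HarmonicOnNhd u (Metric.ball c r)) (huc : ContinuousOn u (Metric.closedBall c r))
    (hw : HarmonicOnNhd w (Metric.ball C R \ Metric.closedBall c r))
    (hwc : ContinuousOn w (Metric.closedBall C R \ Metric.ball c r))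
    (hw0 : ∀ x ∈ Metric.sphere C R, w x = 0) (huw : ∀ x ∈ Metric.sphere c r, u x = w x)
    (ht : ∀ x ∈ Metric.sphere c r, ∃ a b : ℝ,
      HasDerivWithinAt (fun t : ℝ => w (x + t • ((r⁻¹ : ℝ) • (x - c)))) a (Ici 0) 0 ∧
      HasDerivWithinAt (fun t : ℝ => u (x + t • ((r⁻¹ : ℝ) • (x - c)))) b (Iic 0) 0 ∧ a = k * b) :
    (∀ x ∈ Metric.closedBall c r, u x = 0) ∧
      ∀ x ∈ Metric.closedBall C R \ Metric.ball c r, w x = 0 := by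
  have h1 := transmission_nonpos hr hk hsub hu huc hw hwc hw0 huw ht
  have h2 := transmission_nonpos (u := -u) (w := -w) hr hk hsub hu.neg huc.neg hw.neg hwc.neg
    (fun x hx => by simp [hw0 x hx]) (fun x hx => by simp [huw x hx]) (fun x hx => by
      obtain ⟨a, b, ha, hb, hab⟩ := ht x hx
      exact ⟨-a, -b, ha.neg, hb.neg, by rw [hab]; ring⟩)
  refine ⟨fun x hx => le_antisymm (h1.1 x hx) ?_, fun x hx => le_antisymm (h1.2 x hx) ?_⟩
  · have := h2.1 x hx; simpa using this
  · have := h2.2 x hx; simpa using this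

/-! ### The geometry of the two circles in the coordinate `w = e^{-(ξ + iθ)}` -/

/-- The admissible radii and distances. -/
structure Admissible (ri re ε : ℝ) : Prop where
  ri_pos : 0 < ri
  ri_lt_re : ri < re
  eps_pos : 0 < ε
  eps_lt : ε < re - ri

/-- The radius `e^{-ξᵢ}` of the image of `∂D`. -/
def rhoI (ri re ε : ℝ) : ℝ := ri / (ci ri re ε + alpha ri re ε)

/-- The radius `e^{-ξₑ}` of the image of `∂Ω`. -/
def rhoE (ri re ε : ℝ) : ℝ := re / (ce ri re ε + alpha ri re ε)

/-- The coordinate `w = e^{-(ξ + iθ)}`. -/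
def wMap (ri re ε : ℝ) (z : ℂ) : ℂ :=
  (alpha ri re ε - (z + x0 ri re ε)) / (alpha ri re ε + (z + x0 ri re ε))

/-- The inverse of `wMap`. -/
def zMap (ri re ε : ℝ) (W : ℂ) : ℂ := alpha ri re ε * (1 - W) / (1 + W) - x0 ri re ε

/-- Under `c² - α² = r²` one has `(r/(c + α))² = (c - α)/(c + α)`, so the difference is a positive
multiple of the power of `z` with respect to the circle. Its sign therefore decides on which side of
the circle `z` lies. -/
theorem norm_sq_apollonius {α c r : ℝ} (hα : 0 < α) (hc : 0 < c) (h : c ^ 2 - α ^ 2 = r ^ 2)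
    {z : ℂ} (hz : α + z ≠ 0) :
    ‖(α - z) / (α + z)‖ ^ 2 - (r / (c + α)) ^ 2 =
      2 * α / ((c + α) * ‖α + z‖ ^ 2) * (‖z - c‖ ^ 2 - r ^ 2) := by
  have h1 : ‖(α : ℂ) + z‖ ^ 2 ≠ 0 := pow_ne_zero _ (norm_ne_zero_iff.2 hz)
  have h2 : c + α ≠ 0 := by positivity
  have e1 : ‖(α : ℂ) - z‖ ^ 2 = (α - z.re) ^ 2 + z.im ^ 2 := by
    rw [← Complex.normSq_eq_norm_sq, Complex.normSq_apply]; simp; ring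
  have e2 : ‖(α : ℂ) + z‖ ^ 2 = (α + z.re) ^ 2 + z.im ^ 2 := by
    rw [← Complex.normSq_eq_norm_sq, Complex.normSq_apply]; simp; ring
  have e3 : ‖z - c‖ ^ 2 = (z.re - c) ^ 2 + z.im ^ 2 := by
    rw [← Complex.normSq_eq_norm_sq, Complex.normSq_apply]; simp; ring
  rw [norm_div, div_pow, div_pow, ← h, e3]
  field_simp
  rw [e1, e2]
  ring

section

variable {α c r : ℝ} (hα : 0 < α) (hc : 0 < c) (hr : 0 < r) (h : c ^ 2 - α ^ 2 = r ^ 2)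
  {z : ℂ} (hz : α + z ≠ 0)

include hα hc hr h hz

theorem norm_apollonius_lt_iff : ‖(α - z) / (α + z)‖ < r / (c + α) ↔ ‖z - c‖ < r := by
  have e := norm_sq_apollonius hα hc h hz
  have hK : 0 < 2 * α / ((c + α) * ‖α + z‖ ^ 2) := by
    have := norm_pos_iff.2 hz
    positivity
  have hρ : 0 < r / (c + α) := by positivity
  rw [← sq_lt_sq₀ (norm_nonneg _) hρ.le, ← sq_lt_sq₀ (norm_nonneg _) hr.le, ← sub_neg, e,
    ← sub_neg (a := ‖z - c‖ ^ 2)]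
  exact ⟨fun h => by by_contra! h'; nlinarith, fun h => mul_neg_of_pos_of_neg hK h⟩

theorem norm_apollonius_le_iff : ‖(α - z) / (α + z)‖ ≤ r / (c + α) ↔ ‖z - c‖ ≤ r := by
  have e := norm_sq_apollonius hα hc h hz
  have hK : 0 < 2 * α / ((c + α) * ‖α + z‖ ^ 2) := by
    have := norm_pos_iff.2 hz
    positivity
  have hρ : 0 < r / (c + α) := by positivity
  rw [← sq_le_sq₀ (norm_nonneg _) hρ.le, ← sq_le_sq₀ (norm_nonneg _) hr.le, ← sub_nonpos, e,
    ← sub_nonpos (a := ‖z - c‖ ^ 2)]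
  exact ⟨fun h => by by_contra! h'; nlinarith, fun h => mul_nonpos_of_nonneg_of_nonpos hK.le h⟩

end

namespace Admissible

variable {ri re ε : ℝ} (H : Admissible ri re ε)

include H

theorem re_pos : 0 < re := H.ri_pos.trans H.ri_lt_re

theorem gap_pos : 0 < re - ri - ε := by linarith [H.eps_lt]

theorem alpha_pos : 0 < alpha ri re ε := by
  have h1 := H.gap_pos
  have h2 := H.ri_pos
  have h3 := H.eps_pos
  have h4 := H.re_pos
  have h5 : 0 < 2 * re - ε := by linarith [H.eps_lt]
  have h6 : 0 < 2 * re - 2 * ri - ε := by linarith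
  rw [alpha]
  positivity

theorem alpha_sq : alpha ri re ε ^ 2 =
    ε * (2 * ri + ε) * (2 * re - ε) * (2 * re - 2 * ri - ε) / (4 * (re - ri - ε) ^ 2) := by
  have h1 := H.gap_pos
  have h2 := H.ri_pos
  have h3 := H.eps_pos
  have h5 : 0 < 2 * re - ε := by linarith [H.eps_lt]
  have h6 : 0 < 2 * re - 2 * ri - ε := by linarith
  rw [alpha, div_pow, Real.sq_sqrt (by positivity)]
  ring

/-- Together with `ce_sq_sub` this places both translated circles in the Apollonius family with
limit points `±α`, so one Möbius map makes them concentric. -/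
theorem ci_sq_sub : ci ri re ε ^ 2 - alpha ri re ε ^ 2 = ri ^ 2 := by
  have h1 := H.gap_pos.ne'
  rw [H.alpha_sq, ci]
  field_simp
  ring

theorem ce_sq_sub : ce ri re ε ^ 2 - alpha ri re ε ^ 2 = re ^ 2 := by
  have h1 := H.gap_pos.ne'
  rw [H.alpha_sq, ce, ci]
  field_simp
  ring

theorem ci_gt : ri < ci ri re ε := by
  have h1 := H.gap_pos
  have h3 := H.eps_pos
  rw [ci, lt_div_iff₀ (by linarith)]
  nlinarith [H.ri_pos, H.ri_lt_re]

theorem ci_pos : 0 < ci ri re ε := H.ri_pos.trans H.ci_gt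

theorem ce_eq : ce ri re ε = ci ri re ε + (re - ri - ε) := by rw [ce]; ring

theorem ce_pos : 0 < ce ri re ε := by
  rw [H.ce_eq]; linarith [H.ci_pos, H.gap_pos]

theorem re_lt_ce : re < ce ri re ε := by
  have h1 := H.ce_sq_sub
  have h2 := H.alpha_pos
  have h3 := H.ce_pos
  nlinarith [H.re_pos]

theorem x0_pos : 0 < x0 ri re ε := by
  rw [x0]; linarith [H.re_lt_ce]

theorem rhoI_pos : 0 < rhoI ri re ε := by
  have := H.ri_pos
  have := H.ci_pos
  have := H.alpha_pos
  rw [rhoI]; positivity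

theorem rhoE_pos : 0 < rhoE ri re ε := by
  have := H.re_pos
  have := H.ce_pos
  have := H.alpha_pos
  rw [rhoE]; positivity

theorem rhoE_lt_one : rhoE ri re ε < 1 := by
  have := H.re_lt_ce
  have := H.alpha_pos
  have := H.re_pos
  rw [rhoE, div_lt_one (by linarith)]
  linarith

theorem rhoI_lt_rhoE : rhoI ri re ε < rhoE ri re ε := by
  have h1 := H.ci_gt
  have h2 := H.alpha_pos
  have h3 := H.ri_pos
  have h4 := H.gap_pos
  have h5 := H.eps_pos
  rw [rhoI, rhoE, div_lt_div_iff₀ (by linarith) (by linarith [H.ce_pos]), H.ce_eq]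
  nlinarith [mul_pos h2 (sub_pos.2 H.ri_lt_re), mul_pos (sub_pos.2 h1) (sub_pos.2 H.ri_lt_re)]

theorem rhoI_lt_one : rhoI ri re ε < 1 := H.rhoI_lt_rhoE.trans H.rhoE_lt_one

theorem exp_neg_xiI : Real.exp (-xiI ri re ε) = rhoI ri re ε := by
  have h1 := H.ci_sq_sub
  have h2 := H.alpha_pos
  have h3 := H.ri_pos
  have h4 := H.ci_gt
  have h5 : 0 < ci ri re ε - alpha ri re ε := by nlinarith
  have e : (ci ri re ε + alpha ri re ε) / (ci ri re ε - alpha ri re ε) =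
      (rhoI ri re ε)⁻¹ ^ 2 := by
    rw [rhoI, inv_div, div_pow, ← h1]
    have : ci ri re ε ^ 2 - alpha ri re ε ^ 2 ≠ 0 := by rw [h1]; positivity
    field_simp
    ring
  rw [xiI, e, Real.log_pow, Real.log_inv]
  push_cast
  rw [show -(1 / 2 * (2 * -Real.log (rhoI ri re ε))) = Real.log (rhoI ri re ε) by ring,
    Real.exp_log H.rhoI_pos]

theorem exp_neg_xiE : Real.exp (-xiE ri re ε) = rhoE ri re ε := by
  have h1 := H.ce_sq_sub
  have h2 := H.alpha_pos
  have h3 := H.re_pos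
  have h4 := H.re_lt_ce
  have h5 : 0 < ce ri re ε - alpha ri re ε := by nlinarith
  have e : (ce ri re ε + alpha ri re ε) / (ce ri re ε - alpha ri re ε) =
      (rhoE ri re ε)⁻¹ ^ 2 := by
    rw [rhoE, inv_div, div_pow, ← h1]
    have : ce ri re ε ^ 2 - alpha ri re ε ^ 2 ≠ 0 := by rw [h1]; positivity
    field_simp
    ring
  rw [xiE, e, Real.log_pow, Real.log_inv]
  push_cast
  rw [show -(1 / 2 * (2 * -Real.log (rhoE ri re ε))) = Real.log (rhoE ri re ε) by ring,
    Real.exp_log H.rhoE_pos]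

theorem sub_re_eq (z : ℂ) : z + x0 ri re ε - ce ri re ε = z - re := by
  rw [x0]; push_cast; ring

theorem sub_centerD_eq (z : ℂ) : z + x0 ri re ε - ci ri re ε = z - centerD ri ε := by
  rw [x0, ce, centerD]; push_cast; ring

/-- The pole `-α - x₀` of `wMap` has negative real part, while the closed disk lies in the right
half-plane. -/
theorem add_ne_zero_of_mem {z : ℂ} (hz : z ∈ Metric.closedBall (re : ℂ) re) :
    (alpha ri re ε : ℂ) + (z + x0 ri re ε) ≠ 0 := by
  intro h
  rw [Metric.mem_closedBall, dist_eq_norm] at hz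
  have h1 := congrArg Complex.re h
  simp only [Complex.add_re, Complex.ofReal_re, Complex.zero_re] at h1
  have h2 := (abs_le.1 ((Complex.abs_re_le_norm _).trans hz)).1
  simp only [Complex.sub_re, Complex.ofReal_re] at h2
  linarith [H.alpha_pos, H.x0_pos]

theorem closedBall_subset :
    Metric.closedBall (centerD ri ε) ri ⊆ Metric.ball (re : ℂ) re := by
  refine Metric.closedBall_subset_ball' ?_
  have : dist (centerD ri ε) (re : ℂ) = re - ri - ε := by
    rw [dist_eq_norm, centerD, ← Complex.ofReal_sub, Complex.norm_real, Real.norm_eq_abs,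
      abs_of_neg (by linarith [H.gap_pos])]
    ring
  rw [this]
  linarith [H.eps_pos]

theorem norm_wMap_lt_rhoE_iff {z : ℂ} (hz : (alpha ri re ε : ℂ) + (z + x0 ri re ε) ≠ 0) :
    ‖wMap ri re ε z‖ < rhoE ri re ε ↔ z ∈ Metric.ball (re : ℂ) re := by
  rw [Metric.mem_ball, dist_eq_norm, ← H.sub_re_eq]
  exact norm_apollonius_lt_iff H.alpha_pos H.ce_pos H.re_pos H.ce_sq_sub hz

theorem norm_wMap_le_rhoE_iff {z : ℂ} (hz : (alpha ri re ε : ℂ) + (z + x0 ri re ε) ≠ 0) :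
    ‖wMap ri re ε z‖ ≤ rhoE ri re ε ↔ z ∈ Metric.closedBall (re : ℂ) re := by
  rw [Metric.mem_closedBall, dist_eq_norm, ← H.sub_re_eq]
  exact norm_apollonius_le_iff H.alpha_pos H.ce_pos H.re_pos H.ce_sq_sub hz

theorem norm_wMap_lt_rhoI_iff {z : ℂ} (hz : (alpha ri re ε : ℂ) + (z + x0 ri re ε) ≠ 0) :
    ‖wMap ri re ε z‖ < rhoI ri re ε ↔ z ∈ Metric.ball (centerD ri ε) ri := by
  rw [Metric.mem_ball, dist_eq_norm, ← H.sub_centerD_eq]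
  exact norm_apollonius_lt_iff H.alpha_pos H.ci_pos H.ri_pos H.ci_sq_sub hz

theorem norm_wMap_le_rhoI_iff {z : ℂ} (hz : (alpha ri re ε : ℂ) + (z + x0 ri re ε) ≠ 0) :
    ‖wMap ri re ε z‖ ≤ rhoI ri re ε ↔ z ∈ Metric.closedBall (centerD ri ε) ri := by
  rw [Metric.mem_closedBall, dist_eq_norm, ← H.sub_centerD_eq]
  exact norm_apollonius_le_iff H.alpha_pos H.ci_pos H.ri_pos H.ci_sq_sub hz

theorem norm_wMap_eq_rhoE {z : ℂ} (hz : z ∈ Metric.sphere (re : ℂ) re) :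
    ‖wMap ri re ε z‖ = rhoE ri re ε := by
  have h0 := H.add_ne_zero_of_mem (Metric.sphere_subset_closedBall hz)
  refine le_antisymm ((H.norm_wMap_le_rhoE_iff h0).2 (Metric.sphere_subset_closedBall hz)) ?_
  by_contra! h
  exact (Metric.mem_ball.1 ((H.norm_wMap_lt_rhoE_iff h0).1 h)).ne hz

theorem norm_wMap_eq_rhoI {z : ℂ} (hz : z ∈ Metric.sphere (centerD ri ε) ri) :
    ‖wMap ri re ε z‖ = rhoI ri re ε := by
  have h0 := H.add_ne_zero_of_mem
    (Metric.ball_subset_closedBall (H.closedBall_subset (Metric.sphere_subset_closedBall hz)))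
  refine le_antisymm ((H.norm_wMap_le_rhoI_iff h0).2 (Metric.sphere_subset_closedBall hz)) ?_
  by_contra! h
  exact (Metric.mem_ball.1 ((H.norm_wMap_lt_rhoI_iff h0).1 h)).ne hz

theorem one_add_wMap {z : ℂ} (hz : (alpha ri re ε : ℂ) + (z + x0 ri re ε) ≠ 0) :
    1 + wMap ri re ε z = 2 * alpha ri re ε / (alpha ri re ε + (z + x0 ri re ε)) := by
  rw [wMap]
  field_simp
  ring

theorem hasDerivAt_wMap {z : ℂ} (hz : (alpha ri re ε : ℂ) + (z + x0 ri re ε) ≠ 0) :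
    HasDerivAt (wMap ri re ε) (-(1 + wMap ri re ε z) ^ 2 / (2 * alpha ri re ε)) z := by
  have hα : (alpha ri re ε : ℂ) ≠ 0 := by exact_mod_cast H.alpha_pos.ne'
  have h1 : HasDerivAt (fun z : ℂ => (alpha ri re ε : ℂ) - (z + x0 ri re ε)) (-1) z := by
    simpa using ((hasDerivAt_id z).add_const _).const_sub _
  have h2 : HasDerivAt (fun z : ℂ => (alpha ri re ε : ℂ) + (z + x0 ri re ε)) 1 z := by
    exact ((hasDerivAt_id z).add_const (x0 ri re ε : ℂ)).const_add (alpha ri re ε : ℂ)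
  refine (h1.div h2 hz).congr_deriv ?_
  rw [H.one_add_wMap hz]
  field_simp
  ring

theorem one_add_ne_zero {W : ℂ} (hW : ‖W‖ < 1) : 1 + W ≠ 0 := by
  intro h
  rw [show W = -1 by linear_combination h] at hW
  simp at hW

theorem alpha_add_zMap {W : ℂ} (hW : ‖W‖ < 1) :
    (alpha ri re ε : ℂ) + (zMap ri re ε W + x0 ri re ε) = 2 * alpha ri re ε / (1 + W) := by
  have := H.one_add_ne_zero hW
  rw [zMap]
  field_simp
  ring

theorem alpha_add_zMap_ne {W : ℂ} (hW : ‖W‖ < 1) :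
    (alpha ri re ε : ℂ) + (zMap ri re ε W + x0 ri re ε) ≠ 0 := by
  rw [H.alpha_add_zMap hW]
  have hα : (alpha ri re ε : ℂ) ≠ 0 := by exact_mod_cast H.alpha_pos.ne'
  exact div_ne_zero (mul_ne_zero two_ne_zero hα) (H.one_add_ne_zero hW)

theorem wMap_zMap {W : ℂ} (hW : ‖W‖ < 1) : wMap ri re ε (zMap ri re ε W) = W := by
  have h1 := H.one_add_ne_zero hW
  have hα : (alpha ri re ε : ℂ) ≠ 0 := by exact_mod_cast H.alpha_pos.ne'
  rw [wMap, H.alpha_add_zMap hW, zMap]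
  field_simp
  ring

theorem zMap_wMap {z : ℂ} (hz : (alpha ri re ε : ℂ) + (z + x0 ri re ε) ≠ 0) :
    zMap ri re ε (wMap ri re ε z) = z := by
  have hα : (alpha ri re ε : ℂ) ≠ 0 := by exact_mod_cast H.alpha_pos.ne'
  rw [zMap, H.one_add_wMap hz, wMap]
  field_simp
  ring

theorem zMap_mem_ball {W : ℂ} (hW : ‖W‖ < rhoE ri re ε) :
    zMap ri re ε W ∈ Metric.ball (re : ℂ) re := by
  have h1 := hW.trans H.rhoE_lt_one
  rw [← H.norm_wMap_lt_rhoE_iff (H.alpha_add_zMap_ne h1), H.wMap_zMap h1]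
  exact hW

theorem zMap_mem_closedBall {W : ℂ} (hW : ‖W‖ ≤ rhoE ri re ε) :
    zMap ri re ε W ∈ Metric.closedBall (re : ℂ) re := by
  have h1 := hW.trans_lt H.rhoE_lt_one
  rw [← H.norm_wMap_le_rhoE_iff (H.alpha_add_zMap_ne h1), H.wMap_zMap h1]
  exact hW

theorem hasDerivAt_zMap {W : ℂ} (hW : ‖W‖ < 1) :
    HasDerivAt (zMap ri re ε) (-2 * alpha ri re ε / (1 + W) ^ 2) W := by
  have h1 := H.one_add_ne_zero hW
  have h2 : HasDerivAt (fun W : ℂ => (alpha ri re ε : ℂ) * (1 - W)) (-alpha ri re ε) W := by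
    simpa using ((hasDerivAt_id W).const_sub 1).const_mul (alpha ri re ε : ℂ)
  have h3 : HasDerivAt (fun W : ℂ => 1 + W) 1 W := (hasDerivAt_id W).const_add 1
  refine ((h2.div h3 h1).sub_const (x0 ri re ε : ℂ)).congr_deriv ?_
  field_simp
  ring

/-- The images of the normals to `∂D` are radial. -/
theorem deriv_wMap_mul_normal {z : ℂ} (hz : z ∈ Metric.sphere (centerD ri ε) ri) :
    ∃ l : ℝ, -(1 + wMap ri re ε z) ^ 2 / (2 * alpha ri re ε) * ((ri⁻¹ : ℝ) • (z - centerD ri ε)) =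
      l * wMap ri re ε z := by
  have hsub := Metric.ball_subset_closedBall
    (H.closedBall_subset (Metric.sphere_subset_closedBall hz))
  have h0 := H.add_ne_zero_of_mem hsub
  have hα : (alpha ri re ε : ℂ) ≠ 0 := by exact_mod_cast H.alpha_pos.ne'
  set y : ℂ := z + x0 ri re ε with hy
  have hyc : z - centerD ri ε = y - ci ri re ε := (H.sub_centerD_eq z).symm
  have hn : ‖y - ci ri re ε‖ = ri := by rw [← hyc, ← dist_eq_norm]; exact hz
  have hre0 : y.re ≠ 0 := by
    have h2 := (abs_le.1 ((Complex.abs_re_le_norm _).trans hn.le)).1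
    simp only [Complex.sub_re, Complex.ofReal_re] at h2
    have := H.ci_gt
    intro h; linarith
  have hsq : (y - ci ri re ε) * ((starRingEnd ℂ) y - ci ri re ε) = ri ^ 2 := by
    have h3 := Complex.mul_conj (y - ci ri re ε)
    rw [Complex.normSq_eq_norm_sq, hn, map_sub, Complex.conj_ofReal] at h3
    rw [h3]; push_cast; ring
  have hα2 : (ci ri re ε : ℂ) ^ 2 - (alpha ri re ε : ℂ) ^ 2 = (ri : ℂ) ^ 2 := by
    exact_mod_cast H.ci_sq_sub
  have hadd : y + (starRingEnd ℂ) y = ((2 * y.re : ℝ) : ℂ) := Complex.add_conj y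
  -- On the circle `|y|² - c(y + ȳ) = -α²`, hence `α² - y² = -(y - c)(y + ȳ)`.
  have key : ((alpha ri re ε : ℂ) - y) * (alpha ri re ε + y) =
      -(y - ci ri re ε) * ((2 * y.re : ℝ) : ℂ) := by
    rw [← hadd]
    linear_combination hsq - hα2
  -- `l` is the logarithmic derivative `w' ν / w = -2αν / ((α - y)(α + y))`, which `key` shows to be
  -- real.
  refine ⟨ri⁻¹ * alpha ri re ε / y.re, ?_⟩
  rw [H.one_add_wMap h0, wMap, ← hy, hyc, Complex.real_smul]
  have hre1 : (y.re : ℂ) ≠ 0 := by exact_mod_cast hre0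
  have hri : (ri : ℂ) ≠ 0 := by exact_mod_cast H.ri_pos.ne'
  push_cast at key ⊢
  field_simp
  linear_combination (-1) * key

end Admissible

/-! ### The solution as a series of images -/

/-- The series of images `∑ τ^m F(z(q^m W))`. -/
def imageSeries (ri re ε τ q : ℝ) (F : ℂ → ℂ) (W : ℂ) : ℂ :=
  ∑' m : ℕ, (τ : ℂ) ^ m * F (zMap ri re ε ((q : ℂ) ^ m * W))

/-- The weight `x (1 + W)² / (1 + x W)²`. -/
def kerM (W : ℂ) (x : ℝ) : ℂ := x * (1 + W) ^ 2 / (1 + x * W) ^ 2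

/-- The series `∑ τ^m M(s q^m) F₁(z(s q^m W))`, by which the gradient of the solution is expressed. -/
def gradSeries (ri re ε τ q s : ℝ) (F₁ : ℂ → ℂ) (W : ℂ) : ℂ :=
  ∑' m : ℕ, (τ : ℂ) ^ m * (kerM W (s * q ^ m) * F₁ (zMap ri re ε ((s * q ^ m : ℝ) * W)))

/-- The phase `B²`, where `B` is the phase of `(1 + W)² / W`. -/
def phaseSq (W : ℂ) : ℂ :=
  (1 + W) ^ 2 * (starRingEnd ℂ) W / (W * (starRingEnd ℂ) ((1 + W) ^ 2))

/-- The ratio `e^{-2(ξᵢ - ξₑ)}`. -/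
def ratioQ (ri re ε : ℝ) : ℝ := (rhoI ri re ε / rhoE ri re ε) ^ 2

/-- What is needed of the holomorphic extension of the boundary datum. -/
structure IsExtension (re : ℝ) (F F₁ : ℂ → ℂ) (L : ℝ) : Prop where
  nonneg : 0 ≤ L
  cont : ContinuousOn F (Metric.closedBall (re : ℂ) re)
  deriv : ∀ z ∈ Metric.ball (re : ℂ) re, HasDerivAt F (F₁ z) z
  lip : ∀ x ∈ Metric.closedBall (re : ℂ) re, ∀ y ∈ Metric.closedBall (re : ℂ) re,
    ‖F₁ x - F₁ y‖ ≤ L * ‖x - y‖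

theorem IsExtension.cont_deriv {re : ℝ} {F F₁ : ℂ → ℂ} {L : ℝ} (E : IsExtension re F F₁ L) :
    ContinuousOn F₁ (Metric.closedBall (re : ℂ) re) := by
  have h : LipschitzOnWith ⟨L, E.nonneg⟩ F₁ (Metric.closedBall (re : ℂ) re) :=
    LipschitzOnWith.of_dist_le_mul fun x hx y hy => by
      rw [dist_eq_norm, dist_eq_norm]; exact E.lip x hx y hy
  exact h.continuousOn

theorem IsExtension.exists_bound {re : ℝ} {F F₁ : ℂ → ℂ} {L : ℝ} (E : IsExtension re F F₁ L) :
    ∃ B, 0 ≤ B ∧ (∀ z ∈ Metric.closedBall (re : ℂ) re, ‖F z‖ ≤ B) ∧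
      ∀ z ∈ Metric.closedBall (re : ℂ) re, ‖F₁ z‖ ≤ B := by
  obtain ⟨B₁, h₁⟩ := (isCompact_closedBall (re : ℂ) re).exists_bound_of_continuousOn E.cont
  obtain ⟨B₂, h₂⟩ := (isCompact_closedBall (re : ℂ) re).exists_bound_of_continuousOn E.cont_deriv
  exact ⟨max 0 (max B₁ B₂), le_max_left _ _,
    fun z hz => (h₁ z hz).trans ((le_max_left _ _).trans (le_max_right _ _)),
    fun z hz => (h₂ z hz).trans ((le_max_right _ _).trans (le_max_right _ _))⟩

/-! ### Convergence, functional equation and derivative of the series of images -/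

namespace Admissible

variable {ri re ε : ℝ} (H : Admissible ri re ε)

include H

theorem ratioQ_pos : 0 < ratioQ ri re ε := by
  have := H.rhoI_pos
  have := H.rhoE_pos
  rw [ratioQ]; positivity

theorem ratioQ_lt_one : ratioQ ri re ε < 1 := by
  have h1 := H.rhoI_pos
  have h2 := H.rhoE_pos
  rw [ratioQ]
  refine pow_lt_one₀ (by positivity) ?_ two_ne_zero
  rw [div_lt_one h2]
  exact H.rhoI_lt_rhoE

theorem norm_ratioQ_pow_mul_le (m : ℕ) (W : ℂ) : ‖(ratioQ ri re ε : ℂ) ^ m * W‖ ≤ ‖W‖ := by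
  rw [norm_mul, norm_pow, Complex.norm_real, Real.norm_of_nonneg H.ratioQ_pos.le]
  exact mul_le_of_le_one_left (norm_nonneg _) (pow_le_one₀ H.ratioQ_pos.le H.ratioQ_lt_one.le)

section Series

variable {F F₁ : ℂ → ℂ} {L : ℝ} (E : IsExtension re F F₁ L) {τ : ℝ} (hτ : |τ| < 1)

include E hτ

theorem summable_imageSeries {W : ℂ} (hW : ‖W‖ ≤ rhoE ri re ε) :
    Summable fun m : ℕ => (τ : ℂ) ^ m * F (zMap ri re ε ((ratioQ ri re ε : ℂ) ^ m * W)) := by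
  obtain ⟨B, -, hB, -⟩ := E.exists_bound
  refine Summable.of_norm_bounded
    ((summable_geometric_of_lt_one (abs_nonneg τ) hτ).mul_right B) fun m => ?_
  rw [norm_mul, norm_pow, Complex.norm_real, Real.norm_eq_abs]
  exact mul_le_mul_of_nonneg_left (hB _ (H.zMap_mem_closedBall
    ((H.norm_ratioQ_pow_mul_le m W).trans hW))) (by positivity)

theorem continuousOn_imageSeries :
    ContinuousOn (imageSeries ri re ε τ (ratioQ ri re ε) F)
      (Metric.closedBall 0 (rhoE ri re ε)) := by
  obtain ⟨B, -, hB, -⟩ := E.exists_bound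
  have hmem : ∀ m : ℕ, ∀ W ∈ Metric.closedBall (0 : ℂ) (rhoE ri re ε),
      ‖(ratioQ ri re ε : ℂ) ^ m * W‖ ≤ rhoE ri re ε := fun m W hW =>
    (H.norm_ratioQ_pow_mul_le m W).trans (by simpa using hW)
  refine continuousOn_tsum (u := fun m => |τ| ^ m * B) (fun m => ?_)
    ((summable_geometric_of_lt_one (abs_nonneg τ) hτ).mul_right B) fun m W hW => ?_
  · refine continuousOn_const.mul (E.cont.comp ?_ fun W hW => H.zMap_mem_closedBall (hmem m W hW))
    intro W hW
    have h1 := (H.hasDerivAt_zMap ((hmem m W hW).trans_lt H.rhoE_lt_one)).continuousAt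
    exact (ContinuousAt.comp (f := fun W : ℂ => (ratioQ ri re ε : ℂ) ^ m * W) h1
      (by fun_prop)).continuousWithinAt
  · rw [norm_mul, norm_pow, Complex.norm_real, Real.norm_eq_abs]
    exact mul_le_mul_of_nonneg_left (hB _ (H.zMap_mem_closedBall (hmem m W hW))) (by positivity)

/-- Shifting the summation index. This identity is what enforces the Dirichlet condition on `∂Ω`. -/
theorem imageSeries_sub {W : ℂ} (hW : ‖W‖ ≤ rhoE ri re ε) :
    imageSeries ri re ε τ (ratioQ ri re ε) F W -
      τ * imageSeries ri re ε τ (ratioQ ri re ε) F (ratioQ ri re ε * W) = F (zMap ri re ε W) := by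
  have hs := H.summable_imageSeries E hτ hW
  rw [imageSeries, hs.tsum_eq_zero_add, imageSeries, ← tsum_mul_left]
  simp only [pow_zero, one_mul]
  rw [add_sub_assoc, add_eq_left, sub_eq_zero]
  refine tsum_congr fun m => ?_
  rw [pow_succ, pow_succ]
  ring_nf

/-- Termwise differentiation gives `q^m z'(q^m W) F₁`, and `q^m z'(q^m W) = z'(W) kerM W (q^m)`. The
common factor `z'(W)` is pulled out because it cancels against `w'(z)` in the potentials. -/
theorem hasDerivAt_imageSeries {W : ℂ} (hW : ‖W‖ < rhoE ri re ε) :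
    HasDerivAt (imageSeries ri re ε τ (ratioQ ri re ε) F)
      (-2 * alpha ri re ε / (1 + W) ^ 2 *
        gradSeries ri re ε τ (ratioQ ri re ε) 1 F₁ W) W := by
  obtain ⟨B, hB0, -, hB⟩ := E.exists_bound
  set q := ratioQ ri re ε with hq
  have hq0 := H.ratioQ_pos
  have hq1 := H.ratioQ_lt_one
  have hmem : ∀ m : ℕ, ∀ W : ℂ, ‖W‖ < rhoE ri re ε → ‖(q : ℂ) ^ m * W‖ < rhoE ri re ε :=
    fun m W hW => (H.norm_ratioQ_pow_mul_le m W).trans_lt hW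
  have hlow : ∀ m : ℕ, ∀ W : ℂ, ‖W‖ < rhoE ri re ε →
      1 - rhoE ri re ε ≤ ‖1 + (q : ℂ) ^ m * W‖ := fun m W hW => by
    have := norm_sub_norm_le (1 : ℂ) (-((q : ℂ) ^ m * W))
    rw [norm_one, norm_neg, sub_neg_eq_add] at this
    linarith [hmem m W hW]
  have hρ : 0 < 1 - rhoE ri re ε := by linarith [H.rhoE_lt_one]
  have h := hasDerivAt_tsum_of_isPreconnected (𝕜 := ℂ)
    (g := fun (m : ℕ) W => (τ : ℂ) ^ m * F (zMap ri re ε ((q : ℂ) ^ m * W)))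
    (g' := fun m W => (τ : ℂ) ^ m * (F₁ (zMap ri re ε ((q : ℂ) ^ m * W)) *
      (-2 * alpha ri re ε / (1 + (q : ℂ) ^ m * W) ^ 2 * (q : ℂ) ^ m)))
    (u := fun m => |τ| ^ m * (B * (2 * alpha ri re ε / (1 - rhoE ri re ε) ^ 2)))
    ((summable_geometric_of_lt_one (abs_nonneg τ) hτ).mul_right _)
    (t := Metric.ball (0 : ℂ) (rhoE ri re ε)) Metric.isOpen_ball
    (convex_ball _ _).isPreconnected (y₀ := 0) (y := W) (fun m y hy => ?_) (fun m y hy => ?_)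
    (Metric.mem_ball_self H.rhoE_pos)
    (H.summable_imageSeries E hτ (by simpa using H.rhoE_pos.le)) (by simpa using hW)
  · refine h.congr_deriv ?_
    rw [gradSeries, ← tsum_mul_left]
    refine tsum_congr fun m => ?_
    have h1 := H.one_add_ne_zero (hW.trans H.rhoE_lt_one)
    have h2 := H.one_add_ne_zero ((hmem m W hW).trans H.rhoE_lt_one)
    rw [kerM]
    push_cast
    simp only [one_mul]
    field_simp
  · have hy' : ‖y‖ < rhoE ri re ε := by simpa using hy
    have h1 : HasDerivAt (fun W : ℂ => (q : ℂ) ^ m * W) ((q : ℂ) ^ m) y := by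
      simpa using (hasDerivAt_id y).const_mul ((q : ℂ) ^ m)
    have h2 := H.hasDerivAt_zMap ((hmem m y hy').trans H.rhoE_lt_one)
    have h3 := E.deriv _ (H.zMap_mem_ball (hmem m y hy'))
    exact (h3.comp y (h2.comp y h1)).const_mul _
  · have hy' : ‖y‖ < rhoE ri re ε := by simpa using hy
    rw [norm_mul, norm_pow, Complex.norm_real, Real.norm_eq_abs, norm_mul]
    refine mul_le_mul_of_nonneg_left ?_ (by positivity)
    refine mul_le_mul (hB _ (H.zMap_mem_closedBall (hmem m y hy').le)) ?_ (norm_nonneg _) hB0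
    have hqm : ‖(q : ℂ) ^ m‖ ≤ 1 := norm_pow_le_one (by
      rw [Complex.norm_real, Real.norm_of_nonneg hq0.le]; exact hq1.le) m
    rw [norm_mul, norm_div, norm_mul, norm_neg, norm_pow, Complex.norm_real,
      Real.norm_of_nonneg H.alpha_pos.le, Complex.norm_ofNat]
    have hα := H.alpha_pos
    refine (mul_le_of_le_one_right (by positivity) hqm).trans ?_
    gcongr
    exact hlow m y hy'

end Series

theorem wMap_eq_zero_or_mem {z : ℂ} (hz : z ∈ Metric.ball (re : ℂ) re \
    Metric.closedBall (centerD ri ε) ri) : rhoI ri re ε < ‖wMap ri re ε z‖ ∧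
      ‖wMap ri re ε z‖ < rhoE ri re ε := by
  have h0 := H.add_ne_zero_of_mem (Metric.ball_subset_closedBall hz.1)
  refine ⟨?_, (H.norm_wMap_lt_rhoE_iff h0).2 hz.1⟩
  by_contra! h
  exact hz.2 ((H.norm_wMap_le_rhoI_iff h0).1 h)

theorem continuousOn_wMap : ContinuousOn (wMap ri re ε) (Metric.closedBall (re : ℂ) re) :=
  fun _ hz => (H.hasDerivAt_wMap (H.add_ne_zero_of_mem hz)).continuousAt.continuousWithinAt

end Admissible

/-- The holomorphic function whose real part is the solution outside the inclusion. -/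
def outerPotential (ri re ε τ : ℝ) (F : ℂ → ℂ) (z : ℂ) : ℂ :=
  imageSeries ri re ε τ (ratioQ ri re ε) F (wMap ri re ε z) -
    τ * (starRingEnd ℂ) (imageSeries ri re ε τ (ratioQ ri re ε) F
      ((starRingEnd ℂ) (rhoI ri re ε ^ 2 / wMap ri re ε z)))

/-- The holomorphic function whose real part is the solution in the inclusion. -/
def innerPotential (ri re ε τ : ℝ) (F : ℂ → ℂ) (z : ℂ) : ℂ :=
  (1 - τ) * imageSeries ri re ε τ (ratioQ ri re ε) F (wMap ri re ε z)

/-- The weights satisfy the cocycle rule `kerM W r * kerM (rW) x = kerM W (rx)`. It rewrites a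
series at the reflected point `rW` as a series at `W` started at scale `r`. -/
theorem gradSeries_smul {ri re ε τ q r : ℝ} {F₁ : ℂ → ℂ} {W : ℂ} (h1 : 1 + (r : ℂ) * W ≠ 0)
    (h2 : 1 + W ≠ 0) :
    r * (1 + W) ^ 2 / (1 + r * W) ^ 2 * gradSeries ri re ε τ q 1 F₁ (r * W) =
      gradSeries ri re ε τ q r F₁ W := by
  rw [gradSeries, gradSeries, ← tsum_mul_left]
  refine tsum_congr fun m => ?_
  have e1 : ((1 * q ^ m : ℝ) : ℂ) * ((r : ℂ) * W) = ((r * q ^ m : ℝ) : ℂ) * W := by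
    push_cast; ring
  rw [kerM, kerM, e1]
  push_cast
  field_simp

/-- Reflection in the circle `|w| = ρ` preserves the argument, so the reflected point is a real
multiple of `w`. -/
theorem conj_sq_div (ρ : ℝ) {w : ℂ} (hw : w ≠ 0) :
    (starRingEnd ℂ) ((ρ : ℂ) ^ 2 / w) = ((ρ ^ 2 / ‖w‖ ^ 2 : ℝ) : ℂ) * w := by
  have hc : (starRingEnd ℂ) w ≠ 0 := (map_ne_zero _).2 hw
  have h1 : (‖w‖ : ℂ) ^ 2 = w * (starRingEnd ℂ) w := by
    rw [Complex.mul_conj, Complex.normSq_eq_norm_sq]; push_cast; ring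
  push_cast
  rw [h1, map_div₀, map_pow, Complex.conj_ofReal]
  field_simp

/-! ### Derivatives of the two potentials -/

namespace Admissible

variable {ri re ε : ℝ} (H : Admissible ri re ε)
  {F F₁ : ℂ → ℂ} {L : ℝ} (E : IsExtension re F F₁ L) {τ : ℝ} (hτ : |τ| < 1)

include H

/-- The reflected point stays in the disk where the image series converges. -/
theorem norm_reflect_lt {w : ℂ} (h1 : rhoI ri re ε ≤ ‖w‖) :
    ‖(starRingEnd ℂ) ((rhoI ri re ε : ℂ) ^ 2 / w)‖ < rhoE ri re ε := by
  have h0 := H.rhoI_pos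
  rw [RCLike.norm_conj, norm_div, norm_pow, Complex.norm_real, Real.norm_of_nonneg h0.le,
    div_lt_iff₀ (h0.trans_le h1)]
  nlinarith [H.rhoI_lt_rhoE]

include E hτ

theorem hasDerivAt_innerPotential {z : ℂ} (hz : z ∈ Metric.ball (re : ℂ) re) :
    HasDerivAt (innerPotential ri re ε τ F)
      ((1 - τ) * gradSeries ri re ε τ (ratioQ ri re ε) 1 F₁ (wMap ri re ε z)) z := by
  have h0 := H.add_ne_zero_of_mem (Metric.ball_subset_closedBall hz)
  have hw := (H.norm_wMap_lt_rhoE_iff h0).2 hz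
  have h1 := ((H.hasDerivAt_imageSeries E hτ hw).comp z (H.hasDerivAt_wMap h0)).const_mul
    (1 - τ : ℂ)
  refine h1.congr_deriv ?_
  have h2 := H.one_add_ne_zero (hw.trans H.rhoE_lt_one)
  have hα : (alpha ri re ε : ℂ) ≠ 0 := by exact_mod_cast H.alpha_pos.ne'
  field_simp

/-- The reflected term is holomorphic because it is conjugated both before and after `S`. This raw
form keeps the reflected point, which is convenient on `∂D`, where the reflection is the identity.
-/
theorem hasDerivAt_outerPotential_aux {z : ℂ} (hz : z ∈ Metric.ball (re : ℂ) re)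
    (hz2 : rhoI ri re ε ≤ ‖wMap ri re ε z‖) :
    HasDerivAt (outerPotential ri re ε τ F)
      (gradSeries ri re ε τ (ratioQ ri re ε) 1 F₁ (wMap ri re ε z) -
        τ * (starRingEnd ℂ) (-2 * alpha ri re ε /
          (1 + (starRingEnd ℂ) (rhoI ri re ε ^ 2 / wMap ri re ε z)) ^ 2 *
          gradSeries ri re ε τ (ratioQ ri re ε) 1 F₁
            ((starRingEnd ℂ) (rhoI ri re ε ^ 2 / wMap ri re ε z))) *
        (-(rhoI ri re ε : ℂ) ^ 2 / wMap ri re ε z ^ 2) *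
        (-(1 + wMap ri re ε z) ^ 2 / (2 * alpha ri re ε))) z := by
  have h0 := H.add_ne_zero_of_mem (Metric.ball_subset_closedBall hz)
  have hw := (H.norm_wMap_lt_rhoE_iff h0).2 hz
  have hw0 : wMap ri re ε z ≠ 0 := norm_pos_iff.1 (H.rhoI_pos.trans_le hz2)
  have hd := H.hasDerivAt_wMap h0
  have h1 := (H.hasDerivAt_imageSeries E hτ hw).comp z hd
  have h3 : HasDerivAt (fun z => (rhoI ri re ε : ℂ) ^ 2 / wMap ri re ε z)
      (-(rhoI ri re ε : ℂ) ^ 2 / wMap ri re ε z ^ 2 *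
        (-(1 + wMap ri re ε z) ^ 2 / (2 * alpha ri re ε))) z := by
    refine ((hasDerivAt_const z ((rhoI ri re ε : ℂ) ^ 2)).div hd hw0).congr_deriv ?_
    rw [zero_mul, zero_sub]
    ring
  have h4 := (H.hasDerivAt_imageSeries E hτ (H.norm_reflect_lt hz2)).conj_conj
  rw [Complex.conj_conj] at h4
  have h5 := ((h4.comp z h3).const_mul (τ : ℂ))
  refine (h1.sub h5).congr_deriv ?_
  have h2 := H.one_add_ne_zero (hw.trans H.rhoE_lt_one)
  have hα : (alpha ri re ε : ℂ) ≠ 0 := by exact_mod_cast H.alpha_pos.ne'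
  congr 1
  · field_simp
  · ring

/-- Both terms become series of the same kind at the same point `W`, started at the scales `1` and
`ρᵢ²/|W|²`, so one set of estimates covers them. -/
theorem hasDerivAt_outerPotential {z : ℂ} (hz : z ∈ Metric.ball (re : ℂ) re)
    (hz2 : rhoI ri re ε ≤ ‖wMap ri re ε z‖) :
    HasDerivAt (outerPotential ri re ε τ F)
      (gradSeries ri re ε τ (ratioQ ri re ε) 1 F₁ (wMap ri re ε z) +
        τ * phaseSq (wMap ri re ε z) * (starRingEnd ℂ) (gradSeries ri re ε τ (ratioQ ri re ε)
          (rhoI ri re ε ^ 2 / ‖wMap ri re ε z‖ ^ 2) F₁ (wMap ri re ε z))) z := by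
  refine (H.hasDerivAt_outerPotential_aux E hτ hz hz2).congr_deriv ?_
  have h0 := H.add_ne_zero_of_mem (Metric.ball_subset_closedBall hz)
  have hw := (H.norm_wMap_lt_rhoE_iff h0).2 hz
  set w := wMap ri re ε z with hwdef
  have hw0 : w ≠ 0 := norm_pos_iff.1 (H.rhoI_pos.trans_le hz2)
  have h2 := H.one_add_ne_zero (hw.trans H.rhoE_lt_one)
  have hα : (alpha ri re ε : ℂ) ≠ 0 := by exact_mod_cast H.alpha_pos.ne'
  have hlt := H.norm_reflect_lt hz2
  have hcs := conj_sq_div (rhoI ri re ε) hw0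
  set r : ℝ := rhoI ri re ε ^ 2 / ‖w‖ ^ 2 with hr
  have h3 : 1 + (r : ℂ) * w ≠ 0 := by
    rw [← hcs]; exact H.one_add_ne_zero (hlt.trans H.rhoE_lt_one)
  rw [hcs, ← gradSeries_smul h3 h2, sub_eq_add_neg]
  congr 1
  have hρ : (rhoI ri re ε : ℂ) ^ 2 = r * (w * (starRingEnd ℂ) w) := by
    have h5 := congrArg (starRingEnd ℂ) hcs
    rw [Complex.conj_conj, map_mul, Complex.conj_ofReal, div_eq_iff hw0] at h5
    rw [h5]; ring
  have hcw : (starRingEnd ℂ) w ≠ 0 := (map_ne_zero _).2 hw0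
  have hc2 : (starRingEnd ℂ) (1 + w) ≠ 0 := (map_ne_zero _).2 h2
  have hc3 : (starRingEnd ℂ) (1 + r * w) ≠ 0 := (map_ne_zero _).2 h3
  rw [hρ, phaseSq]
  simp only [map_mul, map_div₀, map_pow, map_neg, Complex.conj_ofReal, map_ofNat]
  generalize (starRingEnd ℂ) (1 + r * w) = X at *
  generalize (starRingEnd ℂ) (1 + w) = Y at *
  generalize (starRingEnd ℂ) w = wb at *
  generalize (starRingEnd ℂ) (gradSeries ri re ε τ (ratioQ ri re ε) 1 F₁ (r * w)) = G at *
  field_simp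

end Admissible

theorem abs_tau_lt_one {k : ℝ} (hk : 0 < k) : |tau k| < 1 := by
  rw [tau, abs_div, abs_of_pos (by linarith : 0 < k + 1), div_lt_one (by linarith), abs_lt]
  constructor <;> linarith

theorem one_add_tau {k : ℝ} (hk : 0 < k) : 1 + tau k = k * (1 - tau k) := by
  rw [tau]
  field_simp
  ring

/-! ### Boundary and transmission conditions; identification of the solution -/

namespace Admissible

variable {ri re ε : ℝ} (H : Admissible ri re ε)
  {F F₁ : ℂ → ℂ} {L : ℝ} (E : IsExtension re F F₁ L) {τ : ℝ} (hτ : |τ| < 1)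

include H

theorem conj_reflect_of_norm {w : ℂ} (hw : ‖w‖ = rhoI ri re ε) :
    (starRingEnd ℂ) ((rhoI ri re ε : ℂ) ^ 2 / w) = w := by
  have h0 : w ≠ 0 := norm_pos_iff.1 (by rw [hw]; exact H.rhoI_pos)
  rw [conj_sq_div _ h0, hw, div_self (pow_ne_zero _ H.rhoI_pos.ne'), Complex.ofReal_one, one_mul]

theorem not_mem_ball_of {z : ℂ} (hz : z ∈ Metric.closedBall (re : ℂ) re \
    Metric.ball (centerD ri ε) ri) : rhoI ri re ε ≤ ‖wMap ri re ε z‖ ∧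
      ‖wMap ri re ε z‖ ≤ rhoE ri re ε := by
  have h0 := H.add_ne_zero_of_mem hz.1
  refine ⟨?_, (H.norm_wMap_le_rhoE_iff h0).2 hz.1⟩
  by_contra! h
  exact hz.2 ((H.norm_wMap_lt_rhoI_iff h0).1 h)

include E hτ

theorem continuousOn_outerPotential :
    ContinuousOn (outerPotential ri re ε τ F)
      (Metric.closedBall (re : ℂ) re \ Metric.ball (centerD ri ε) ri) := by
  have hS := H.continuousOn_imageSeries E hτ
  have hw : ContinuousOn (wMap ri re ε)
      (Metric.closedBall (re : ℂ) re \ Metric.ball (centerD ri ε) ri) :=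
    H.continuousOn_wMap.mono sdiff_subset
  refine (hS.comp hw fun z hz => ?_).sub (continuousOn_const.mul
    (Complex.continuous_conj.comp_continuousOn (hS.comp
      (Complex.continuous_conj.comp_continuousOn (continuousOn_const.div hw fun z hz => ?_))
      fun z hz => ?_)))
  · simpa using (H.not_mem_ball_of hz).2
  · exact norm_pos_iff.1 (H.rhoI_pos.trans_le (H.not_mem_ball_of hz).1)
  · exact mem_closedBall_zero_iff.2 (H.norm_reflect_lt (H.not_mem_ball_of hz).1).le

/-- On `|w| = ρₑ` the reflected point is `q w`, so `imageSeries_sub` collapses the two series. -/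
theorem outerPotential_boundary {z : ℂ} (hz : z ∈ Metric.sphere (re : ℂ) re) :
    (outerPotential ri re ε τ F z).re = (F z).re := by
  have h0 := H.add_ne_zero_of_mem (Metric.sphere_subset_closedBall hz)
  have hw := H.norm_wMap_eq_rhoE hz
  have hw0 : wMap ri re ε z ≠ 0 := norm_pos_iff.1 (by rw [hw]; exact H.rhoE_pos)
  have h1 := H.imageSeries_sub E hτ hw.le
  rw [H.zMap_wMap h0] at h1
  have hq : (rhoI ri re ε ^ 2 / rhoE ri re ε ^ 2 : ℝ) = ratioQ ri re ε := by
    rw [ratioQ, div_pow]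
  rw [outerPotential, conj_sq_div _ hw0, hw, hq, ← h1]
  simp only [Complex.sub_re, Complex.re_ofReal_mul, Complex.conj_re]

omit E hτ in
-- The reflection fixes `∂D`, and `S - τ conj S` has real part `(1 - τ) Re S`.
theorem innerPotential_eq_outerPotential {z : ℂ} (hz : z ∈ Metric.sphere (centerD ri ε) ri) :
    (innerPotential ri re ε τ F z).re = (outerPotential ri re ε τ F z).re := by
  rw [outerPotential, innerPotential, H.conj_reflect_of_norm (H.norm_wMap_eq_rhoI hz)]
  rw [show (1 : ℂ) - τ = ((1 - τ : ℝ) : ℂ) by push_cast; ring]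
  simp only [Complex.sub_re, Complex.re_ofReal_mul, Complex.conj_re]
  ring

/-- On `∂D` the exterior and interior normal derivatives are proportional to `1 + τ` and `1 - τ`. -/
theorem normal_derivatives {z : ℂ} (hz : z ∈ Metric.sphere (centerD ri ε) ri) :
    ∃ N : ℝ,
      HasDerivAt (fun t : ℝ => (outerPotential ri re ε τ F
        (z + t • ((ri⁻¹ : ℝ) • (z - centerD ri ε)))).re) ((1 + τ) * N) 0 ∧
      HasDerivAt (fun t : ℝ => (innerPotential ri re ε τ F
        (z + t • ((ri⁻¹ : ℝ) • (z - centerD ri ε)))).re) ((1 - τ) * N) 0 := by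
  have hzΩ := H.closedBall_subset (Metric.sphere_subset_closedBall hz)
  have hw := H.norm_wMap_eq_rhoI hz
  obtain ⟨l, hl⟩ := H.deriv_wMap_mul_normal hz
  have h0 := H.add_ne_zero_of_mem (Metric.ball_subset_closedBall hzΩ)
  have h1 := H.hasDerivAt_outerPotential_aux E hτ hzΩ hw.ge
  have h2 := H.hasDerivAt_innerPotential E hτ hzΩ
  rw [H.conj_reflect_of_norm hw] at h1
  have hρ : (rhoI ri re ε : ℂ) ^ 2 = wMap ri re ε z * (starRingEnd ℂ) (wMap ri re ε z) := by
    rw [Complex.mul_conj, Complex.normSq_eq_norm_sq, hw]; push_cast; ring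
  have hw0 : wMap ri re ε z ≠ 0 := norm_pos_iff.1 (by rw [hw]; exact H.rhoI_pos)
  have hne := H.one_add_ne_zero (hw.trans_lt H.rhoI_lt_one)
  have hα : (alpha ri re ε : ℂ) ≠ 0 := by exact_mod_cast H.alpha_pos.ne'
  have h3 := hasDerivAt_line_of_hasGradientAt (hasGradientAt_re h1)
    ((ri⁻¹ : ℝ) • (z - centerD ri ε))
  have h4 := hasDerivAt_line_of_hasGradientAt (hasGradientAt_re h2)
    ((ri⁻¹ : ℝ) • (z - centerD ri ε))
  rw [Complex.conj_conj] at h3 h4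
  set w := wMap ri re ε z with hwdef
  set ν : ℂ := (ri⁻¹ : ℝ) • (z - centerD ri ε) with hν
  set G := gradSeries ri re ε τ (ratioQ ri re ε) 1 F₁ w with hG
  -- In the coordinate `w` the normal is radial, so `Gν = S'(w) l w` with `l` real. The reflected
  -- term therefore contributes `τ conj (Gν)`, whence the factors `1 + τ` and `1 - τ`.
  have hGν : G * ν = (-2 * alpha ri re ε / (1 + w) ^ 2 * G) * (l * w) := by
    rw [← hl]
    field_simp
  refine ⟨(G * ν).re, h3.congr_deriv ?_, h4.congr_deriv ?_⟩
  · have hcw : (starRingEnd ℂ) w ≠ 0 := (map_ne_zero _).2 hw0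
    have e : (G - τ * (starRingEnd ℂ) (-2 * alpha ri re ε / (1 + w) ^ 2 * G) *
        (-(rhoI ri re ε : ℂ) ^ 2 / w ^ 2) * (-(1 + w) ^ 2 / (2 * alpha ri re ε))) * ν =
        G * ν + τ * (starRingEnd ℂ) (G * ν) := by
      rw [hGν, map_mul _ (_ * G), map_mul _ (l : ℂ), Complex.conj_ofReal, hρ]
      rw [sub_mul, mul_assoc _ _ ν, hl, hGν]
      field_simp
      ring
    rw [e, Complex.add_re, Complex.re_ofReal_mul, Complex.conj_re]
    ring
  · rw [show ((1 : ℂ) - τ) * G * ν = ((1 - τ : ℝ) : ℂ) * (G * ν) by push_cast; ring,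
      Complex.re_ofReal_mul]

end Admissible

/-- The solution of the transmission problem is given by the series of images. -/
theorem IsSolution.eq_potential {ri re ε k : ℝ} (H : Admissible ri re ε) (hk : 0 < k)
    {F F₁ : ℂ → ℂ} {L : ℝ} (E : IsExtension re F F₁ L) {g v : ℂ → ℝ}
    (hF : ∀ z ∈ Metric.sphere (re : ℂ) re, (F z).re = g z) (hv : IsSolution ri re ε k g v) :
    (∀ z ∈ Metric.closedBall (centerD ri ε) ri, v z = (innerPotential ri re ε (tau k) F z).re) ∧
      ∀ z ∈ Metric.closedBall (re : ℂ) re \ Metric.ball (centerD ri ε) ri,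
        v z = (outerPotential ri re ε (tau k) F z).re := by
  have hτ := abs_tau_lt_one hk
  have hri := H.ri_pos.ne'
  have hre := H.re_pos.ne'
  have hsub := H.closedBall_subset
  have hvc : ContinuousOn v (Metric.closedBall (re : ℂ) re) := by
    have := hv.continuous
    rwa [Omega, closure_ball _ hre] at this
  have hin : DifferentiableOn ℂ (innerPotential ri re ε (tau k) F) (Metric.ball (re : ℂ) re) :=
    fun z hz => (H.hasDerivAt_innerPotential E hτ hz).differentiableAt.differentiableWithinAt
  have hUo : IsOpen (Metric.ball (re : ℂ) re \ Metric.closedBall (centerD ri ε) ri) :=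
    Metric.isOpen_ball.sdiff Metric.isClosed_closedBall
  have hout : DifferentiableOn ℂ (outerPotential ri re ε (tau k) F)
      (Metric.ball (re : ℂ) re \ Metric.closedBall (centerD ri ε) ri) := fun z hz =>
    (H.hasDerivAt_outerPotential E hτ hz.1
      (H.wMap_eq_zero_or_mem hz).1.le).differentiableAt.differentiableWithinAt
  have hvout : HarmonicOnNhd v (Metric.ball (re : ℂ) re \ Metric.closedBall (centerD ri ε) ri) := by
    have := hv.harmonic_outside
    rwa [Inclusion, closure_ball _ hri] at this
  have key := transmission_eq_zero (C := (re : ℂ)) (c := centerD ri ε) (R := re) (r := ri) (k := k)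
    H.ri_pos hk hsub
    (u := fun z => v z - (innerPotential ri re ε (tau k) F z).re)
    (w := fun z => v z - (outerPotential ri re ε (tau k) F z).re)
    (fun z hz => (hv.harmonic_inside z hz).sub (hin.analyticAt (Metric.isOpen_ball.mem_nhds
      (hsub (Metric.ball_subset_closedBall hz)))).harmonicAt_re)
    ((hvc.mono (hsub.trans Metric.ball_subset_closedBall)).sub
      (Complex.continuous_re.comp_continuousOn (hin.continuousOn.mono hsub)))
    (fun z hz => (hvout z hz).sub (hout.analyticAt (hUo.mem_nhds hz)).harmonicAt_re)
    ((hvc.mono sdiff_subset).sub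
      (Complex.continuous_re.comp_continuousOn (H.continuousOn_outerPotential E hτ)))
    (fun z hz => by
      rw [H.outerPotential_boundary E hτ hz, hF z hz, sub_eq_zero]
      refine hv.boundary z ?_
      rwa [Omega, frontier_ball _ hre])
    (fun z hz => by rw [H.innerPotential_eq_outerPotential hz])
    (fun z hz => by
      obtain ⟨a, b, ha, hb, hab⟩ := hv.transmission z
        (by rwa [Inclusion, frontier_ball _ hri]) _ rfl
      obtain ⟨N, hN1, hN2⟩ := H.normal_derivatives E hτ hz
      refine ⟨_, _, ha.sub hN1.hasDerivWithinAt, hb.sub hN2.hasDerivWithinAt, ?_⟩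
      rw [hab, one_add_tau hk]
      ring)
  exact ⟨fun z hz => sub_eq_zero.1 (key.1 z hz), fun z hz => sub_eq_zero.1 (key.2 z hz)⟩

theorem IsSolution.gradient_inside {ri re ε k : ℝ} (H : Admissible ri re ε) (hk : 0 < k)
    {F F₁ : ℂ → ℂ} {L : ℝ} (E : IsExtension re F F₁ L) {g v : ℂ → ℝ}
    (hF : ∀ z ∈ Metric.sphere (re : ℂ) re, (F z).re = g z) (hv : IsSolution ri re ε k g v)
    {z : ℂ} (hz : z ∈ Inclusion ri ε) :
    gradient v z = (starRingEnd ℂ) ((1 - tau k : ℝ) *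
      gradSeries ri re ε (tau k) (ratioQ ri re ε) 1 F₁ (wMap ri re ε z)) := by
  have h1 := hasGradientAt_re (H.hasDerivAt_innerPotential E (abs_tau_lt_one hk)
    (H.closedBall_subset (Metric.ball_subset_closedBall hz)))
  have h2 : v =ᶠ[𝓝 z] fun z => (innerPotential ri re ε (tau k) F z).re := by
    filter_upwards [Metric.isOpen_ball.mem_nhds hz] with y hy
    exact (hv.eq_potential H hk E hF).1 y (Metric.ball_subset_closedBall hy)
  rw [(h1.congr_of_eventuallyEq h2).gradient]
  push_cast
  rfl

theorem IsSolution.gradient_outside {ri re ε k : ℝ} (H : Admissible ri re ε) (hk : 0 < k)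
    {F F₁ : ℂ → ℂ} {L : ℝ} (E : IsExtension re F F₁ L) {g v : ℂ → ℝ}
    (hF : ∀ z ∈ Metric.sphere (re : ℂ) re, (F z).re = g z) (hv : IsSolution ri re ε k g v)
    {z : ℂ} (hz : z ∈ Omega re \ closure (Inclusion ri ε)) :
    gradient v z = (starRingEnd ℂ)
      (gradSeries ri re ε (tau k) (ratioQ ri re ε) 1 F₁ (wMap ri re ε z) +
        tau k * phaseSq (wMap ri re ε z) * (starRingEnd ℂ) (gradSeries ri re ε (tau k)
          (ratioQ ri re ε) (rhoI ri re ε ^ 2 / ‖wMap ri re ε z‖ ^ 2) F₁ (wMap ri re ε z))) := by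
  rw [Omega, Inclusion, closure_ball _ H.ri_pos.ne'] at hz
  have h1 := hasGradientAt_re (H.hasDerivAt_outerPotential E (abs_tau_lt_one hk) hz.1
    (H.wMap_eq_zero_or_mem hz).1.le)
  have hUo : IsOpen (Metric.ball (re : ℂ) re \ Metric.closedBall (centerD ri ε) ri) :=
    Metric.isOpen_ball.sdiff Metric.isClosed_closedBall
  have h2 : v =ᶠ[𝓝 z] fun z => (outerPotential ri re ε (tau k) F z).re := by
    filter_upwards [hUo.mem_nhds hz] with y hy
    exact (hv.eq_potential H hk E hF).2 y
      ⟨Metric.ball_subset_closedBall hy.1, fun h => hy.2 (Metric.ball_subset_closedBall h)⟩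
  rw [(h1.congr_of_eventuallyEq h2).gradient]

/-! ### Estimates for the weight `kerM` -/

/-- An increasing function of `x` that dominates the variation of `kerM W`. -/
def majorant (W : ℂ) (x : ℝ) : ℝ := ‖1 + W‖ ^ 2 / (‖1 + W‖ + 1 - x) ^ 2

section Kernel

variable {W : ℂ} (hW : ‖W‖ < 1)

include hW

theorem norm_one_add_pos : 0 < ‖1 + W‖ := by
  rw [norm_pos_iff]
  intro h
  rw [show W = -1 by linear_combination h] at hW
  simp at hW

theorem one_sub_le_norm_one_add_mul {x : ℝ} (hx : 0 ≤ x) : 1 - x ≤ ‖1 + x * W‖ := by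
  have h1 := norm_sub_norm_le (1 : ℂ) (-(x * W))
  rw [norm_one, norm_neg, sub_neg_eq_add, norm_mul, Complex.norm_real,
    Real.norm_of_nonneg hx] at h1
  nlinarith

/-- Add `|1 + xW| ≥ |1 + W| - (1 - x)` to twice `|1 + xW| ≥ 1 - x`. -/
theorem le_norm_one_add_mul {x : ℝ} (hx : 0 ≤ x) (hx1 : x ≤ 1) :
    (‖1 + W‖ + 1 - x) / 3 ≤ ‖1 + x * W‖ := by
  have h1 := one_sub_le_norm_one_add_mul hW hx
  have h2 : ‖1 + W‖ ≤ ‖1 + x * W‖ + (1 - x) := by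
    have e : 1 + W = (1 + x * W) + ((1 - x : ℝ) : ℂ) * W := by push_cast; ring
    rw [e]
    refine (norm_add_le _ _).trans ?_
    rw [norm_mul, Complex.norm_real, Real.norm_of_nonneg (by linarith)]
    nlinarith
  linarith

theorem norm_one_add_mul_pos {x : ℝ} (hx : 0 ≤ x) (hx1 : x ≤ 1) : 0 < ‖1 + x * W‖ := by
  have := le_norm_one_add_mul hW hx hx1
  have := norm_one_add_pos hW
  linarith

omit hW in
theorem norm_kerM {x : ℝ} (hx : 0 ≤ x) :
    ‖kerM W x‖ = x * ‖1 + W‖ ^ 2 / ‖1 + x * W‖ ^ 2 := by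
  rw [kerM, norm_div, norm_mul, norm_pow, norm_pow, Complex.norm_real, Real.norm_of_nonneg hx]

/-- `|1 + xW|² - x|1 + W|² = (1 - x)(1 - x|W|²)`, which is nonnegative. -/
theorem norm_kerM_le_one {x : ℝ} (hx : 0 ≤ x) (hx1 : x ≤ 1) : ‖kerM W x‖ ≤ 1 := by
  have h0 := norm_one_add_mul_pos hW hx hx1
  rw [norm_kerM hx, div_le_one (by positivity)]
  rw [← Complex.normSq_eq_norm_sq, ← Complex.normSq_eq_norm_sq, Complex.normSq_apply,
    Complex.normSq_apply]
  have h1 : W.re ^ 2 + W.im ^ 2 ≤ 1 := by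
    have h2 := Complex.normSq_apply W
    rw [Complex.normSq_eq_norm_sq] at h2
    nlinarith [norm_nonneg W]
  simp only [Complex.add_re, Complex.add_im, Complex.one_re, Complex.one_im,
    Complex.re_ofReal_mul, Complex.im_ofReal_mul, zero_add]
  have h3 : 0 ≤ (1 - x) * (1 - x * (W.re ^ 2 + W.im ^ 2)) := by
    apply mul_nonneg <;> nlinarith
  nlinarith

theorem norm_kerM_le {x : ℝ} (hx : 0 ≤ x) (hx1 : x < 1) : ‖kerM W x‖ ≤ 4 * x / (1 - x) ^ 2 := by
  have h0 := one_sub_le_norm_one_add_mul hW hx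
  have h1 : ‖1 + W‖ ≤ 2 := by
    refine (norm_add_le _ _).trans ?_
    rw [norm_one]; linarith
  have h2 : 0 < 1 - x := by linarith
  rw [norm_kerM hx]
  have h3 : ‖1 + W‖ ^ 2 ≤ 4 := by nlinarith [norm_nonneg (1 + W)]
  have h4 : (1 - x) ^ 2 ≤ ‖1 + x * W‖ ^ 2 := pow_le_pow_left₀ h2.le h0 2
  calc x * ‖1 + W‖ ^ 2 / ‖1 + x * W‖ ^ 2 ≤ x * 4 / (1 - x) ^ 2 := by gcongr
    _ = _ := by ring

/-- `x(1 + yW)² - y(1 + xW)² = (x - y)(1 - xyW²)`, and `1 - xyW² = (1 + xW) - xW(1 + yW)` is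
controlled by the factors of the denominator. -/
theorem norm_kerM_sub_le {x y : ℝ} (hy : 0 ≤ y) (hyx : y ≤ x) (hx1 : x ≤ 1) :
    ‖kerM W x - kerM W y‖ ≤ (x - y) * ‖1 + W‖ ^ 2 *
      ((‖1 + x * W‖ + ‖1 + y * W‖) / (‖1 + x * W‖ ^ 2 * ‖1 + y * W‖ ^ 2)) := by
  have hX := norm_one_add_mul_pos hW (hy.trans hyx) hx1
  have hY := norm_one_add_mul_pos hW hy (hyx.trans hx1)
  have hX0 : 1 + (x : ℂ) * W ≠ 0 := norm_pos_iff.1 hX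
  have hY0 : 1 + (y : ℂ) * W ≠ 0 := norm_pos_iff.1 hY
  have e : kerM W x - kerM W y = ((x - y : ℝ) : ℂ) * (1 + W) ^ 2 *
      (((1 + x * W) - x * W * (1 + y * W)) / ((1 + x * W) ^ 2 * (1 + y * W) ^ 2)) := by
    rw [kerM, kerM, div_sub_div _ _ (pow_ne_zero 2 hX0) (pow_ne_zero 2 hY0), mul_div_assoc']
    push_cast
    congr 1
    ring
  rw [e, norm_mul, norm_mul, norm_div, norm_mul, norm_pow, norm_pow, norm_pow, Complex.norm_real,
    Real.norm_of_nonneg (by linarith)]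
  have hxy : 0 ≤ x - y := by linarith
  have h2 : ‖(1 + x * W) - x * W * (1 + y * W)‖ ≤ ‖1 + x * W‖ + ‖1 + y * W‖ := by
    refine (norm_sub_le _ _).trans ?_
    gcongr
    rw [norm_mul, norm_mul, Complex.norm_real, Real.norm_of_nonneg (hy.trans hyx)]
    have : x * ‖W‖ ≤ 1 := by nlinarith [norm_nonneg W]
    nlinarith
  gcongr

/-- This has the shape of the bound in `norm_kerM_sub_le`, with `|1 + xW|` replaced by `|1 + W| + 1
- x`; the two increments can thus be compared factor by factor. -/
theorem majorant_sub_eq {x y : ℝ} (hx1 : x ≤ 1) (hy1 : y ≤ 1) :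
    majorant W x - majorant W y = (x - y) * ‖1 + W‖ ^ 2 *
      (((‖1 + W‖ + 1 - x) + (‖1 + W‖ + 1 - y)) /
        ((‖1 + W‖ + 1 - x) ^ 2 * (‖1 + W‖ + 1 - y) ^ 2)) := by
  have hu := norm_one_add_pos hW
  have h1 : ‖1 + W‖ + 1 - x ≠ 0 := by linarith
  have h2 : ‖1 + W‖ + 1 - y ≠ 0 := by linarith
  rw [majorant, majorant]
  field_simp
  ring

omit hW in
theorem majorant_nonneg (x : ℝ) : 0 ≤ majorant W x := by
  rw [majorant]; positivity

theorem majorant_le_one {x : ℝ} (hx1 : x ≤ 1) : majorant W x ≤ 1 := by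
  have hu := norm_one_add_pos hW
  rw [majorant, div_le_one (by nlinarith)]
  gcongr
  linarith

theorem majorant_mono {x y : ℝ} (hyx : y ≤ x) (hx1 : x ≤ 1) : majorant W y ≤ majorant W x := by
  have hu := norm_one_add_pos hW
  rw [majorant, majorant]
  have : 0 < ‖1 + W‖ + 1 - x := by linarith
  gcongr

theorem norm_kerM_sub_le_majorant {x y : ℝ} (hy : 0 ≤ y) (hyx : y ≤ x) (hx1 : x ≤ 1) :
    ‖kerM W x - kerM W y‖ ≤ 27 * (majorant W x - majorant W y) := by
  have hu := norm_one_add_pos hW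
  refine (norm_kerM_sub_le hW hy hyx hx1).trans ?_
  rw [majorant_sub_eq hW hx1 (hyx.trans hx1)]
  have hX := le_norm_one_add_mul hW (hy.trans hyx) hx1
  have hY := le_norm_one_add_mul hW hy (hyx.trans hx1)
  set X := ‖1 + (x : ℂ) * W‖
  set Y := ‖1 + (y : ℂ) * W‖
  set a := ‖1 + W‖ + 1 - x with ha
  set b := ‖1 + W‖ + 1 - y with hb
  have ha0 : 0 < a := by linarith
  have hb0 : 0 < b := by linarith
  have hX0 : 0 < X := by linarith
  have hY0 : 0 < Y := by linarith
  have hxy : 0 ≤ x - y := by linarith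
  -- Each summand has three factors in its denominator, each bounded below up to a factor `3`; hence
  -- `27`.
  have key : (X + Y) / (X ^ 2 * Y ^ 2) ≤ 27 * ((a + b) / (a ^ 2 * b ^ 2)) := by
    have e1 : (X + Y) / (X ^ 2 * Y ^ 2) = 1 / (X * Y ^ 2) + 1 / (X ^ 2 * Y) := by
      field_simp
    have e2 : 27 * ((a + b) / (a ^ 2 * b ^ 2)) =
        1 / ((a / 3) * (b / 3) ^ 2) + 1 / ((a / 3) ^ 2 * (b / 3)) := by
      field_simp; norm_num
    rw [e1, e2]
    gcongr
  calc (x - y) * ‖1 + W‖ ^ 2 * ((X + Y) / (X ^ 2 * Y ^ 2))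
      ≤ (x - y) * ‖1 + W‖ ^ 2 * (27 * ((a + b) / (a ^ 2 * b ^ 2))) := by gcongr
    _ = _ := by ring

/-- The variation of `kerM W`, with a bound that does not depend on `W`. -/
theorem norm_kerM_sub_le_div {x y z : ℝ} (hx : 0 ≤ x) (hy : 0 ≤ y) (hxz : x ≤ z) (hyz : y ≤ z)
    (hz1 : z < 1) : ‖kerM W x - kerM W y‖ ≤ 54 * |x - y| / (1 - z) := by
  wlog hyx : y ≤ x generalizing x y
  · rw [norm_sub_rev, abs_sub_comm]
    exact this hy hx hyz hxz (le_of_not_ge hyx)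
  have hu := norm_one_add_pos hW
  have hx1 : x ≤ 1 := hxz.trans hz1.le
  refine (norm_kerM_sub_le hW hy hyx hx1).trans ?_
  have hX := le_norm_one_add_mul hW hx hx1
  have hY := le_norm_one_add_mul hW hy (hyx.trans hx1)
  rw [abs_of_nonneg (by linarith)]
  set X := ‖1 + (x : ℂ) * W‖
  set Y := ‖1 + (y : ℂ) * W‖
  set u := ‖1 + W‖
  have hz0 : 0 < 1 - z := by linarith
  have hX0 : 0 < X := by linarith
  have hY0 : 0 < Y := by linarith
  have hXu : u ≤ 3 * X := by linarith
  have hYu : u ≤ 3 * Y := by linarith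
  have hxy : 0 ≤ x - y := by linarith
  have h1 : 1 / X ≤ 3 / (1 - z) := by
    rw [div_le_div_iff₀ hX0 hz0]; linarith
  have h2 : 1 / Y ≤ 3 / (1 - z) := by
    rw [div_le_div_iff₀ hY0 hz0]; linarith
  have h3 : u ^ 2 / (X * Y) ≤ 9 := by
    rw [div_le_iff₀ (by positivity)]
    nlinarith
  calc (x - y) * u ^ 2 * ((X + Y) / (X ^ 2 * Y ^ 2))
      = (x - y) * (u ^ 2 / (X * Y)) * (1 / X + 1 / Y) := by field_simp; ring
    _ ≤ (x - y) * 9 * (3 / (1 - z) + 3 / (1 - z)) := by gcongr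
    _ = _ := by ring

/-- Up to constants the left side is the derivative of the majorant at `x` times the step `x - xq`.
The hypothesis on `c` keeps the denominators at the two ends of the step comparable, so the
derivative is controlled by the increment. -/
theorem norm_kerM_div_le_majorant {x q c : ℝ} (hx : 0 ≤ x) (hx1 : x ≤ 1)
    (hq1 : q < 1) (hc : 1 - q ≤ c * ‖1 + W‖) :
    (1 - q) * (‖kerM W x‖ / ‖1 + x * W‖) ≤
      27 * (1 + c) * (majorant W x - majorant W (x * q)) := by
  have hu := norm_one_add_pos hW
  have hxq : x * q ≤ x := mul_le_of_le_one_right hx hq1.le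
  rw [majorant_sub_eq hW hx1 (hxq.trans hx1), norm_kerM hx]
  have hX := le_norm_one_add_mul hW hx hx1
  set X := ‖1 + (x : ℂ) * W‖
  set u := ‖1 + W‖
  set a := u + 1 - x with ha
  set b := u + 1 - x * q with hb
  have ha0 : 0 < a := by linarith
  have hX0 : 0 < X := by linarith
  have hab : a ≤ b := by linarith
  have hb0 : 0 < b := by linarith
  have hc0 : 0 < c := by
    by_contra! h
    nlinarith
  have hba : b ≤ (1 + c) * a := by
    have : x * (1 - q) ≤ 1 - q := mul_le_of_le_one_left (by linarith) hx1
    nlinarith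
  have h1 : 1 / X ^ 3 ≤ 27 / a ^ 3 := by
    rw [show 27 / a ^ 3 = 1 / (a / 3) ^ 3 by field_simp; norm_num]
    gcongr
  have h2 : 1 / a ^ 3 ≤ (1 + c) * ((a + b) / (a ^ 2 * b ^ 2)) := by
    rw [← mul_div_assoc, div_le_div_iff₀ (by positivity) (by positivity)]
    nlinarith [mul_le_mul_of_nonneg_left hba (by positivity : 0 ≤ a ^ 2 * b),
      mul_pos (pow_pos ha0 2) (pow_pos ha0 2), mul_pos (pow_pos ha0 4) hc0]
  have hq0 : 0 ≤ 1 - q := by linarith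
  calc (1 - q) * (x * u ^ 2 / X ^ 2 / X) = (1 - q) * x * u ^ 2 * (1 / X ^ 3) := by
        field_simp
    _ ≤ (1 - q) * x * u ^ 2 * (27 * ((1 + c) * ((a + b) / (a ^ 2 * b ^ 2)))) := by
        gcongr
        refine h1.trans ?_
        rw [show 27 / a ^ 3 = 27 * (1 / a ^ 3) by ring]
        gcongr
    _ = _ := by ring

end Kernel

/-! ### Telescoping and summation by parts -/

/-- A shift by `j` is a sum of `j` unit shifts, each telescoping to at most `1`. -/
theorem sum_sub_shift_le {f : ℕ → ℝ} (hf : Antitone f) (h0 : ∀ n, 0 ≤ f n) (h1 : f 0 ≤ 1)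
    (j n : ℕ) : ∑ m ∈ Finset.range n, (f m - f (m + j)) ≤ j := by
  induction j with
  | zero => simp
  | succ j ih =>
    have e : ∀ m, f m - f (m + (j + 1)) = (f m - f (m + j)) + (f (j + m) - f (j + (m + 1))) := by
      intro m
      rw [add_comm j m, show j + (m + 1) = m + (j + 1) by ring]
      ring
    simp_rw [e]
    rw [Finset.sum_add_distrib, Finset.sum_range_sub' (fun m => f (j + m)) n]
    have := h0 (j + n)
    have := hf (Nat.zero_le j)
    push_cast
    simp only [add_zero]
    linarith

/-- Abel summation: `(1 - τ) ∑ τ^m a_m = a_0 + ∑ τ^{m+1} (a_{m+1} - a_m)`, which is at most supremum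
plus total variation whatever the sign of `τ`. -/
theorem norm_one_sub_mul_tsum_le {τ A B : ℝ} (hτ : |τ| < 1) {a : ℕ → ℂ} (hA : ∀ m, ‖a m‖ ≤ A)
    (hB : ∀ n, ∑ m ∈ Finset.range n, ‖a (m + 1) - a m‖ ≤ B) :
    ‖(1 - τ : ℂ) * ∑' m : ℕ, (τ : ℂ) ^ m * a m‖ ≤ A + B := by
  have hs : Summable fun m : ℕ => (τ : ℂ) ^ m * a m :=
    Summable.of_norm_bounded ((summable_geometric_of_lt_one (abs_nonneg τ) hτ).mul_right A)
      fun m => by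
        rw [norm_mul, norm_pow, Complex.norm_real, Real.norm_eq_abs]
        exact mul_le_mul_of_nonneg_left (hA m) (by positivity)
  have hsB : Summable fun m : ℕ => ‖a (m + 1) - a m‖ :=
    summable_of_sum_range_le (fun _ => norm_nonneg _) hB
  have hle : ∀ m : ℕ, ‖(τ : ℂ) ^ (m + 1) * (a (m + 1) - a m)‖ ≤ ‖a (m + 1) - a m‖ := fun m => by
    rw [norm_mul]
    exact mul_le_of_le_one_left (norm_nonneg _) (norm_pow_le_one (by
      rw [Complex.norm_real, Real.norm_eq_abs]; exact hτ.le) _)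
  have hs2 := (summable_nat_add_iff 1).2 hs
  have e : (1 - τ : ℂ) * ∑' m : ℕ, (τ : ℂ) ^ m * a m =
      a 0 + ∑' m : ℕ, (τ : ℂ) ^ (m + 1) * (a (m + 1) - a m) := by
    have e1 : ∑' m : ℕ, (τ : ℂ) ^ (m + 1) * (a (m + 1) - a m) =
        ∑' m : ℕ, (τ : ℂ) ^ (m + 1) * a (m + 1) - τ * ∑' m : ℕ, (τ : ℂ) ^ m * a m := by
      rw [← tsum_mul_left, ← hs2.tsum_sub (hs.mul_left _)]
      refine tsum_congr fun m => ?_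
      ring
    rw [e1, sub_mul, one_mul]
    nth_rewrite 1 [hs.tsum_eq_zero_add]
    ring
  rw [e]
  refine (norm_add_le _ _).trans (add_le_add (hA 0) ?_)
  refine (tsum_of_norm_bounded hsB.hasSum hle).trans ?_
  exact hsB.tsum_le_of_sum_range_le hB

/-! ### Comparison of series and integrals of the weight -/

/-- `∫₀^∞ e^{-lt} M(s e^{-ht}) dt`. -/
def kerIntegral (W : ℂ) (l h s : ℝ) : ℂ :=
  ∫ t in Ioi (0 : ℝ), (Real.exp (-(l * t)) : ℂ) * kerM W (s * Real.exp (-(h * t)))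

theorem measurable_kerM (W : ℂ) : Measurable (kerM W) := by
  unfold kerM
  fun_prop

theorem mul_exp_neg_mem {s h t : ℝ} (hs : 0 ≤ s) (hs1 : s ≤ 1) (hh : 0 ≤ h) (ht : 0 ≤ t) :
    0 ≤ s * Real.exp (-(h * t)) ∧ s * Real.exp (-(h * t)) ≤ 1 := by
  have h1 : Real.exp (-(h * t)) ≤ 1 := Real.exp_le_one_iff.2 (by nlinarith [mul_nonneg hh ht])
  exact ⟨by positivity, mul_le_one₀ hs1 (Real.exp_pos _).le h1⟩

section

variable {W : ℂ} (hW : ‖W‖ < 1)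

include hW

theorem integrableOn_kerIntegral {l h s : ℝ} (hl : 0 < l) (hh : 0 ≤ h) (hs : 0 ≤ s)
    (hs1 : s ≤ 1) : MeasureTheory.IntegrableOn
      (fun t : ℝ => (Real.exp (-(l * t)) : ℂ) * kerM W (s * Real.exp (-(h * t)))) (Ioi 0) := by
  have h1 : MeasureTheory.IntegrableOn (fun t : ℝ => Real.exp (-(l * t))) (Ioi 0) := by
    simpa only [neg_mul] using exp_neg_integrableOn_Ioi 0 hl
  refine MeasureTheory.Integrable.mono' h1 ?_ ?_
  · have := measurable_kerM W
    exact (by fun_prop : Measurable _).aestronglyMeasurable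
  · filter_upwards [MeasureTheory.ae_restrict_mem measurableSet_Ioi] with t ht
    have h2 := mul_exp_neg_mem hs hs1 hh (le_of_lt ht)
    rw [norm_mul, Complex.norm_real, Real.norm_of_nonneg (Real.exp_pos _).le]
    exact mul_le_of_le_one_right (Real.exp_pos _).le (norm_kerM_le_one hW h2.1 h2.2)

/-- The integral is at most `1/l`, and `1 - e^{-l} ≤ l`. This allows an extra factor `τ = e^{-l}` in
front of the integral at cost `O(1)`. -/
theorem norm_one_sub_mul_kerIntegral_le {l h s : ℝ} (hl : 0 < l) (hh : 0 ≤ h) (hs : 0 ≤ s)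
    (hs1 : s ≤ 1) : (1 - Real.exp (-l)) * ‖kerIntegral W l h s‖ ≤ 1 := by
  have h1 : MeasureTheory.IntegrableOn (fun t : ℝ => Real.exp (-(l * t))) (Ioi 0) := by
    simpa only [neg_mul] using exp_neg_integrableOn_Ioi 0 hl
  have h2 : ‖kerIntegral W l h s‖ ≤ ∫ t in Ioi (0 : ℝ), Real.exp (-(l * t)) := by
    refine MeasureTheory.norm_integral_le_of_norm_le h1 ?_
    filter_upwards [MeasureTheory.ae_restrict_mem measurableSet_Ioi] with t ht
    have h2 := mul_exp_neg_mem hs hs1 hh (le_of_lt ht)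
    rw [norm_mul, Complex.norm_real, Real.norm_of_nonneg (Real.exp_pos _).le]
    exact mul_le_of_le_one_right (Real.exp_pos _).le (norm_kerM_le_one hW h2.1 h2.2)
  have h3 : ∫ t in Ioi (0 : ℝ), Real.exp (-(l * t)) = 1 / l := by
    have := integral_exp_mul_Ioi (a := -l) (by linarith) 0
    simp only [neg_mul, mul_zero, Real.exp_zero] at this
    rw [this]
    field_simp
  rw [h3] at h2
  have h4 : 1 - Real.exp (-l) ≤ l := by linarith [Real.add_one_le_exp (-l)]
  have h5 : 0 ≤ 1 - Real.exp (-l) := by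
    have : Real.exp (-l) ≤ 1 := Real.exp_le_one_iff.2 (by linarith)
    linarith
  calc (1 - Real.exp (-l)) * ‖kerIntegral W l h s‖ ≤ l * (1 / l) := by gcongr
    _ = 1 := by field_simp

theorem norm_kerM_sub_le_of_mem {x y a b : ℝ} (ha : 0 ≤ a) (hb : b ≤ 1) (hx : x ∈ Icc a b)
    (hy : y ∈ Icc a b) : ‖kerM W x - kerM W y‖ ≤ 27 * (majorant W b - majorant W a) := by
  wlog hyx : y ≤ x generalizing x y
  · rw [norm_sub_rev]
    exact this hy hx (le_of_not_ge hyx)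
  refine (norm_kerM_sub_le_majorant hW (ha.trans hy.1) hyx (hx.2.trans hb)).trans ?_
  have h1 := majorant_mono hW hx.2 hb
  have h2 := majorant_mono hW hy.1 (hyx.trans (hx.2.trans hb))
  linarith

theorem antitone_majorant_pow {s q : ℝ} (hs : 0 ≤ s) (hs1 : s ≤ 1) (hq : 0 ≤ q) (hq1 : q ≤ 1) :
    Antitone fun m : ℕ => majorant W (s * q ^ m) := fun m n hmn =>
  majorant_mono hW (mul_le_mul_of_nonneg_left (pow_le_pow_of_le_one hq hq1 hmn) hs)
    (mul_le_one₀ hs1 (by positivity) (pow_le_one₀ hq hq1))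

theorem sum_majorant_le {s q : ℝ} (hs : 0 ≤ s) (hs1 : s ≤ 1) (hq : 0 ≤ q) (hq1 : q ≤ 1)
    (j n : ℕ) : ∑ m ∈ Finset.range n, (majorant W (s * q ^ m) - majorant W (s * q ^ (m + j))) ≤ j :=
  sum_sub_shift_le (antitone_majorant_pow hW hs hs1 hq hq1) (fun _ => majorant_nonneg _)
    (majorant_le_one hW (by simpa using hs1)) j n

/-- The series of weights is `O(1 / (1 - τ))`, for both signs of `τ`. -/
theorem norm_one_sub_mul_kerSum_le {τ s q : ℝ} (hτ : |τ| < 1) (hs : 0 ≤ s) (hs1 : s ≤ 1)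
    (hq : 0 ≤ q) (hq1 : q ≤ 1) :
    ‖(1 - τ : ℂ) * ∑' m : ℕ, (τ : ℂ) ^ m * kerM W (s * q ^ m)‖ ≤ 1 + 27 := by
  have hmem : ∀ m : ℕ, 0 ≤ s * q ^ m ∧ s * q ^ m ≤ 1 := fun m =>
    ⟨by positivity, mul_le_one₀ hs1 (by positivity) (pow_le_one₀ hq hq1)⟩
  refine norm_one_sub_mul_tsum_le hτ (fun m => norm_kerM_le_one hW (hmem m).1 (hmem m).2)
    fun n => ?_
  have h1 := sum_majorant_le hW hs hs1 hq hq1 1 n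
  calc ∑ m ∈ Finset.range n, ‖kerM W (s * q ^ (m + 1)) - kerM W (s * q ^ m)‖
      ≤ ∑ m ∈ Finset.range n, 27 * (majorant W (s * q ^ m) - majorant W (s * q ^ (m + 1))) := by
        refine Finset.sum_le_sum fun m _ => ?_
        rw [norm_sub_rev]
        refine norm_kerM_sub_le_majorant hW (hmem _).1 ?_ (hmem m).2
        exact mul_le_mul_of_nonneg_left (pow_le_pow_of_le_one hq hq1 (Nat.le_succ m)) hs
    _ ≤ 27 := by rw [← Finset.mul_sum]; push_cast at h1; linarith

theorem sum_norm_kerM_div_le {s q c : ℝ} (hs : 0 ≤ s) (hs1 : s ≤ 1) (hq : 0 ≤ q) (hq1 : q < 1)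
    (hc : 1 - q ≤ c * ‖1 + W‖) (n : ℕ) :
    ∑ m ∈ Finset.range n, (1 - q) * (‖kerM W (s * q ^ m)‖ / ‖1 + (s * q ^ m : ℝ) * W‖) ≤
      27 * (1 + c) := by
  have hc0 : 0 < c := by
    by_contra! h
    nlinarith [norm_nonneg (1 + W)]
  have h1 := sum_majorant_le hW hs hs1 hq hq1.le 1 n
  calc _ ≤ ∑ m ∈ Finset.range n,
        27 * (1 + c) * (majorant W (s * q ^ m) - majorant W (s * q ^ (m + 1))) := by
        refine Finset.sum_le_sum fun m _ => ?_
        rw [pow_succ, ← mul_assoc]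
        exact norm_kerM_div_le_majorant hW (by positivity)
          (mul_le_one₀ hs1 (by positivity) (pow_le_one₀ hq hq1.le)) hq1 hc
    _ ≤ _ := by
      rw [← Finset.mul_sum]
      push_cast at h1
      have : 0 < 27 * (1 + c) := by positivity
      nlinarith

theorem summable_kerSum {τ s q : ℝ} (hτ : |τ| < 1) (hs : 0 ≤ s) (hs1 : s ≤ 1)
    (hq : 0 ≤ q) (hq1 : q ≤ 1) : Summable fun m : ℕ => (τ : ℂ) ^ m * kerM W (s * q ^ m) :=
  Summable.of_norm_bounded (summable_geometric_of_lt_one (abs_nonneg τ) hτ) fun m => by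
    rw [norm_mul, norm_pow, Complex.norm_real, Real.norm_eq_abs]
    exact mul_le_of_le_one_right (by positivity) (norm_kerM_le_one hW (by positivity)
      (mul_le_one₀ hs1 (by positivity) (pow_le_one₀ hq hq1)))

/-- The series of weights is within `O(1)` of the corresponding integral. -/
theorem norm_kerSum_sub_kerIntegral_le {l h s s' : ℝ} {J : ℕ} (hl : 0 < l) (hh : 0 < h)
    (hs : Real.exp (-h) ^ J ≤ s) (hs1 : s ≤ 1) (hs' : Real.exp (-h) ^ J ≤ s') (hs1' : s' ≤ 1) :
    ‖∑' m : ℕ, (Real.exp (-l) : ℂ) ^ m * kerM W (s * Real.exp (-h) ^ m) -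
      kerIntegral W l h s'‖ ≤ 1 + 27 * (J + 1) := by
  set q := Real.exp (-h) with hq
  set τ := Real.exp (-l) with hτ
  have hq0 : 0 < q := Real.exp_pos _
  have hτ0 : 0 < τ := Real.exp_pos _
  have hq1 : q ≤ 1 := Real.exp_le_one_iff.2 (by linarith)
  have hτ1 : τ < 1 := Real.exp_lt_one_iff.2 (by linarith)
  have hs0 : 0 ≤ s := (by positivity : 0 ≤ q ^ J).trans hs
  have hs0' : 0 ≤ s' := (by positivity : 0 ≤ q ^ J).trans hs'
  set f : ℝ → ℂ := fun t => (Real.exp (-(l * t)) : ℂ) * kerM W (s' * Real.exp (-(h * t))) with hf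
  have hfi : MeasureTheory.IntegrableOn f (Ioi 0) :=
    integrableOn_kerIntegral hW hl hh.le hs0' hs1'
  have hfint : ∀ a b : ℝ, 0 ≤ a → 0 ≤ b → IntervalIntegrable f MeasureTheory.volume a b := by
    intro a b ha hb
    rw [intervalIntegrable_iff]
    exact hfi.mono_set fun t ht => lt_of_le_of_lt (le_min ha hb) ht.1
  have hexpq : ∀ m : ℕ, Real.exp (-(h * m)) = q ^ m := fun m => by
    rw [hq, ← Real.exp_nat_mul]; ring_nf
  have hexpτ : ∀ m : ℕ, Real.exp (-(l * m)) = τ ^ m := fun m => by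
    rw [hτ, ← Real.exp_nat_mul]; ring_nf
  -- The error on `[m, m + 1]` splits into the variation of `τ^t` and that of the weight. Both
  -- arguments of the weight lie in `[q^{m+1+J}, q^m]`, since `s` and `s'` lie in `[q^J, 1]`. Summed
  -- over `m`, the parts give `1` and `27 (J + 1)`.
  set b : ℕ → ℝ := fun m => (τ ^ m - τ ^ (m + 1)) +
    27 * (majorant W (1 * q ^ m) - majorant W (1 * q ^ (m + (1 + J)))) with hb
  have hterm : ∀ m : ℕ, ‖(τ : ℂ) ^ m * kerM W (s * q ^ m) - ∫ t in (m : ℝ)..(m + 1 : ℕ), f t‖ ≤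
      b m := by
    intro m
    have e : (τ : ℂ) ^ m * kerM W (s * q ^ m) - ∫ t in (m : ℝ)..(m + 1 : ℕ), f t =
        ∫ t in (m : ℝ)..(m + 1 : ℕ), ((τ : ℂ) ^ m * kerM W (s * q ^ m) - f t) := by
      rw [intervalIntegral.integral_sub (by simp) (hfint _ _ (by positivity) (by positivity)),
        intervalIntegral.integral_const]
      push_cast
      simp
    rw [e]
    have hbd : ∀ t ∈ uIoc (m : ℝ) ((m + 1 : ℕ) : ℝ), ‖(τ : ℂ) ^ m * kerM W (s * q ^ m) - f t‖ ≤ b m := by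
      intro t ht
      rw [uIoc_of_le (by push_cast; linarith)] at ht
      obtain ⟨ht1, ht2⟩ := ht
      have ht0 : 0 ≤ t := (Nat.cast_nonneg m).trans ht1.le
      have hE1 : Real.exp (-(l * t)) ≤ τ ^ m := by
        rw [← hexpτ]; exact Real.exp_le_exp.2 (by nlinarith)
      have hE2 : τ ^ (m + 1) ≤ Real.exp (-(l * t)) := by
        rw [← hexpτ]; exact Real.exp_le_exp.2 (by nlinarith)
      have hQ1 : Real.exp (-(h * t)) ≤ q ^ m := by
        rw [← hexpq]; exact Real.exp_le_exp.2 (by nlinarith)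
      have hQ2 : q ^ (m + 1) ≤ Real.exp (-(h * t)) := by
        rw [← hexpq]; exact Real.exp_le_exp.2 (by nlinarith)
      have hqm : 0 < q ^ m := by positivity
      have hx : s * q ^ m ∈ Icc (1 * q ^ (m + (1 + J))) (1 * q ^ m) := by
        refine ⟨?_, mul_le_mul_of_nonneg_right hs1 hqm.le⟩
        calc 1 * q ^ (m + (1 + J)) = q ^ J * q ^ m * q := by ring
          _ ≤ q ^ J * q ^ m := mul_le_of_le_one_right (by positivity) hq1
          _ ≤ _ := by gcongr
      have hy : s' * Real.exp (-(h * t)) ∈ Icc (1 * q ^ (m + (1 + J))) (1 * q ^ m) := by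
        refine ⟨?_, mul_le_mul hs1' hQ1 (Real.exp_pos _).le zero_le_one⟩
        calc 1 * q ^ (m + (1 + J)) = q ^ J * q ^ (m + 1) := by ring
          _ ≤ _ := by gcongr
      have hM := norm_kerM_sub_le_of_mem hW (by positivity)
        (by rw [one_mul]; exact pow_le_one₀ hq0.le hq1) hx hy
      have hM1 : ‖kerM W (s * q ^ m)‖ ≤ 1 := norm_kerM_le_one hW (by positivity)
        (mul_le_one₀ hs1 (by positivity) (pow_le_one₀ hq0.le hq1))
      have e2 : (τ : ℂ) ^ m * kerM W (s * q ^ m) - f t =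
          ((τ ^ m - Real.exp (-(l * t)) : ℝ) : ℂ) * kerM W (s * q ^ m) +
            (Real.exp (-(l * t)) : ℂ) *
              (kerM W (s * q ^ m) - kerM W (s' * Real.exp (-(h * t)))) := by
        simp only [hf]; push_cast; ring
      rw [e2]
      refine (norm_add_le _ _).trans (add_le_add ?_ ?_)
      · rw [norm_mul, Complex.norm_real, Real.norm_of_nonneg (by linarith)]
        refine (mul_le_of_le_one_right (by linarith) hM1).trans (by linarith)
      · rw [norm_mul, Complex.norm_real, Real.norm_of_nonneg (Real.exp_pos _).le]
        refine (mul_le_of_le_one_left (norm_nonneg _) ?_).trans hM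
        exact Real.exp_le_one_iff.2 (by nlinarith)
    refine (intervalIntegral.norm_integral_le_of_norm_le_const hbd).trans (le_of_eq ?_)
    push_cast
    simp
  have hbsum : ∀ n : ℕ, ∑ m ∈ Finset.range n, b m ≤ 1 + 27 * (J + 1) := by
    intro n
    rw [hb, Finset.sum_add_distrib, ← Finset.mul_sum,
      Finset.sum_range_sub' (fun m => τ ^ m) n]
    have h1 := sum_majorant_le hW zero_le_one le_rfl hq0.le hq1 (1 + J) n
    have h2 : 0 < τ ^ n := by positivity
    push_cast at h1
    simp only [pow_zero]
    linarith
  have hpart : ∀ n : ℕ, ‖∑ m ∈ Finset.range n, (τ : ℂ) ^ m * kerM W (s * q ^ m) -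
      ∫ t in (0 : ℝ)..(n : ℝ), f t‖ ≤ 1 + 27 * (J + 1) := by
    intro n
    have e := intervalIntegral.sum_integral_adjacent_intervals (f := f)
      (μ := MeasureTheory.volume) (a := fun k : ℕ => (k : ℝ)) (n := n)
      (fun k _ => hfint _ _ (by positivity) (by positivity))
    simp only [Nat.cast_zero] at e
    rw [← e, ← Finset.sum_sub_distrib]
    exact (norm_sum_le _ _).trans ((Finset.sum_le_sum fun m _ => hterm m).trans (hbsum n))
  have hlim1 := (summable_kerSum (τ := τ) hW (by rw [abs_of_pos hτ0]; exact hτ1) hs0 hs1 hq0.le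
    hq1).hasSum.tendsto_sum_nat
  have hlim2 := MeasureTheory.intervalIntegral_tendsto_integral_Ioi (0 : ℝ) hfi
    (tendsto_natCast_atTop_atTop (R := ℝ))
  exact le_of_tendsto (hlim1.sub hlim2).norm (Eventually.of_forall hpart)

/-- The left side equals `e^{-v/2} (v/2) / sinh (v/2)`, and `x ≤ sinh x`. -/
theorem exp_half_mul_le {v : ℝ} (hv : 0 < v) :
    v * Real.exp (-v) / (1 - Real.exp (-v)) ≤ Real.exp (-(v / 2)) := by
  have h1 : Real.exp (-v) < 1 := Real.exp_lt_one_iff.2 (by linarith)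
  rw [div_le_iff₀ (by linarith)]
  have h2 := Real.self_le_sinh_iff.2 (by linarith : 0 ≤ v / 2)
  rw [Real.sinh_eq] at h2
  have e1 : Real.exp (-v) = Real.exp (-(v / 2)) ^ 2 := by rw [sq, ← Real.exp_add]; ring_nf
  have e2 : Real.exp (v / 2) * Real.exp (-(v / 2)) = 1 := by rw [← Real.exp_add]; simp
  rw [e1]
  have h3 := Real.exp_pos (-(v / 2))
  have h4 : v * Real.exp (-(v / 2)) ≤ 1 - Real.exp (-(v / 2)) ^ 2 := by nlinarith
  nlinarith

/-- The integral depends on its rate `h` in a controlled way. -/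
theorem norm_kerIntegral_sub_le {l h h₀ p s : ℝ} (hl : 0 < l) (hp : 0 < p) (hh : p ≤ h)
    (hh₀ : p ≤ h₀) (hs : 0 ≤ s) (hs1 : s ≤ 1) :
    ‖kerIntegral W l h s - kerIntegral W l h₀ s‖ ≤ 108 * |h - h₀| / p ^ 2 := by
  have i1 := integrableOn_kerIntegral hW hl (hp.le.trans hh) hs hs1
  have i2 := integrableOn_kerIntegral hW hl (hp.le.trans hh₀) hs hs1
  rw [kerIntegral, kerIntegral, ← MeasureTheory.integral_sub i1 i2]
  -- The arguments differ by at most `|h - h₀| t e^{-pt}`. `norm_kerM_sub_le_div` with `z = e^{-pt}`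
  -- and `exp_half_mul_le` at `v = pt` then give this dominating function, whose integral is `108 |h
  -- - h₀| / p²`.
  have h1 : MeasureTheory.IntegrableOn
      (fun t : ℝ => 54 * |h - h₀| / p * Real.exp (-(p / 2) * t)) (Ioi 0) :=
    (exp_neg_integrableOn_Ioi 0 (by positivity)).const_mul _
  refine (MeasureTheory.norm_integral_le_of_norm_le h1 ?_).trans (le_of_eq ?_)
  · filter_upwards [MeasureTheory.ae_restrict_mem measurableSet_Ioi] with t ht
    have ht0 : 0 < t := ht
    rw [← mul_sub, norm_mul, Complex.norm_real, Real.norm_of_nonneg (Real.exp_pos _).le]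
    have hl1 : Real.exp (-(l * t)) ≤ 1 := Real.exp_le_one_iff.2 (by nlinarith [mul_pos hl ht0])
    refine (mul_le_of_le_one_left (norm_nonneg _) hl1).trans ?_
    have hv : 0 < p * t := by positivity
    have hz1 : Real.exp (-(p * t)) < 1 := Real.exp_lt_one_iff.2 (by linarith)
    have hle : ∀ h', p ≤ h' → s * Real.exp (-(h' * t)) ≤ Real.exp (-(p * t)) := fun h' hh' => by
      refine (mul_le_of_le_one_left (Real.exp_pos _).le hs1).trans (Real.exp_le_exp.2 ?_)
      nlinarith
    have h2 := norm_kerM_sub_le_div hW (by positivity) (by positivity) (hle h hh) (hle h₀ hh₀) hz1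
    refine h2.trans ?_
    have h3 : |s * Real.exp (-(h * t)) - s * Real.exp (-(h₀ * t))| ≤
        |h - h₀| * t * Real.exp (-(p * t)) := by
      have aux : ∀ a b : ℝ, p ≤ a → a ≤ b →
          |Real.exp (-(a * t)) - Real.exp (-(b * t))| ≤ (b - a) * t * Real.exp (-(p * t)) := by
        intro a b hpa hab
        have e : Real.exp (-(b * t)) = Real.exp (-(a * t)) * Real.exp (-((b - a) * t)) := by
          rw [← Real.exp_add]; ring_nf
        have h4 := Real.add_one_le_exp (-((b - a) * t))
        have h5 : Real.exp (-((b - a) * t)) ≤ 1 :=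
          Real.exp_le_one_iff.2 (by nlinarith [mul_nonneg (sub_nonneg.2 hab) ht0.le])
        have h6 : Real.exp (-(a * t)) ≤ Real.exp (-(p * t)) := Real.exp_le_exp.2 (by nlinarith)
        have h7 := Real.exp_pos (-(a * t))
        have h8 : 0 ≤ (b - a) * t := mul_nonneg (sub_nonneg.2 hab) ht0.le
        rw [e, abs_of_nonneg (by nlinarith)]
        calc Real.exp (-(a * t)) - Real.exp (-(a * t)) * Real.exp (-((b - a) * t))
            = Real.exp (-(a * t)) * (1 - Real.exp (-((b - a) * t))) := by ring
          _ ≤ Real.exp (-(p * t)) * ((b - a) * t) := by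
            refine mul_le_mul h6 (by linarith) (by linarith) (Real.exp_pos _).le
          _ = _ := by ring
      rw [← mul_sub, abs_mul, abs_of_nonneg hs]
      refine (mul_le_of_le_one_left (abs_nonneg _) hs1).trans ?_
      rcases le_total h h₀ with h9 | h9
      · rw [abs_of_nonpos (by linarith : h - h₀ ≤ 0), neg_sub]
        exact aux h h₀ hh h9
      · rw [abs_of_nonneg (by linarith : 0 ≤ h - h₀), abs_sub_comm]
        exact aux h₀ h hh₀ h9
    have h10 := exp_half_mul_le hW hv
    have hz0 : 0 < 1 - Real.exp (-(p * t)) := by linarith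
    calc 54 * |s * Real.exp (-(h * t)) - s * Real.exp (-(h₀ * t))| / (1 - Real.exp (-(p * t)))
        ≤ 54 * (|h - h₀| * t * Real.exp (-(p * t))) / (1 - Real.exp (-(p * t))) := by gcongr
      _ = 54 * |h - h₀| / p * (p * t * Real.exp (-(p * t)) / (1 - Real.exp (-(p * t)))) := by
        field_simp
      _ ≤ 54 * |h - h₀| / p * Real.exp (-(p * t / 2)) := by gcongr
      _ = _ := by congr 2; ring
  · rw [MeasureTheory.integral_const_mul, integral_exp_mul_Ioi (by linarith) 0]
    simp only [mul_zero, Real.exp_zero]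
    field_simp
    ring

end

/-! ### The size of the geometric parameters -/

/-- The period `2 (ξᵢ - ξₑ)` of the images. -/
def stepH (ri re ε : ℝ) : ℝ := 2 * (xiI ri re ε - xiE ri re ε)

namespace Admissible

variable {ri re ε : ℝ} (H : Admissible ri re ε)

include H

theorem exp_neg_stepH : Real.exp (-stepH ri re ε) = ratioQ ri re ε := by
  rw [ratioQ, ← H.exp_neg_xiI, ← H.exp_neg_xiE, ← Real.exp_sub, ← Real.exp_nat_mul, stepH]
  congr 1
  push_cast
  ring

theorem stepH_pos : 0 < stepH ri re ε := by
  have h := H.ratioQ_lt_one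
  rw [← H.exp_neg_stepH, Real.exp_lt_one_iff] at h
  linarith

/-- `e^{±ξᵢ} = (cᵢ ± α)/rᵢ`. With `sinh_xiE` it yields `h ≈ 2α (1/rᵢ - 1/rₑ)` for small `α`. -/
theorem sinh_xiI : Real.sinh (xiI ri re ε) = alpha ri re ε / ri := by
  have h1 := H.ci_sq_sub
  have h2 := H.ri_pos
  have h3 : 0 < ci ri re ε + alpha ri re ε := add_pos H.ci_pos H.alpha_pos
  rw [Real.sinh_eq, H.exp_neg_xiI, ← neg_neg (xiI ri re ε), Real.exp_neg (-xiI ri re ε),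
    H.exp_neg_xiI, rhoI]
  field_simp
  linear_combination h1

theorem sinh_xiE : Real.sinh (xiE ri re ε) = alpha ri re ε / re := by
  have h1 := H.ce_sq_sub
  have h2 := H.re_pos
  have h3 : 0 < ce ri re ε + alpha ri re ε := add_pos H.ce_pos H.alpha_pos
  rw [Real.sinh_eq, H.exp_neg_xiE, ← neg_neg (xiE ri re ε), Real.exp_neg (-xiE ri re ε),
    H.exp_neg_xiE, rhoE]
  field_simp
  linear_combination h1

theorem x0_le : x0 ri re ε ≤ alpha ri re ε ^ 2 / re := by
  have h1 := H.ce_sq_sub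
  have h2 := H.re_pos
  have h3 := H.re_lt_ce
  rw [x0, le_div_iff₀ h2]
  nlinarith

end Admissible

/-- `sinh` is close to the identity near `0`. -/
theorem sinh_bounds {x s : ℝ} (hs : Real.sinh x = s) (h0 : 0 < s) : s - s ^ 2 ≤ x ∧ x ≤ s := by
  have hx : 0 < x := by rw [← hs] at h0; exact Real.sinh_pos_iff.1 h0
  refine ⟨?_, by rw [← hs]; exact Real.self_le_sinh_iff.2 hx.le⟩
  have h1 : 1 + s ≤ Real.exp x := by
    have := Real.cosh_add_sinh x
    have := Real.one_le_cosh x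
    linarith
  have h2 := Real.one_sub_inv_le_log_of_pos (x := 1 + s) (by linarith)
  have h3 : Real.log (1 + s) ≤ x := by
    rw [Real.log_le_iff_le_exp (by linarith)]; exact h1
  have h4 : s - s ^ 2 ≤ 1 - (1 + s)⁻¹ := by
    have e : 1 - (1 + s)⁻¹ = s / (1 + s) := by field_simp; ring
    rw [e, le_div_iff₀ (by linarith)]
    nlinarith [pow_pos h0 3]
  linarith

theorem rStar_pos {ri re : ℝ} (hri : 0 < ri) (hrire : ri < re) : 0 < rStar ri re := by
  have : 0 < re - ri := by linarith
  have : 0 < re := by linarith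
  rw [rStar]
  positivity

theorem rStar_sq {ri re : ℝ} (hri : 0 < ri) (hrire : ri < re) :
    rStar ri re ^ 2 = 2 * ri * re / (re - ri) := by
  have : 0 < re - ri := by linarith
  have : 0 < re := by linarith
  rw [rStar, Real.sq_sqrt (by positivity)]

/-- The exact difference carries a factor `ε²`, and `ε ≤ (rₑ - rᵢ)/2` keeps its denominator away
from zero. -/
theorem exists_alpha_bounds {ri re : ℝ} (hri : 0 < ri) (hrire : ri < re) :
    ∃ K : ℝ, 0 < K ∧ ∀ ε, Admissible ri re ε → ε ≤ (re - ri) / 2 →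
      |alpha ri re ε ^ 2 - rStar ri re ^ 2 * ε| ≤ K * ε ^ 2 := by
  have hD : 0 < re - ri := by linarith
  have hre : 0 < re := by linarith
  set D := re - ri with hDdef
  -- The numerator of the remainder, bounded term by term in absolute value using `ε ≤ D`.
  set K₀ := 4 * D ^ 3 + 12 * D * (ri * re) + 4 * D ^ 3 + D ^ 3 + 8 * (ri * re) * D with hK₀
  have hK₀pos : 0 < K₀ := by positivity
  refine ⟨K₀ / (D * D ^ 2), by positivity, fun ε H hε => ?_⟩
  have h1 := H.gap_pos
  have h2 := H.eps_pos
  have hgap : D / 2 ≤ D - ε := by linarith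
  have e : alpha ri re ε ^ 2 - rStar ri re ^ 2 * ε =
      ε ^ 2 * (4 * D ^ 3 + 12 * D * (ri * re) - 4 * D ^ 2 * ε + D * ε ^ 2 - 8 * (ri * re) * ε) /
        (4 * D * (D - ε) ^ 2) := by
    have h1' : re - ri - ε ≠ 0 := h1.ne'
    have h3' : re - ri ≠ 0 := hD.ne'
    rw [H.alpha_sq, rStar_sq hri hrire, hDdef]
    field_simp
    ring
  have hεD : ε ≤ D := by linarith
  have hrr : 0 < ri * re := by positivity
  have hnum : |4 * D ^ 3 + 12 * D * (ri * re) - 4 * D ^ 2 * ε + D * ε ^ 2 - 8 * (ri * re) * ε| ≤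
      K₀ := by
    have g1 : D ^ 2 * ε ≤ D ^ 3 := by nlinarith [mul_nonneg (sq_nonneg D) (sub_nonneg.2 hεD)]
    have g2 : D * ε ^ 2 ≤ D ^ 3 := by
      have : ε ^ 2 ≤ D ^ 2 := pow_le_pow_left₀ h2.le hεD 2
      nlinarith
    have g3 : (ri * re) * ε ≤ (ri * re) * D := mul_le_mul_of_nonneg_left hεD hrr.le
    have g4 : 0 ≤ D ^ 2 * ε := by positivity
    have g5 : 0 ≤ D * ε ^ 2 := by positivity
    have g6 : 0 ≤ (ri * re) * ε := by positivity
    have g7 : 0 ≤ D ^ 3 := by positivity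
    have g8 : 0 ≤ D * (ri * re) := by positivity
    rw [abs_le]
    constructor <;> simp only [hK₀] <;> linarith
  rw [e, abs_div, abs_mul, abs_of_pos (by positivity : 0 < ε ^ 2),
    abs_of_pos (by positivity : 0 < 4 * D * (D - ε) ^ 2), div_mul_eq_mul_div]
  have hden : D * D ^ 2 ≤ 4 * D * (D - ε) ^ 2 := by
    have : (D / 2) ^ 2 ≤ (D - ε) ^ 2 := pow_le_pow_left₀ (by positivity) hgap 2
    nlinarith
  rw [mul_comm K₀]
  gcongr

set_option maxHeartbeats 1600000 in
/-- For small `ε` all the parameters are comparable to `√ε`. -/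
theorem exists_small_params {ri re : ℝ} (hri : 0 < ri) (hrire : ri < re) :
    ∃ ε₁ > 0, ∃ c₁ c₂ c₃ : ℝ, ∃ J : ℕ, 0 ≤ c₁ ∧ 0 ≤ c₂ ∧ 0 ≤ c₃ ∧
      ∀ ε, Admissible ri re ε → ε < ε₁ →
        alpha ri re ε + x0 ri re ε ≤ c₁ * (1 - ratioQ ri re ε) ∧
        1 - ratioQ ri re ε ≤ c₂ * (1 - rhoE ri re ε) ∧
        ratioQ ri re ε ^ J ≤ rhoI ri re ε ^ 2 ∧
        ∃ p > 0, p ≤ stepH ri re ε ∧ p ≤ 4 * Real.sqrt ε / rStar ri re ∧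
          |stepH ri re ε - 4 * Real.sqrt ε / rStar ri re| ≤ c₃ * p ^ 2 := by
  obtain ⟨K, hK, hα⟩ := exists_alpha_bounds hri hrire
  have hD : 0 < re - ri := by linarith
  have hre : 0 < re := by linarith
  set r := rStar ri re with hr
  have hr0 : 0 < r := rStar_pos hri hrire
  have hr2 : r ^ 2 = 2 * ri * re / (re - ri) := rStar_sq hri hrire
  -- `α ≤ a √ε`
  set a := r + K / r with ha
  have ha0 : 0 < a := by positivity
  set c := 4 * a ^ 2 / ri ^ 2 + 4 / r ^ 2 * (K / r) with hc
  have hc0 : 0 < c := by positivity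
  set b := re + a ^ 2 / re + a with hb
  have hb0 : 0 < b := by positivity
  -- Since `2ξᵢ ≤ 2a√ε/rᵢ` and `h ≥ 2√ε/r`, this choice gives `2ξᵢ ≤ J h`, that is `q^J ≤ ρᵢ²`.
  obtain ⟨J, hJ⟩ := exists_nat_ge (a * r / ri)
  clear_value r a c b
  -- The four thresholds on `√ε` ensure, in order, `ε ≤ √ε`, `α ≥ r√ε/2`, `c ε ≤ 2√ε/r` (hence `h ≥
  -- 2√ε/r`), and `h ≤ 1`.
  set s₁ := min (min 1 (r / (2 * (K / r + 1)))) (min (2 / (r * c)) (r / 8)) with hs₁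
  have hs₁0 : 0 < s₁ := by
    rw [hs₁]
    refine lt_min (lt_min one_pos (by positivity)) (lt_min (by positivity) (by positivity))
  have hs₁a : s₁ ≤ 1 := (min_le_left _ _).trans (min_le_left _ _)
  have hs₁b : s₁ ≤ r / (2 * (K / r + 1)) := (min_le_left _ _).trans (min_le_right _ _)
  have hs₁c : s₁ ≤ 2 / (r * c) := (min_le_right _ _).trans (min_le_left _ _)
  have hs₁d : s₁ ≤ r / 8 := (min_le_right _ _).trans (min_le_right _ _)
  clear_value s₁
  -- `c₁` compares `α + x₀ ≤ (a + a²/rₑ)√ε` with `1 - q ≥ √ε/r`; `c₂` compares `1 - q ≤ 8√ε/r` with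
  -- `1 - ρₑ ≥ r√ε/(2b)`.
  refine ⟨min (s₁ ^ 2) ((re - ri) / 2), lt_min (by positivity) (by linarith),
    (a + a ^ 2 / re) * r, 16 * b / r ^ 2, c * r ^ 2 / 4, J, by positivity, by positivity,
    by positivity, fun ε H hε => ?_⟩
  have hε0 := H.eps_pos
  set s := Real.sqrt ε with hs
  have hs0 : 0 < s := Real.sqrt_pos.2 hε0
  have hss : s ^ 2 = ε := Real.sq_sqrt hε0.le
  clear_value s
  have hslt : s < s₁ := by
    refine lt_of_pow_lt_pow_left₀ 2 hs₁0.le ?_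
    rw [hss]
    exact hε.trans_le (min_le_left _ _)
  have hs_1 : s ≤ 1 := hslt.le.trans hs₁a
  have hs2s : s ^ 2 ≤ s := by rw [sq]; exact mul_le_of_le_one_left hs0.le hs_1
  have hs_2 : s ≤ r / (2 * (K / r + 1)) := hslt.le.trans hs₁b
  have hs_3 : s ≤ 2 / (r * c) := hslt.le.trans hs₁c
  have hs_4 : s ≤ r / 8 := hslt.le.trans hs₁d
  set α := alpha ri re ε with hαdef
  have hα0 : 0 < α := H.alpha_pos
  clear_value α
  -- `|α - r √ε| ≤ (K / r) ε`
  have hαs : |α - r * s| ≤ K / r * s ^ 2 := by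
    have h1 := hα ε H (hε.le.trans (min_le_right _ _))
    rw [← hαdef, ← hss, show α ^ 2 - r ^ 2 * s ^ 2 = (α - r * s) * (α + r * s) by ring, abs_mul,
      abs_of_pos (by positivity : 0 < α + r * s)] at h1
    have h2 : |α - r * s| * (r * s) ≤ K * (s ^ 2) ^ 2 :=
      (mul_le_mul_of_nonneg_left (by linarith) (abs_nonneg _)).trans h1
    have h3 : |α - r * s| ≤ K * (s ^ 2) ^ 2 / (r * s) := by
      rw [le_div_iff₀ (by positivity)]; exact h2
    refine h3.trans ?_
    rw [show K * (s ^ 2) ^ 2 / (r * s) = K / r * s ^ 2 * s by field_simp]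
    exact mul_le_of_le_one_right (by positivity) hs_1
  have hαu : α ≤ a * s := by
    have h1 := (abs_le.1 hαs).2
    have h2 : K / r * s ^ 2 ≤ K / r * s := by gcongr
    rw [ha]
    linarith
  have hαl : r / 2 * s ≤ α := by
    have h1 := (abs_le.1 hαs).1
    have h2 : K / r * s ≤ r / 2 := by
      rw [le_div_iff₀ (by positivity)] at hs_2
      have : K / r * s ≤ (K / r + 1) * s := by rw [add_mul]; linarith
      linarith
    have h3 : K / r * s ^ 2 ≤ r / 2 * s := by
      rw [sq, ← mul_assoc]; exact mul_le_mul_of_nonneg_right h2 hs0.le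
    linarith
  have hαsq : α ^ 2 ≤ a ^ 2 * s ^ 2 := by
    rw [← mul_pow]; exact pow_le_pow_left₀ hα0.le hαu 2
  obtain ⟨hI1, hI2⟩ := sinh_bounds H.sinh_xiI (div_pos H.alpha_pos hri)
  obtain ⟨hE1, hE2⟩ := sinh_bounds H.sinh_xiE (div_pos H.alpha_pos hre)
  rw [← hαdef] at hI1 hI2 hE1 hE2
  set h := stepH ri re ε with hh
  have hstep : h = 2 * (xiI ri re ε - xiE ri re ε) := rfl
  clear_value h
  have hhs : |h - 4 * α / r ^ 2| ≤ 4 * a ^ 2 / ri ^ 2 * s ^ 2 := by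
    -- `1/rᵢ - 1/rₑ = 2/r_*²`: this is where `r_*` comes from.
    have e1 : 4 * α / r ^ 2 = 2 * (α / ri - α / re) := by
      rw [hr2]; field_simp; ring
    have e2 : (α / ri) ^ 2 ≤ a ^ 2 / ri ^ 2 * s ^ 2 := by
      rw [div_pow, div_mul_eq_mul_div]; gcongr
    have e3 : (α / re) ^ 2 ≤ (α / ri) ^ 2 := by
      gcongr
    rw [e1, hstep, abs_le]
    have e4 : 4 * a ^ 2 / ri ^ 2 * s ^ 2 = 4 * (a ^ 2 / ri ^ 2 * s ^ 2) := by ring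
    have e5 : 0 ≤ (α / ri) ^ 2 := by positivity
    rw [e4]
    constructor <;> linarith
  have hdiff : |h - 4 * s / r| ≤ c * s ^ 2 := by
    have e1 : h - 4 * s / r = (h - 4 * α / r ^ 2) + 4 / r ^ 2 * (α - r * s) := by
      field_simp; ring
    rw [e1]
    refine (abs_add_le _ _).trans ?_
    rw [abs_mul, abs_of_pos (by positivity : 0 < 4 / r ^ 2), hc, add_mul, mul_assoc (4 / r ^ 2)]
    gcongr
  have hcs : c * s ^ 2 ≤ 2 * s / r := by
    rw [le_div_iff₀ (by positivity)] at hs_3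
    rw [le_div_iff₀ hr0]
    have := mul_le_mul_of_nonneg_right hs_3 hs0.le
    linarith
  have e4s : 4 * s / r = 2 * (2 * s / r) := by ring
  have hsr : 0 < 2 * s / r := by positivity
  have hhl : 2 * s / r ≤ h := by
    have := (abs_le.1 hdiff).1
    linarith
  have hhu : h ≤ 8 * s / r := by
    have h1 := (abs_le.1 hdiff).2
    have e8 : 8 * s / r = 4 * (2 * s / r) := by ring
    rw [e8]
    linarith
  have hh1 : h ≤ 1 := by
    refine hhu.trans ?_
    rw [div_le_one hr0]
    linarith
  have hh0 : 0 < h := hsr.trans_le hhl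
  have hq : ratioQ ri re ε = Real.exp (-h) := by rw [hh]; exact H.exp_neg_stepH.symm
  have hql : s / r ≤ 1 - ratioQ ri re ε := by
    have h1 : Real.exp (-h) ≤ 1 / (1 + h) := by
      rw [Real.exp_neg, inv_eq_one_div]
      have := Real.add_one_le_exp h
      gcongr
      linarith
    have h2 : 1 / (1 + h) ≤ 1 - h / 2 := by
      rw [div_le_iff₀ (by linarith)]
      have := mul_le_of_le_one_right hh0.le hh1
      linarith
    have h3 : s / r = (2 * s / r) / 2 := by ring
    rw [hq, h3]
    linarith
  have hqu : 1 - ratioQ ri re ε ≤ 8 * s / r := by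
    rw [hq]
    have := Real.add_one_le_exp (-h)
    linarith
  have hx0 : x0 ri re ε ≤ a ^ 2 / re * s := by
    refine H.x0_le.trans ?_
    rw [← hαdef, div_mul_eq_mul_div]
    gcongr
    refine hαsq.trans ?_
    gcongr
  -- `p` is half the leading term of `h`, and `c ε = (c r²/4) p²` accounts for `c₃`.
  refine ⟨?_, ?_, ?_, 2 * s / r, hsr, hhl, by linarith, hdiff.trans (le_of_eq ?_)⟩
  · calc α + x0 ri re ε ≤ (a + a ^ 2 / re) * r * (s / r) := by
          have e : (a + a ^ 2 / re) * r * (s / r) = a * s + a ^ 2 / re * s := by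
            field_simp
          rw [e]; linarith
      _ ≤ _ := by gcongr
  · have hce : ce ri re ε + α ≤ b := by
      have h1 : ce ri re ε = re + x0 ri re ε := by rw [x0]; ring
      have h2 : a ^ 2 / re * s ≤ a ^ 2 / re := mul_le_of_le_one_right (by positivity) hs_1
      have h3 : a * s ≤ a := mul_le_of_le_one_right ha0.le hs_1
      rw [hb]; linarith
    have hce0 : 0 < ce ri re ε + α := by linarith [H.ce_pos]
    have h1 : r / 2 * s / b ≤ 1 - rhoE ri re ε := by
      have e : 1 - rhoE ri re ε = (ce ri re ε + α - re) / (ce ri re ε + α) := by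
        rw [rhoE, ← hαdef]; field_simp
      rw [e]
      have h2 := H.re_lt_ce
      gcongr <;> linarith
    calc 1 - ratioQ ri re ε ≤ 8 * s / r := hqu
      _ = 16 * b / r ^ 2 * (r / 2 * s / b) := by field_simp; ring
      _ ≤ _ := by gcongr
  · rw [hq, ← H.exp_neg_xiI, ← Real.exp_nat_mul, ← Real.exp_nat_mul]
    refine Real.exp_le_exp.2 ?_
    have h1 : xiI ri re ε ≤ a * s / ri := hI2.trans (by gcongr)
    have h2 : a * r / ri * (2 * s / r) ≤ J * h := by gcongr
    have e : a * r / ri * (2 * s / r) = 2 * (a * s / ri) := by field_simp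
    push_cast
    linarith
  · field_simp
    norm_num

/-- For `ε` bounded away from `0` the circles are uniformly separated. -/
theorem exists_large_params {ri re : ℝ} (hri : 0 < ri) (hrire : ri < re) {ε₁ : ℝ} (hε₁ : 0 < ε₁) :
    ∃ q₀ ρ₀ : ℝ, 0 ≤ q₀ ∧ q₀ < 1 ∧ ρ₀ < 1 ∧ ∀ ε, Admissible ri re ε → ε₁ ≤ ε →
      ratioQ ri re ε ≤ q₀ ∧ rhoI ri re ε ≤ ρ₀ := by
  by_cases hlt : ε₁ < re - ri
  swap
  · exact ⟨0, 0, le_rfl, one_pos, one_pos, fun ε H h => absurd H.eps_lt (by linarith)⟩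
  have H₁ : Admissible ri re ε₁ := ⟨hri, hrire, hε₁, hlt⟩
  have hre := H₁.re_pos
  have hg₁ := H₁.gap_pos
  set c := ci ri re ε₁ with hc
  have hcr : ri < c := H₁.ci_gt
  have hc0 : 0 < c := hri.trans hcr
  -- `ρᵢ/ρₑ = (rᵢ/rₑ)(1 + (rₑ - rᵢ - ε)/(cᵢ + α))`. As `cᵢ` increases with `ε`, dropping `α` and
  -- setting `ε = ε₁` bounds it from above; `cᵢ > rᵢ` makes the bound less than `1`.
  set t := ri / re * (1 + (re - ri - ε₁) / c) with ht
  have ht0 : 0 ≤ t := by positivity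
  have ht1 : t < 1 := by
    have e : t = ri * (c + (re - ri - ε₁)) / (re * c) := by rw [ht]; field_simp
    rw [e, div_lt_one (by positivity)]
    nlinarith [mul_pos (sub_pos.2 hrire) (sub_pos.2 hcr)]
  refine ⟨t ^ 2, ri / c, by positivity, pow_lt_one₀ ht0 ht1 two_ne_zero, ?_, fun ε H hε => ?_⟩
  · rw [div_lt_one hc0]; exact hcr
  have hci : c ≤ ci ri re ε := by
    have h1 := H.gap_pos
    rw [hc, ci, ci, div_le_div_iff₀ (by linarith) (by linarith)]
    have h2 : re - ri - ε ≤ re - ri - ε₁ := by linarith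
    set p := re - ri - ε
    set p₁ := re - ri - ε₁
    have h3 : 0 < re ^ 2 - ri ^ 2 := by nlinarith
    nlinarith [mul_nonneg (sub_nonneg.2 h2) h3.le, mul_nonneg (sub_nonneg.2 h2)
      (mul_pos h1 hg₁).le]
  have hα := H.alpha_pos
  refine ⟨?_, ?_⟩
  · rw [ratioQ]
    have h0 : 0 ≤ rhoI ri re ε / rhoE ri re ε := div_nonneg H.rhoI_pos.le H.rhoE_pos.le
    refine pow_le_pow_left₀ h0 ?_ 2
    have h4 := H.ci_pos
    have h5 := H.ce_pos
    have e : rhoI ri re ε / rhoE ri re ε =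
        ri / re * (1 + (re - ri - ε) / (ci ri re ε + alpha ri re ε)) := by
      rw [rhoI, rhoE]
      have : ce ri re ε = ci ri re ε + (re - ri - ε) := H.ce_eq
      rw [this] at h5 ⊢
      field_simp
      ring
    rw [e, ht]
    have h6 := H.gap_pos
    gcongr
    linarith
  · rw [rhoI]
    gcongr
    linarith

/-! ### Uniform bounds for the series of images -/

/-- Away from the pole the weight is at most `4x/(1 - ρ)²`, so the integral converges through the
decay of its argument. The bound is uniform in `l`, hence survives `τ → 1` when `h` is bounded
below. -/
theorem norm_kerIntegral_le {W : ℂ} (hW : ‖W‖ < 1) {l h s ρ : ℝ} (hl : 0 < l) (hh : 0 < h)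
    (hs : 0 ≤ s) (hs1 : s ≤ 1) (hρ : s * ‖W‖ ≤ ρ) (hρ1 : ρ < 1) :
    ‖kerIntegral W l h s‖ ≤ 4 / (1 - ρ) ^ 2 / h := by
  have h1 : MeasureTheory.IntegrableOn
      (fun t : ℝ => 4 / (1 - ρ) ^ 2 * Real.exp (-h * t)) (Ioi 0) :=
    (exp_neg_integrableOn_Ioi 0 hh).const_mul _
  have hρ0 : 0 < 1 - ρ := by linarith
  refine (MeasureTheory.norm_integral_le_of_norm_le h1 ?_).trans (le_of_eq ?_)
  · filter_upwards [MeasureTheory.ae_restrict_mem measurableSet_Ioi] with t ht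
    have ht0 : 0 < t := ht
    obtain ⟨hx0, hx1⟩ := mul_exp_neg_mem hs hs1 hh.le ht0.le
    have hexp : Real.exp (-(h * t)) ≤ 1 :=
      Real.exp_le_one_iff.2 (by linarith [mul_pos hh ht0])
    have hxs : s * Real.exp (-(h * t)) ≤ s := mul_le_of_le_one_right hs hexp
    set x := s * Real.exp (-(h * t)) with hx
    have hxe : x ≤ Real.exp (-h * t) := by
      rw [neg_mul]; exact mul_le_of_le_one_left (Real.exp_pos _).le hs1
    rw [norm_mul, Complex.norm_real, Real.norm_of_nonneg (Real.exp_pos _).le]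
    have hl1 : Real.exp (-(l * t)) ≤ 1 :=
      Real.exp_le_one_iff.2 (by linarith [mul_pos hl ht0])
    refine (mul_le_of_le_one_left (norm_nonneg _) hl1).trans ?_
    rw [norm_kerM hx0]
    have h2 : 1 - ρ ≤ ‖1 + (x : ℂ) * W‖ := by
      have h3 := norm_sub_norm_le (1 : ℂ) (-(x * W))
      rw [norm_one, norm_neg, sub_neg_eq_add, norm_mul, Complex.norm_real,
        Real.norm_of_nonneg hx0] at h3
      have := mul_le_mul_of_nonneg_right hxs (norm_nonneg W)
      linarith
    have h4 : ‖1 + W‖ ≤ 2 := by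
      refine (norm_add_le _ _).trans ?_
      rw [norm_one]; linarith
    calc x * ‖1 + W‖ ^ 2 / ‖1 + (x : ℂ) * W‖ ^ 2
        ≤ Real.exp (-h * t) * 2 ^ 2 / (1 - ρ) ^ 2 := by gcongr
      _ = _ := by ring
  · rw [MeasureTheory.integral_const_mul, integral_exp_mul_Ioi (by linarith) 0]
    simp only [mul_zero, Real.exp_zero]
    field_simp

theorem zero_mem_closedBall {re : ℝ} (hre : 0 < re) : (0 : ℂ) ∈ Metric.closedBall (re : ℂ) re := by
  rw [Metric.mem_closedBall, dist_eq_norm, zero_sub, norm_neg, Complex.norm_real,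
    Real.norm_of_nonneg hre.le]

namespace Admissible

variable {ri re ε : ℝ} (H : Admissible ri re ε)

include H

/-- The factor `1/|1 + X|` is exactly what `sum_norm_kerM_div_le` absorbs when it is multiplied by
`1 - q`. -/
theorem norm_zMap_le {X : ℂ} (hX : ‖X‖ < 1) :
    ‖zMap ri re ε X‖ ≤ 2 * (alpha ri re ε + x0 ri re ε) * (1 / ‖1 + X‖) := by
  have hα := H.alpha_pos
  have hx := H.x0_pos
  have h0 := norm_one_add_pos hX
  have h1 : ‖1 - X‖ ≤ 2 := by
    refine (norm_sub_le _ _).trans ?_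
    rw [norm_one]; linarith
  have h2 : ‖1 + X‖ ≤ 2 := by
    refine (norm_add_le _ _).trans ?_
    rw [norm_one]; linarith
  rw [zMap]
  refine (norm_sub_le _ _).trans ?_
  rw [norm_div, norm_mul, Complex.norm_real, Complex.norm_real, Real.norm_of_nonneg hα.le,
    Real.norm_of_nonneg hx.le]
  have h3 : x0 ri re ε ≤ x0 ri re ε * 2 * (1 / ‖1 + X‖) := by
    rw [mul_one_div, le_div_iff₀ h0]
    exact (mul_le_mul_of_nonneg_left h2 hx.le).trans le_rfl
  have h4 : alpha ri re ε * ‖1 - X‖ / ‖1 + X‖ ≤ alpha ri re ε * 2 * (1 / ‖1 + X‖) := by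
    rw [mul_one_div]
    gcongr
  linarith

theorem scaled_pow_mem {s : ℝ} (hs : 0 ≤ s) (hs1 : s ≤ 1) (m : ℕ) :
    0 ≤ s * ratioQ ri re ε ^ m ∧ s * ratioQ ri re ε ^ m ≤ 1 := by
  have h := H.ratioQ_pos
  exact ⟨by positivity, mul_le_one₀ hs1 (by positivity) (pow_le_one₀ h.le H.ratioQ_lt_one.le)⟩

theorem zMap_scaled_mem {s : ℝ} (hs : 0 ≤ s) (hs1 : s ≤ 1) {W : ℂ} (hW : ‖W‖ < rhoE ri re ε)
    (m : ℕ) : ‖((s * ratioQ ri re ε ^ m : ℝ) : ℂ) * W‖ < 1 ∧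
      zMap ri re ε ((s * ratioQ ri re ε ^ m : ℝ) * W) ∈ Metric.closedBall (re : ℂ) re := by
  obtain ⟨h1, h2⟩ := H.scaled_pow_mem hs hs1 m
  have h3 : ‖((s * ratioQ ri re ε ^ m : ℝ) : ℂ) * W‖ ≤ ‖W‖ := by
    rw [norm_mul, Complex.norm_real, Real.norm_of_nonneg h1]
    exact mul_le_of_le_one_left (norm_nonneg _) h2
  exact ⟨h3.trans_lt (hW.trans H.rhoE_lt_one), H.zMap_mem_closedBall (h3.trans hW.le)⟩

variable {F F₁ : ℂ → ℂ} {L B : ℝ} (E : IsExtension re F F₁ L)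
  (hB : ∀ z ∈ Metric.closedBall (re : ℂ) re, ‖F₁ z‖ ≤ B)
  {τ : ℝ} (hτ : |τ| < 1) {s : ℝ} (hs : 0 ≤ s) (hs1 : s ≤ 1) {W : ℂ} (hW : ‖W‖ < rhoE ri re ε)

include hB hτ hs hs1 hW

theorem norm_gradSeries_term_le (m : ℕ) :
    ‖(τ : ℂ) ^ m * (kerM W (s * ratioQ ri re ε ^ m) *
      F₁ (zMap ri re ε ((s * ratioQ ri re ε ^ m : ℝ) * W)))‖ ≤
      |τ| ^ m * (‖kerM W (s * ratioQ ri re ε ^ m)‖ * B) := by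
  rw [norm_mul, norm_mul, norm_pow, Complex.norm_real, Real.norm_eq_abs]
  gcongr
  exact hB _ (H.zMap_scaled_mem hs hs1 hW m).2

theorem summable_gradSeries : Summable fun m : ℕ =>
    (τ : ℂ) ^ m * (kerM W (s * ratioQ ri re ε ^ m) *
      F₁ (zMap ri re ε ((s * ratioQ ri re ε ^ m : ℝ) * W))) := by
  have hB0 : 0 ≤ B := (norm_nonneg _).trans (hB _ (zero_mem_closedBall H.re_pos))
  refine Summable.of_norm_bounded
    ((summable_geometric_of_lt_one (abs_nonneg τ) hτ).mul_right (1 * B)) fun m => ?_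
  refine (H.norm_gradSeries_term_le hB hτ hs hs1 hW m).trans ?_
  obtain ⟨h1, h2⟩ := H.scaled_pow_mem hs hs1 m
  gcongr
  exact norm_kerM_le_one (hW.trans H.rhoE_lt_one) h1 h2

theorem norm_gradSeries_le_of_ratio_le {q₀ : ℝ} (hq₀ : ratioQ ri re ε ≤ q₀) (hq₁ : q₀ < 1) :
    ‖gradSeries ri re ε τ (ratioQ ri re ε) s F₁ W‖ ≤ 4 / (1 - q₀) ^ 2 * B * (1 - q₀)⁻¹ := by
  have hB0 : 0 ≤ B := (norm_nonneg _).trans (hB _ (zero_mem_closedBall H.re_pos))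
  have hq := H.ratioQ_pos
  have hW1 := hW.trans H.rhoE_lt_one
  have hq0 : 0 < 1 - q₀ := by linarith
  rw [gradSeries]
  refine tsum_of_norm_bounded
    ((hasSum_geometric_of_lt_one (hq.le.trans hq₀) hq₁).mul_left (4 / (1 - q₀) ^ 2 * B))
    fun m => ?_
  obtain ⟨h1, h2⟩ := H.scaled_pow_mem hs hs1 m
  have hτm : |τ| ^ m ≤ 1 := pow_le_one₀ (abs_nonneg _) hτ.le
  refine (H.norm_gradSeries_term_le hB hτ hs hs1 hW m).trans ?_
  refine (mul_le_of_le_one_left (by positivity) hτm).trans ?_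
  rw [mul_assoc, mul_comm B, ← mul_assoc]
  refine mul_le_mul_of_nonneg_right ?_ hB0
  have hxq : s * ratioQ ri re ε ^ m ≤ q₀ ^ m :=
    (mul_le_of_le_one_left (by positivity) hs1).trans (pow_le_pow_left₀ hq.le hq₀ m)
  -- For `m = 0` the argument may be `1`, where the bound `4x/(1 - x)²` is unavailable; the trivial
  -- bound `1` is used instead.
  rcases Nat.eq_zero_or_pos m with rfl | hm
  · refine (norm_kerM_le_one hW1 h1 h2).trans ?_
    rw [pow_zero, mul_one, le_div_iff₀ (by positivity)]
    nlinarith [hq.le.trans hq₀]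
  · have h3 : q₀ ^ m ≤ q₀ := pow_le_of_le_one (hq.le.trans hq₀) hq₁.le hm.ne'
    have h4 : s * ratioQ ri re ε ^ m ≤ q₀ := hxq.trans h3
    refine (norm_kerM_le hW1 h1 (h4.trans_lt hq₁)).trans ?_
    rw [div_mul_eq_mul_div]
    have hq₀' := hq.le.trans hq₀
    gcongr

include E in
/-- Replacing the derivative of the extension by its value at the origin costs `O(1)`. -/
theorem norm_gradSeries_sub_le {c₁ c₂ : ℝ} (hc₂ : 0 ≤ c₂)
    (h₁ : alpha ri re ε + x0 ri re ε ≤ c₁ * (1 - ratioQ ri re ε))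
    (h₂ : 1 - ratioQ ri re ε ≤ c₂ * (1 - rhoE ri re ε)) :
    ‖gradSeries ri re ε τ (ratioQ ri re ε) s F₁ W -
      F₁ 0 * ∑' m : ℕ, (τ : ℂ) ^ m * kerM W (s * ratioQ ri re ε ^ m)‖ ≤
      L * (2 * c₁) * (27 * (1 + c₂)) := by
  have hq := H.ratioQ_pos
  have hq1 := H.ratioQ_lt_one
  have hW1 := hW.trans H.rhoE_lt_one
  have hL := E.nonneg
  have hc₁ : 0 ≤ c₁ := by
    by_contra! h
    have := H.alpha_pos
    have := H.x0_pos
    nlinarith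
  have hu : 1 - ratioQ ri re ε ≤ c₂ * ‖1 + W‖ := by
    refine h₂.trans (mul_le_mul_of_nonneg_left ?_ hc₂)
    have h3 := one_sub_le_norm_one_add_mul hW1 zero_le_one
    have h4 := norm_sub_norm_le (1 : ℂ) (-W)
    rw [norm_one, norm_neg, sub_neg_eq_add] at h4
    linarith
  have hsum := sum_norm_kerM_div_le hW1 hs hs1 hq.le hq1 hu
  have hnn : ∀ m : ℕ, 0 ≤ (1 - ratioQ ri re ε) * (‖kerM W (s * ratioQ ri re ε ^ m)‖ /
      ‖1 + (s * ratioQ ri re ε ^ m : ℝ) * W‖) := fun m =>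
    mul_nonneg (by linarith) (by positivity)
  have hsb : Summable fun m : ℕ => (1 - ratioQ ri re ε) *
      (‖kerM W (s * ratioQ ri re ε ^ m)‖ / ‖1 + (s * ratioQ ri re ε ^ m : ℝ) * W‖) :=
    summable_of_sum_range_le hnn hsum
  rw [gradSeries, ← tsum_mul_left, ← (H.summable_gradSeries hB hτ hs hs1 hW).tsum_sub
    ((summable_kerSum hW1 hτ hs hs1 hq.le hq1.le).mul_left _)]
  refine (tsum_of_norm_bounded (hsb.mul_left (L * (2 * c₁))).hasSum fun m => ?_).trans ?_
  · obtain ⟨h5, h6⟩ := H.zMap_scaled_mem hs hs1 hW m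
    have e : (τ : ℂ) ^ m * (kerM W (s * ratioQ ri re ε ^ m) *
        F₁ (zMap ri re ε ((s * ratioQ ri re ε ^ m : ℝ) * W))) -
        F₁ 0 * ((τ : ℂ) ^ m * kerM W (s * ratioQ ri re ε ^ m)) =
        (τ : ℂ) ^ m * (kerM W (s * ratioQ ri re ε ^ m) *
          (F₁ (zMap ri re ε ((s * ratioQ ri re ε ^ m : ℝ) * W)) - F₁ 0)) := by ring
    rw [e, norm_mul]
    refine (mul_le_of_le_one_left (norm_nonneg _) (norm_pow_le_one (by
      rw [Complex.norm_real, Real.norm_eq_abs]; exact hτ.le) m)).trans ?_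
    rw [norm_mul]
    have h7 := E.lip _ h6 0 (zero_mem_closedBall H.re_pos)
    rw [sub_zero] at h7
    have h8 := H.norm_zMap_le h5
    have h9 : 0 ≤ 1 / ‖1 + (s * ratioQ ri re ε ^ m : ℝ) * W‖ := by positivity
    calc ‖kerM W (s * ratioQ ri re ε ^ m)‖ *
          ‖F₁ (zMap ri re ε ((s * ratioQ ri re ε ^ m : ℝ) * W)) - F₁ 0‖
        ≤ ‖kerM W (s * ratioQ ri re ε ^ m)‖ *
          (L * (2 * (c₁ * (1 - ratioQ ri re ε)) *
            (1 / ‖1 + (s * ratioQ ri re ε ^ m : ℝ) * W‖))) := by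
          gcongr
          refine h7.trans (mul_le_mul_of_nonneg_left (h8.trans ?_) hL)
          gcongr
      _ = _ := by ring
  · rw [tsum_mul_left]
    exact mul_le_mul_of_nonneg_left (hsb.tsum_le_of_sum_range_le hsum) (by positivity)

end Admissible

section Uniform

variable {ri re : ℝ} (hri : 0 < ri) (hrire : ri < re) {F F₁ : ℂ → ℂ} {L : ℝ}
  (E : IsExtension re F F₁ L)

include hri hrire E

/-- For `ε` bounded away from `0` the series of images is bounded. -/
theorem exists_gradSeries_bound_of_le {ε₁ : ℝ} (hε₁ : 0 < ε₁) :
    ∃ C, ∀ ε, Admissible ri re ε → ε₁ ≤ ε → ∀ τ : ℝ, |τ| < 1 → ∀ s, 0 ≤ s → s ≤ 1 →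
      ∀ W : ℂ, ‖W‖ < rhoE ri re ε →
        ‖gradSeries ri re ε τ (ratioQ ri re ε) s F₁ W‖ ≤ C := by
  obtain ⟨B, -, -, hB⟩ := E.exists_bound
  obtain ⟨q₀, ρ₀, -, hq1, -, h⟩ := exists_large_params hri hrire hε₁
  exact ⟨_, fun ε H hε τ hτ s hs hs1 W hW =>
    H.norm_gradSeries_le_of_ratio_le hB hτ hs hs1 hW (h ε H hε).1 hq1⟩

/-- The series of images is `O(1 / (1 - τ))`, uniformly in all parameters. -/
theorem exists_one_sub_mul_gradSeries_bound :
    ∃ C, 0 ≤ C ∧ ∀ ε, Admissible ri re ε → ∀ τ : ℝ, |τ| < 1 → ∀ s, 0 ≤ s → s ≤ 1 →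
      ∀ W : ℂ, ‖W‖ < rhoE ri re ε →
        (1 - τ) * ‖gradSeries ri re ε τ (ratioQ ri re ε) s F₁ W‖ ≤ C := by
  obtain ⟨B, hB0, -, hB⟩ := E.exists_bound
  obtain ⟨ε₁, hε₁, c₁, c₂, c₃, J, hc₁, hc₂, -, hsmall⟩ := exists_small_params hri hrire
  obtain ⟨C, hC⟩ := exists_gradSeries_bound_of_le hri hrire E hε₁
  have hL := E.nonneg
  refine ⟨max (2 * |C|) (2 * (L * (2 * c₁) * (27 * (1 + c₂))) + B * (1 + 27)),
    (by positivity : 0 ≤ 2 * |C|).trans (le_max_left _ _), fun ε H τ hτ s hs hs1 W hW => ?_⟩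
  have hτ' := abs_lt.1 hτ
  have h0 : 0 ≤ 1 - τ := by linarith
  have h2 : 1 - τ ≤ 2 := by linarith
  rcases le_or_gt ε₁ ε with hε | hε
  · refine le_trans ?_ (le_max_left _ _)
    exact mul_le_mul h2 ((hC ε H hε τ hτ s hs hs1 W hW).trans (le_abs_self _))
      (norm_nonneg _) (by norm_num)
  · refine le_trans ?_ (le_max_right _ _)
    obtain ⟨g1, g2, -, -⟩ := hsmall ε H hε
    have h3 := H.norm_gradSeries_sub_le E hB hτ hs hs1 hW hc₂ g1 g2
    have h4 := norm_one_sub_mul_kerSum_le (hW.trans H.rhoE_lt_one) hτ hs hs1 H.ratioQ_pos.le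
      H.ratioQ_lt_one.le
    set S := ∑' m : ℕ, (τ : ℂ) ^ m * kerM W (s * ratioQ ri re ε ^ m)
    set G := gradSeries ri re ε τ (ratioQ ri re ε) s F₁ W
    have e1 : ‖(1 - τ : ℂ)‖ = 1 - τ := by
      rw [← Complex.ofReal_one, ← Complex.ofReal_sub, Complex.norm_real, Real.norm_of_nonneg h0]
    rw [norm_mul, e1] at h4
    have h5 : ‖G‖ ≤ ‖G - F₁ 0 * S‖ + ‖F₁ 0‖ * ‖S‖ := by
      rw [← norm_mul]
      exact norm_le_norm_sub_add _ _
    have hA := hB 0 (zero_mem_closedBall H.re_pos)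
    calc (1 - τ) * ‖G‖ ≤ (1 - τ) * (‖G - F₁ 0 * S‖ + ‖F₁ 0‖ * ‖S‖) := by gcongr
      _ = (1 - τ) * ‖G - F₁ 0 * S‖ + ‖F₁ 0‖ * ((1 - τ) * ‖S‖) := by ring
      _ ≤ _ := by gcongr

/-- The series of images is within `O(1)` of the integral that defines the singular part. -/
theorem exists_gradSeries_sub_kerIntegral_bound :
    ∃ C, ∀ ε, Admissible ri re ε → ∀ l > 0, ∀ W : ℂ, ‖W‖ < rhoE ri re ε →
      ∀ s, rhoI ri re ε ^ 2 ≤ s → s ≤ 1 → ∀ s', rhoI ri re ε ^ 2 ≤ s' → s' ≤ 1 →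
      s' * ‖W‖ ≤ rhoI ri re ε →
        ‖gradSeries ri re ε (Real.exp (-l)) (ratioQ ri re ε) s F₁ W -
          F₁ 0 * kerIntegral W l (4 * Real.sqrt ε / rStar ri re) s'‖ ≤ C ∧
        ‖gradSeries ri re ε (Real.exp (-l)) (ratioQ ri re ε) s F₁ W -
          Real.exp (-l) * (F₁ 0 * kerIntegral W l (4 * Real.sqrt ε / rStar ri re) s')‖ ≤ C := by
  obtain ⟨B, hB0, -, hB⟩ := E.exists_bound
  obtain ⟨ε₁, hε₁, c₁, c₂, c₃, J, hc₁, hc₂, hc₃, hsmall⟩ := exists_small_params hri hrire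
  obtain ⟨C, hC⟩ := exists_gradSeries_bound_of_le hri hrire E hε₁
  obtain ⟨_, ρ₀, -, -, hρ₀, hlarge⟩ := exists_large_params hri hrire hε₁
  have hL := E.nonneg
  have hr := rStar_pos hri hrire
  -- The constant for `ε ≥ ε₁`: series and integral are bounded separately.
  set C₁ := C + B * (4 / (1 - ρ₀) ^ 2 / (4 * Real.sqrt ε₁ / rStar ri re)) with hC₁
  -- For `ε < ε₁` the terms pay, in order, for freezing `F₁` at `0`, passing from sum to integral,
  -- replacing the rate `h` by `4√ε/r_*`, and inserting the factor `τ`.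
  set C₂ := L * (2 * c₁) * (27 * (1 + c₂)) + B * ((1 + 27 * (J + 1)) + 108 * c₃) + B with hC₂
  refine ⟨max C₁ C₂, fun ε H l hl W hW s hs hs1 s' hs' hs1' hsW => ?_⟩
  have hρ2 : 0 < rhoI ri re ε ^ 2 := by have := H.rhoI_pos; positivity
  have hs0 := hρ2.le.trans hs
  have hs0' := hρ2.le.trans hs'
  have hW1 := hW.trans H.rhoE_lt_one
  have hτ1 : Real.exp (-l) < 1 := Real.exp_lt_one_iff.2 (by linarith)
  have hτ0 := Real.exp_pos (-l)
  have hτ : |Real.exp (-l)| < 1 := by rw [abs_of_pos hτ0]; exact hτ1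
  have hA := hB 0 (zero_mem_closedBall H.re_pos)
  have hε0 := H.eps_pos
  have hh₀ : 0 < 4 * Real.sqrt ε / rStar ri re := by positivity
  have hτn : ‖(Real.exp (-l) : ℂ)‖ = Real.exp (-l) := by
    rw [Complex.norm_real, Real.norm_of_nonneg hτ0.le]
  rcases le_or_gt ε₁ ε with hε | hε
  · have h1 := hC ε H hε _ hτ s hs0 hs1 W hW
    have h2 := norm_kerIntegral_le hW1 hl hh₀ hs0' hs1' (hsW.trans (hlarge ε H hε).2) hρ₀
    have h3 : 4 / (1 - ρ₀) ^ 2 / (4 * Real.sqrt ε / rStar ri re) ≤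
        4 / (1 - ρ₀) ^ 2 / (4 * Real.sqrt ε₁ / rStar ri re) := by gcongr
    set I := kerIntegral W l (4 * Real.sqrt ε / rStar ri re) s'
    have h4 : ‖F₁ 0 * I‖ ≤ B * (4 / (1 - ρ₀) ^ 2 / (4 * Real.sqrt ε₁ / rStar ri re)) := by
      rw [norm_mul]
      exact mul_le_mul hA (h2.trans h3) (norm_nonneg _) hB0
    refine ⟨((norm_sub_le _ _).trans (add_le_add h1 h4)).trans (le_max_left _ _),
      ((norm_sub_le _ _).trans (add_le_add h1 (le_trans ?_ h4))).trans (le_max_left _ _)⟩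
    rw [norm_mul, hτn]
    exact mul_le_of_le_one_left (norm_nonneg _) hτ1.le
  · obtain ⟨g1, g2, g3, p, hp, g4, g5, g6⟩ := hsmall ε H hε
    have h1 := H.norm_gradSeries_sub_le E hB hτ hs0 hs1 hW hc₂ g1 g2
    have h2 := norm_kerSum_sub_kerIntegral_le (l := l) (h := stepH ri re ε) (s := s) (s' := s')
      (J := J) hW1 hl H.stepH_pos (by rw [H.exp_neg_stepH]; exact g3.trans hs) hs1
      (by rw [H.exp_neg_stepH]; exact g3.trans hs') hs1'
    rw [H.exp_neg_stepH] at h2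
    have h3 := norm_kerIntegral_sub_le hW1 hl hp g4 g5 hs0' hs1'
    have h3' : 108 * |stepH ri re ε - 4 * Real.sqrt ε / rStar ri re| / p ^ 2 ≤ 108 * c₃ := by
      rw [div_le_iff₀ (by positivity)]
      linarith
    have h4 := norm_one_sub_mul_kerIntegral_le hW1 hl hh₀.le hs0' hs1'
    set S := ∑' m : ℕ, (Real.exp (-l) : ℂ) ^ m * kerM W (s * ratioQ ri re ε ^ m)
    set G := gradSeries ri re ε (Real.exp (-l)) (ratioQ ri re ε) s F₁ W
    set I := kerIntegral W l (4 * Real.sqrt ε / rStar ri re) s'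
    set I' := kerIntegral W l (stepH ri re ε) s'
    have h5 : ‖G - F₁ 0 * I‖ ≤ L * (2 * c₁) * (27 * (1 + c₂)) +
        B * ((1 + 27 * (J + 1)) + 108 * c₃) := by
      have e : G - F₁ 0 * I = (G - F₁ 0 * S) + F₁ 0 * ((S - I') + (I' - I)) := by ring
      rw [e]
      refine (norm_add_le _ _).trans (add_le_add h1 ?_)
      rw [norm_mul]
      refine mul_le_mul hA ?_ (norm_nonneg _) hB0
      exact (norm_add_le _ _).trans (add_le_add h2 (h3.trans h3'))
    refine ⟨(h5.trans (by rw [hC₂]; linarith)).trans (le_max_right _ _), ?_⟩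
    have e : G - Real.exp (-l) * (F₁ 0 * I) =
        (G - F₁ 0 * I) + F₁ 0 * (((1 - Real.exp (-l) : ℝ) : ℂ) * I) := by push_cast; ring
    rw [e]
    refine ((norm_add_le _ _).trans (add_le_add h5 ?_)).trans (le_max_right _ _)
    rw [norm_mul, norm_mul, Complex.norm_real, Real.norm_of_nonneg (by linarith)]
    calc ‖F₁ 0‖ * ((1 - Real.exp (-l)) * ‖I‖) ≤ B * 1 := by gcongr
      _ = B := mul_one B

end Uniform

/-! ### The gradient of the solution -/

/-- Numerator and denominator have equal modulus; the inequality also covers the degenerate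
quotients at `W = 0` and `W = -1`. -/
theorem norm_phaseSq_le_one (W : ℂ) : ‖phaseSq W‖ ≤ 1 := by
  rw [phaseSq, norm_div, norm_mul, norm_mul, RCLike.norm_conj, RCLike.norm_conj,
    mul_comm ‖(1 + W) ^ 2‖]
  exact div_self_le_one _

section Bounds

variable {ri re : ℝ} (hri : 0 < ri) (hrire : ri < re) {F F₁ : ℂ → ℂ} {L : ℝ}
  (E : IsExtension re F F₁ L)

/-- Continuity of `F₁` up to the boundary point `0` provides the limit that defines `(C₁, C₂)`. -/
theorem tendsto_gradient_re (hri : 0 < ri) (hrire : ri < re) (E : IsExtension re F F₁ L)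
    {u : ℂ → ℝ} (hu : ∀ x ∈ Metric.ball (re : ℂ) re, u x = (F x).re) :
    Tendsto (fun x => gradient u x) (𝓝[Omega re] 0) (𝓝 ((starRingEnd ℂ) (F₁ 0))) := by
  have h0 : Tendsto F₁ (𝓝[Omega re] 0) (𝓝 (F₁ 0)) :=
    (E.cont_deriv 0 (zero_mem_closedBall (hri.trans hrire))).mono_left
      (nhdsWithin_mono _ Metric.ball_subset_closedBall)
  refine ((Complex.continuous_conj.tendsto _).comp h0).congr' ?_
  filter_upwards [self_mem_nhdsWithin] with x hx
  refine (((hasGradientAt_re (E.deriv x hx)).congr_of_eventuallyEq ?_).gradient).symm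
  filter_upwards [Metric.isOpen_ball.mem_nhds hx] with y hy using hu y hy

include hri hrire E

theorem exists_gradient_inside_bound {g : ℂ → ℝ}
    (hF : ∀ z ∈ Metric.sphere (re : ℂ) re, (F z).re = g z) :
    ∃ C : ℝ, ∀ ε k : ℝ, 0 < ε → ε < re - ri → 0 < k →
      ∀ v : ℂ → ℝ, IsSolution ri re ε k g v → ∀ x ∈ Inclusion ri ε, ‖gradient v x‖ ≤ C := by
  obtain ⟨C, -, hC⟩ := exists_one_sub_mul_gradSeries_bound hri hrire E
  refine ⟨C, fun ε k hε hε' hk v hv x hx => ?_⟩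
  have H : Admissible ri re ε := ⟨hri, hrire, hε, hε'⟩
  have hτ := abs_tau_lt_one hk
  have h0 : 0 ≤ 1 - tau k := by linarith [(abs_lt.1 hτ).2]
  have hx' := H.closedBall_subset (Metric.ball_subset_closedBall hx)
  rw [hv.gradient_inside H hk E hF hx, RCLike.norm_conj, norm_mul, Complex.norm_real,
    Real.norm_of_nonneg h0]
  exact hC ε H _ hτ 1 zero_le_one le_rfl _
    ((H.norm_wMap_lt_rhoE_iff (H.add_ne_zero_of_mem (Metric.ball_subset_closedBall hx'))).2 hx')

theorem exists_gradient_outside_bound {g : ℂ → ℝ}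
    (hF : ∀ z ∈ Metric.sphere (re : ℂ) re, (F z).re = g z) {ε₀ K : ℝ} (hε₀ : 0 < ε₀) :
    ∃ C : ℝ, ∀ ε k : ℝ, 0 < ε → ε < re - ri → 0 < k → (ε₀ ≤ ε ∨ k ≤ K) →
      ∀ v : ℂ → ℝ, IsSolution ri re ε k g v →
        ∀ x ∈ Omega re \ closure (Inclusion ri ε), ‖gradient v x‖ ≤ C := by
  obtain ⟨C₁, hC₁⟩ := exists_gradSeries_bound_of_le hri hrire E hε₀
  obtain ⟨C₂, hC₂0, hC₂⟩ := exists_one_sub_mul_gradSeries_bound hri hrire E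
  refine ⟨2 * max C₁ ((K + 1) / 2 * C₂), fun ε k hε hε' hk hεk v hv x hx => ?_⟩
  have H : Admissible ri re ε := ⟨hri, hrire, hε, hε'⟩
  have hτ := abs_tau_lt_one hk
  have key : ∀ s, 0 ≤ s → s ≤ 1 → ∀ W : ℂ, ‖W‖ < rhoE ri re ε →
      ‖gradSeries ri re ε (tau k) (ratioQ ri re ε) s F₁ W‖ ≤ max C₁ ((K + 1) / 2 * C₂) := by
    intro s hs hs1 W hW
    rcases hεk with h | h
    · exact (hC₁ ε H h _ hτ s hs hs1 W hW).trans (le_max_left _ _)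
    · refine le_trans ?_ (le_max_right _ _)
      have h1 := hC₂ ε H _ hτ s hs hs1 W hW
      -- `1/(1 - τ) = (k + 1)/2`, so a bound on `k` turns the `O(1/(1 - τ))` estimate into a uniform
      -- one.
      have h2 : (k + 1) / 2 * (1 - tau k) = 1 := by
        rw [tau]
        field_simp
        ring
      calc ‖gradSeries ri re ε (tau k) (ratioQ ri re ε) s F₁ W‖
          = (k + 1) / 2 * ((1 - tau k) *
            ‖gradSeries ri re ε (tau k) (ratioQ ri re ε) s F₁ W‖) := by
            rw [← mul_assoc, h2, one_mul]
        _ ≤ (K + 1) / 2 * C₂ := mul_le_mul (by linarith) h1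
            (mul_nonneg (by linarith [(abs_lt.1 hτ).2]) (norm_nonneg _)) (by linarith)
  rw [hv.gradient_outside H hk E hF hx, RCLike.norm_conj]
  have hx' := hx
  rw [Omega, Inclusion, closure_ball _ H.ri_pos.ne'] at hx'
  obtain ⟨hw1, hw2⟩ := H.wMap_eq_zero_or_mem hx'
  have hw0 := H.rhoI_pos.trans hw1
  have hr1 : rhoI ri re ε ^ 2 / ‖wMap ri re ε x‖ ^ 2 ≤ 1 := by
    rw [div_le_one (by positivity)]
    have := H.rhoI_pos
    gcongr
  have h1 := key 1 zero_le_one le_rfl _ hw2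
  have h2 := key _ (by positivity) hr1 _ hw2
  refine (norm_add_le _ _).trans ?_
  rw [norm_mul, norm_mul, RCLike.norm_conj, Complex.norm_real, Real.norm_eq_abs, two_mul]
  refine add_le_add h1 (le_trans (mul_le_of_le_one_left (norm_nonneg _) ?_) h2)
  exact mul_le_one₀ hτ.le (norm_nonneg _) (norm_phaseSq_le_one _)

end Bounds

/-! ### The singular part in the coordinate `W = e^{-(ξ + iθ)}` -/

theorem norm_exp_neg_add_mul_I (ξ θ : ℝ) :
    ‖Complex.exp (-(ξ + θ * Complex.I))‖ = Real.exp (-ξ) := by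
  rw [Complex.norm_exp]
  simp

/-- `|1 + W|²/|W| = e^ξ + 2 cos θ + e^{-ξ}`. -/
theorem cosh_add_cos_eq (ξ θ : ℝ) :
    Real.cosh ξ + Real.cos θ = ‖(1 + Complex.exp (-(ξ + θ * Complex.I))) ^ 2 /
      Complex.exp (-(ξ + θ * Complex.I))‖ / 2 := by
  have hre : (Complex.exp (-(ξ + θ * Complex.I))).re = Real.exp (-ξ) * Real.cos θ := by
    rw [Complex.exp_re]; simp
  have him : (Complex.exp (-(ξ + θ * Complex.I))).im = -(Real.exp (-ξ) * Real.sin θ) := by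
    rw [Complex.exp_im]; simp
  have h1 : ‖1 + Complex.exp (-(ξ + θ * Complex.I))‖ ^ 2 =
      1 + 2 * (Real.exp (-ξ) * Real.cos θ) + Real.exp (-ξ) ^ 2 := by
    rw [← Complex.normSq_eq_norm_sq, Complex.normSq_apply, Complex.add_re, Complex.add_im, hre,
      him, Complex.one_re, Complex.one_im]
    linear_combination Real.exp (-ξ) ^ 2 * Real.sin_sq_add_cos_sq θ
  rw [norm_div, norm_pow, norm_exp_neg_add_mul_I, h1, Real.cosh_eq, Real.exp_neg]
  have := (Real.exp_pos ξ).ne'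
  field_simp
  ring

theorem bipolar_eq (α ξ θ : ℝ) :
    bipolar α ξ θ = α * ((1 - Complex.exp (-(ξ + θ * Complex.I))) /
      (1 + Complex.exp (-(ξ + θ * Complex.I)))) := by
  rw [bipolar, Complex.exp_neg]
  have h := Complex.exp_ne_zero (ξ + θ * Complex.I)
  generalize Complex.exp (ξ + θ * Complex.I) = e at *
  have e1 : 1 - e⁻¹ = (e - 1) / e := by field_simp
  have e2 : 1 + e⁻¹ = (e + 1) / e := by field_simp
  rw [e1, e2, div_div_div_cancel_right₀ h]

/-- The logarithmic derivative of `(α + z)/(α - z)` is `(1 + W)²/W` divided by `2α`; the positive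
factor disappears on normalising, and the gradient is the conjugate. -/
theorem eXi_bipolar {α : ℝ} (hα : 0 < α) {W : ℂ} (hW : W ≠ 0) (hW1 : 1 + W ≠ 0) :
    eXi α (α * ((1 - W) / (1 + W))) = (starRingEnd ℂ)
      ((‖(1 + W) ^ 2 / W‖⁻¹ : ℝ) * ((1 + W) ^ 2 / W)) := by
  have hα' : (α : ℂ) ≠ 0 := by exact_mod_cast hα.ne'
  set z : ℂ := α * ((1 - W) / (1 + W)) with hz
  have e1 : α - z = 2 * α * W / (1 + W) := by rw [hz]; field_simp; ring
  have e2 : α + z = 2 * α / (1 + W) := by rw [hz]; field_simp; ring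
  have h1 : α - z ≠ 0 := by
    rw [e1]; exact div_ne_zero (mul_ne_zero (mul_ne_zero two_ne_zero hα') hW) hW1
  have h2 : α + z ≠ 0 := by
    rw [e2]; exact div_ne_zero (mul_ne_zero two_ne_zero hα') hW1
  have hd : HasDerivAt (fun w : ℂ => (α + w) / (α - w)) (2 * α / (α - z) ^ 2) z := by
    refine (((hasDerivAt_id z).const_add (α : ℂ)).div ((hasDerivAt_id z).const_sub (α : ℂ))
      h1).congr_deriv ?_
    simp only [id]
    ring
  have hg := (hasGradientAt_log_norm hd (div_ne_zero h2 h1)).gradient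
  have e3 : 2 * α / (α - z) ^ 2 / ((α + z) / (α - z)) =
      ((2 * α)⁻¹ : ℝ) * ((1 + W) ^ 2 / W) := by
    rw [e1, e2]
    push_cast
    field_simp
  rw [e3] at hg
  have hg' : gradient (xiCoord α) z = (starRingEnd ℂ) (((2 * α)⁻¹ : ℝ) * ((1 + W) ^ 2 / W)) := hg
  rw [eXi, hg', RCLike.norm_conj, norm_mul, Complex.norm_real,
    Real.norm_of_nonneg (by positivity : 0 ≤ (2 * α)⁻¹), map_mul, map_mul, Complex.conj_ofReal,
    Complex.conj_ofReal, Complex.real_smul, ← mul_assoc, ← Complex.ofReal_mul, mul_inv, mul_comm,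
    mul_comm (((2 * α)⁻¹)⁻¹), mul_assoc (‖(1 + W) ^ 2 / W‖⁻¹),
    inv_mul_cancel₀ (by positivity : (2 * α)⁻¹ ≠ 0), mul_one, mul_comm]

/-- Substitute `u = ht` and use `kerM W x = ((1 + W)²/W) · xW/(1 + xW)²`. -/
theorem kerIntegral_eq_P {W : ℂ} (hW : W ≠ 0) (l : ℝ) {h : ℝ} (hh : 0 < h) (s : ℝ) :
    h * kerIntegral W l h s = (1 + W) ^ 2 / W * P (s * W) (l / h) := by
  have hcomp := MeasureTheory.integral_comp_mul_left_Ioi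
    (fun u : ℝ => (1 + W) ^ 2 / W * (s * W * Complex.exp (-((l / h : ℝ) + 1) * u) /
      (1 + s * W * Complex.exp (-u)) ^ 2)) 0 hh
  rw [mul_zero, Complex.real_smul] at hcomp
  have hh' : (h : ℂ) ≠ 0 := by exact_mod_cast hh.ne'
  rw [P, ← MeasureTheory.integral_const_mul]
  rw [eq_comm, ← inv_mul_eq_iff_eq_mul₀ hh', ← Complex.ofReal_inv, ← hcomp, kerIntegral]
  refine MeasureTheory.setIntegral_congr_fun measurableSet_Ioi fun t _ => ?_
  have e1 : Complex.exp (-((l / h : ℝ) + 1) * (h * t : ℝ)) =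
      Real.exp (-(l * t)) * Real.exp (-(h * t)) := by
    rw [← Complex.ofReal_mul, ← Real.exp_add, Complex.ofReal_exp]
    congr 1
    push_cast
    field_simp
    ring
  have e2 : Complex.exp (-(h * t : ℝ)) = Real.exp (-(h * t)) := by push_cast; rfl
  simp only [kerM]
  rw [e1, e2]
  push_cast
  rw [mul_right_comm (s : ℂ) W]
  field_simp

theorem phaseSq_eq {W : ℂ} (hW : W ≠ 0) (hW1 : 1 + W ≠ 0) :
    phaseSq W = ((‖(1 + W) ^ 2 / W‖⁻¹ : ℝ) * ((1 + W) ^ 2 / W)) ^ 2 := by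
  have h1 : (1 + W) ^ 2 / W ≠ 0 := div_ne_zero (pow_ne_zero _ hW1) hW
  have h2 := Complex.mul_conj' ((1 + W) ^ 2 / W)
  have h3 : phaseSq W = (1 + W) ^ 2 / W / (starRingEnd ℂ) ((1 + W) ^ 2 / W) := by
    rw [phaseSq, map_div₀, div_div_div_eq, mul_comm W]
  have h4 : (starRingEnd ℂ) ((1 + W) ^ 2 / W) ≠ 0 := (map_ne_zero _).2 h1
  rw [h3]
  generalize (1 + W) ^ 2 / W = b at *
  rw [mul_pow, Complex.ofReal_inv, inv_pow, ← h2]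
  field_simp

/-- Write `(1 + W)²/W = |b| B` with `|B| = 1`; the integral times `A` is then a positive multiple of
`|b| B A P`. The phase `B²` turns the conjugate of this into the same multiple of `|b| B conj (A
P)`, so the sum is `2|b| Re (A P)` in the direction `B`, whose conjugate is `e_ξ`. -/
theorem singularPart_smul_eXi {ri re ε k ξ θ s s' α : ℝ} (hr : 0 < rStar ri re) (hε : 0 < ε)
    (hα : 0 < α) (hτ : 0 < tau k) {W : ℂ} (hWdef : W = Complex.exp (-(ξ + θ * Complex.I)))
    (hW1 : 1 + W ≠ 0) (hs : Complex.exp (-s - θ * Complex.I) = s' * W) (A : ℂ) :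
    singularPart ri re ε k A.re (-A.im) ξ θ s • eXi α (bipolar α ξ θ) =
      (starRingEnd ℂ) (tau k * (A * kerIntegral W (-Real.log (tau k))
          (4 * Real.sqrt ε / rStar ri re) s') +
        tau k * phaseSq W * (starRingEnd ℂ) (A * kerIntegral W (-Real.log (tau k))
          (4 * Real.sqrt ε / rStar ri re) s')) := by
  have hW : W ≠ 0 := hWdef ▸ Complex.exp_ne_zero _
  have hh : 0 < 4 * Real.sqrt ε / rStar ri re := by positivity
  have hb : beta ri re ε k = -Real.log (tau k) / (4 * Real.sqrt ε / rStar ri re) := by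
    rw [beta, abs_of_pos hτ]
    field_simp
  have hJ := kerIntegral_eq_P hW (-Real.log (tau k)) hh s'
  rw [← hb] at hJ
  have hb0 : (1 + W) ^ 2 / W ≠ 0 := div_ne_zero (pow_ne_zero _ hW1) hW
  rw [bipolar_eq, ← hWdef, eXi_bipolar hα hW hW1, phaseSq_eq hW hW1, singularPart,
    cosh_add_cos_eq, ← hWdef, hs]
  generalize kerIntegral W (-Real.log (tau k)) (4 * Real.sqrt ε / rStar ri re) s' = J at *
  generalize P (s' * W) (beta ri re ε k) = p at *
  generalize (1 + W) ^ 2 / W = b at *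
  have hn : 0 < ‖b‖ := norm_pos_iff.2 hb0
  have hsq : (Real.sqrt ε : ℂ) ≠ 0 := by exact_mod_cast (Real.sqrt_pos.2 hε).ne'
  have hr' : (rStar ri re : ℂ) ≠ 0 := by exact_mod_cast hr.ne'
  have hn' : (‖b‖ : ℂ) ≠ 0 := by exact_mod_cast hn.ne'
  have hJ' : J = rStar ri re / (4 * Real.sqrt ε) * (b * p) := by
    rw [← hJ]
    push_cast
    field_simp
  have hbb := Complex.mul_conj' b
  have hre : ((A.re * p.re + -A.im * p.im : ℝ) : ℂ) =
      (A * p + (starRingEnd ℂ) (A * p)) / 2 := by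
    rw [Complex.add_conj, Complex.mul_re]
    push_cast
    ring
  rw [Complex.real_smul, hJ', Complex.ofReal_mul, hre]
  simp only [map_add, map_mul, map_pow, map_div₀, map_inv₀, Complex.conj_ofReal, Complex.conj_conj,
    map_ofNat, Complex.ofReal_mul, Complex.ofReal_div, Complex.ofReal_inv, Complex.ofReal_ofNat]
  field_simp
  generalize (starRingEnd ℂ) b = b' at *
  linear_combination (-4 * tau k * (A * p) * b') * hbb

namespace Admissible

variable {ri re ε : ℝ} (H : Admissible ri re ε)

include H

/-- The coordinate `W` of a point of `Ω \ D̄`. -/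
theorem zMap_mem_diff {W : ℂ} (hW : rhoI ri re ε < ‖W‖) (hW' : ‖W‖ < rhoE ri re ε) :
    zMap ri re ε W ∈ Omega re \ closure (Inclusion ri ε) := by
  have h1 := hW'.trans H.rhoE_lt_one
  rw [Omega, Inclusion, closure_ball _ H.ri_pos.ne']
  refine ⟨H.zMap_mem_ball hW', fun h => ?_⟩
  rw [← H.norm_wMap_le_rhoI_iff (H.alpha_add_zMap_ne h1), H.wMap_zMap h1] at h
  exact hW.not_ge h

end Admissible

/-- The direct series (scale `1`) and the reflected one (scale `ρᵢ²/|W|²`) are both within `O(1)` of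
an integral with one common scale `s'`, so that they combine into the singular part. The direct
series is matched with `τ` times the integral, because the singular part carries `τ` as an overall
factor. -/
theorem exists_gradient_sub_singularPart_bound {ri re : ℝ} (hri : 0 < ri) (hrire : ri < re)
    {F F₁ : ℂ → ℂ} {L : ℝ} (E : IsExtension re F F₁ L) {g : ℂ → ℝ}
    (hF : ∀ z ∈ Metric.sphere (re : ℂ) re, (F z).re = g z) :
    ∃ C : ℝ, ∀ ε k : ℝ, 0 < ε → ε < re - ri → 1 < k →
      ∀ v : ℂ → ℝ, IsSolution ri re ε k g v →
        ∀ ξ θ : ℝ, xiE ri re ε < ξ → ξ < xiI ri re ε →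
          ∀ s, s = 2 * xiI ri re ε - ξ ∨ s = ξ + 2 * xiI ri re ε →
          ‖gradient v (bipolar (alpha ri re ε) ξ θ - x0 ri re ε) -
              singularPart ri re ε k (F₁ 0).re (-(F₁ 0).im) ξ θ s •
                eXi (alpha ri re ε) (bipolar (alpha ri re ε) ξ θ)‖ ≤ C := by
  obtain ⟨C, hC⟩ := exists_gradSeries_sub_kerIntegral_bound hri hrire E
  refine ⟨C + C, fun ε k hε hε' hk v hv ξ θ hξ hξ' s hs => ?_⟩
  have H : Admissible ri re ε := ⟨hri, hrire, hε, hε'⟩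
  have hk0 : 0 < k := one_pos.trans hk
  have hτ := abs_tau_lt_one hk0
  have hτ0 : 0 < tau k := div_pos (by linarith) (by linarith)
  have hτ1 : tau k < 1 := (abs_lt.1 hτ).2
  have hl : 0 < -Real.log (tau k) := neg_pos.2 (Real.log_neg hτ0 hτ1)
  obtain ⟨W, hW⟩ : ∃ W, W = Complex.exp (-(ξ + θ * Complex.I)) := ⟨_, rfl⟩
  have hWn : ‖W‖ = Real.exp (-ξ) := by rw [hW, norm_exp_neg_add_mul_I]
  have hWI : rhoI ri re ε < ‖W‖ := by
    rw [hWn, ← H.exp_neg_xiI]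
    exact Real.exp_lt_exp.2 (by linarith)
  have hWE : ‖W‖ < rhoE ri re ε := by
    rw [hWn, ← H.exp_neg_xiE]
    exact Real.exp_lt_exp.2 (by linarith)
  have hW1 := hWE.trans H.rhoE_lt_one
  have hρ := H.rhoI_pos
  have hWpos := hρ.trans hWI
  have hr1 : rhoI ri re ε ^ 2 / ‖W‖ ^ 2 ≤ 1 := by
    rw [div_le_one (by positivity)]
    gcongr
  have hr2 : rhoI ri re ε ^ 2 ≤ rhoI ri re ε ^ 2 / ‖W‖ ^ 2 := by
    rw [le_div_iff₀ (by positivity)]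
    exact mul_le_of_le_one_right (by positivity) (pow_le_one₀ (norm_nonneg _) hW1.le)
  have hρ1 : rhoI ri re ε ^ 2 ≤ 1 := pow_le_one₀ hρ.le H.rhoI_lt_one.le
  -- `s = 2ξᵢ - ξ` corresponds to the scale `ρᵢ²/|W|²`, and `s = ξ + 2ξᵢ` to `ρᵢ²`.
  obtain ⟨s', hs1, hs2, hs3, hs4⟩ : ∃ s', rhoI ri re ε ^ 2 ≤ s' ∧ s' ≤ 1 ∧
      s' * ‖W‖ ≤ rhoI ri re ε ∧ Complex.exp (-s - θ * Complex.I) = s' * W := by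
    rcases hs with rfl | rfl
    · refine ⟨rhoI ri re ε ^ 2 / ‖W‖ ^ 2, hr2, hr1, ?_, ?_⟩
      · rw [div_mul_eq_mul_div, div_le_iff₀ (by positivity)]
        have := mul_le_mul_of_nonneg_left hWI.le (mul_pos hρ hWpos).le
        linarith
      · rw [hWn, ← H.exp_neg_xiI, hW, ← Real.exp_nat_mul, ← Real.exp_nat_mul, ← Real.exp_sub,
          Complex.ofReal_exp, ← Complex.exp_add]
        congr 1
        push_cast
        ring
    · refine ⟨rhoI ri re ε ^ 2, le_rfl, hρ1, ?_, ?_⟩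
      · have := mul_le_mul H.rhoI_lt_one.le hW1.le (norm_nonneg W) zero_le_one
        nlinarith
      · rw [← H.exp_neg_xiI, hW, ← Real.exp_nat_mul, Complex.ofReal_exp, ← Complex.exp_add]
        congr 1
        push_cast
        ring
  have hz : bipolar (alpha ri re ε) ξ θ - x0 ri re ε = zMap ri re ε W := by
    rw [bipolar_eq, ← hW, zMap, mul_div_assoc]
  have hgrad := hv.gradient_outside H hk0 E hF (H.zMap_mem_diff hWI hWE)
  rw [H.wMap_zMap hW1] at hgrad
  rw [hz, hgrad, singularPart_smul_eXi (rStar_pos hri hrire) hε H.alpha_pos hτ0 hW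
    (H.one_add_ne_zero hW1) hs4, ← map_sub, RCLike.norm_conj]
  have hexp : Real.exp (-(-Real.log (tau k))) = tau k := by rw [neg_neg, Real.exp_log hτ0]
  have b1 := (hC ε H _ hl W hWE 1 hρ1 le_rfl s' hs1 hs2 hs3).2
  have b2 := (hC ε H _ hl W hWE _ hr2 hr1 s' hs1 hs2 hs3).1
  rw [hexp] at b1 b2
  rw [add_sub_add_comm, ← mul_sub, ← map_sub]
  refine (norm_add_le _ _).trans (add_le_add b1 ?_)
  rw [norm_mul, norm_mul, RCLike.norm_conj, Complex.norm_real, Real.norm_eq_abs]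
  exact (mul_le_of_le_one_left (norm_nonneg _)
    (mul_le_one₀ hτ.le (norm_nonneg _) (norm_phaseSq_le_one _))).trans b2

end DirichletInclusion

end

/-! ### Assembly of the theorem -/

open DirichletInclusion in
theorem mainTheorem3 (ri re : ℝ) (hri : 0 < ri) (hrire : ri < re)
    (δ : ℝ≥0) (hδ : 1 / 2 < δ) (g : ℂ → ℝ) (hg : IsC2Holder re δ g) (hg0 : MeanZero re g) :
    -- the gradient is bounded in the inclusion, uniformly in `(ε, k)`
    (∃ C : ℝ, ∀ ε k : ℝ, 0 < ε → ε < re - ri → 0 < k →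
      ∀ v : ℂ → ℝ, IsSolution ri re ε k g v →
        ∀ x ∈ Inclusion ri ε, ‖gradient v x‖ ≤ C) ∧
    -- outside the inclusion it can blow up only if both `ε → 0` and `k → ∞`
    (∀ ε₀ K : ℝ, 0 < ε₀ → 0 < K → ∃ C : ℝ, ∀ ε k : ℝ, 0 < ε → ε < re - ri → 0 < k →
      (ε₀ ≤ ε ∨ k ≤ K) →
      ∀ v : ℂ → ℝ, IsSolution ri re ε k g v →
        ∀ x ∈ Omega re \ closure (Inclusion ri ε), ‖gradient v x‖ ≤ C) ∧
    -- `C₁`, `C₂` are the first partial derivatives of `H_d` at the origin, a point of `∂Ω`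
    ∃ C₁ C₂ : ℝ, Tendsto (fun x => gradient (Hd re g) x) (𝓝[Omega re] 0) (𝓝 ⟨C₁, C₂⟩) ∧
      -- both asymptotic formulas, with an error that is bounded uniformly in `(ε, k)`
      ∃ C : ℝ, ∀ ε k : ℝ, 0 < ε → ε < re - ri → 1 < k →
        ∀ v : ℂ → ℝ, IsSolution ri re ε k g v →
          ∀ ξ θ : ℝ, xiE ri re ε < ξ → ξ < xiI ri re ε → -Real.pi < θ → θ ≤ Real.pi →
            ∀ z : ℂ, z = bipolar (alpha ri re ε) ξ θ →
            ‖gradient v (z - x0 ri re ε) -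
                singularPart ri re ε k C₁ C₂ ξ θ (2 * xiI ri re ε - ξ) •
                  eXi (alpha ri re ε) z‖ ≤ C ∧
            ‖gradient v (z - x0 ri re ε) -
                singularPart ri re ε k C₁ C₂ ξ θ (ξ + 2 * xiI ri re ε) •
                  eXi (alpha ri re ε) z‖ ≤ C := by
  obtain ⟨F, F₁, L, hL, hcont, hderiv, hF, hlip, hHd⟩ :=
    exists_holomorphic_extension (hri.trans hrire) hδ hg hg0
  have E : IsExtension re F F₁ L := ⟨hL, hcont, hderiv, hlip⟩
  -- The sign in the second constant appears because `(C₁, C₂)` is the conjugate of `F₁ 0`.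
  refine ⟨exists_gradient_inside_bound hri hrire E hF,
    fun ε₀ K hε₀ _ => exists_gradient_outside_bound hri hrire E hF hε₀,
    (F₁ 0).re, -(F₁ 0).im, tendsto_gradient_re hri hrire E hHd, ?_⟩
  obtain ⟨C, hC⟩ := exists_gradient_sub_singularPart_bound hri hrire E hF
  refine ⟨C, fun ε k hε hε' hk v hv ξ θ hξ hξ' _ _ z hz => ?_⟩
  subst hz
  exact ⟨hC ε k hε hε' hk v hv ξ θ hξ hξ' _ (Or.inl rfl),
    hC ε k hε hε' hk v hv ξ θ hξ hξ' _ (Or.inr rfl)⟩
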